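/- Let $(M_p)_{p\in\mathbb N}$ and $(A_p)_{p\in\mathbb N}$ be sequences of positive numbers with $M_0=M_1=A_0=A_1=1$. Assume that both satisfy * $(M.1)$: $M_p^2\le M_{p-1}M_{p+1}$ for $p\ge 1$, and * $(M.2)$: $M_p\le c_0H^p\min_{0\le q\le p}M_{p-q}M_q$ for all $p$, with some $c_0,H\ge 1$, that $M_p$ satisfies * $(M.5)$: there are $q>0$ and $c_0\ge 1$ with $\sum_{j=p+1}^\infty M_{j-1}^q/M_j^q\le c_0\,p\,M_p^q/M_{p+1}^q$ for all $p\ge 1$, and that $A_p$ satisfies * $(M.6)$: $p!\le c_0L_0^pA_p$ for all $p$, with some $c_0,L_0\ge 1$. Let $A(\rho)=\sup_p\log_+(\rho^p/A_p)$. Let $*$ stand for $(M_p)$ (Beurling case) or $\{M_p\}$ (Roumieu case). Let $\eta:\mathbb R^d\to(0,\infty)$ be continuous with $\eta(x+h)\le C\eta(x)e^{A(\tau|h|)}$ for all $x,h\in\mathbb R^d$, for some $C,\tau>0$ in the Beurling case, and for every $\tau>0$ with some $C>0$ depending on $\tau$ in the Roumieu case. Put $\|\varphi\|_{\infty,\eta}=\|\varphi/\eta\|_\infty$,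 let $L^\infty_\eta$ be the space of measurable $\varphi$ with $\|\varphi\|_{\infty,\eta}<\infty$, and let $C_\eta$ be its subspace of continuous $\varphi$ with $\varphi(x)/\eta(x)\to0$ as $|x|\to\infty$. For $E=C_\eta$ or $E=L^\infty_\eta$ and $m>0$ let $\mathcal D^{M_p,m}_E$ be the space of all $\varphi\in C^\infty(\mathbb R^d)$ with $D^\alpha\varphi\in E$ for all $\alpha\in\mathbb N^d$ and $\sup_\alpha m^{|\alpha|}\|D^\alpha\varphi\|_{\infty,\eta}/M_{|\alpha|}<\infty$, normed by this supremum. As locally convex spaces, let $$\mathcal D^{(M_p)}_E=\varprojlim_{m\to\infty}\mathcal D^{M_p,m}_E,\qquad \mathcal D^{\{M_p\}}_E=\varinjlim_{m\to0}\mathcal D^{M_p,m}_E.$$ Put $\dot{\mathcal B}^*_\eta=\mathcal D^*_{C_\eta}$ and let $\mathcal D'^*_{L^1_\eta}$ be the strong dual of $\dot{\mathcal B}^*_\eta$. For every $\varphi\in\mathcal D^*_{L^\infty_\eta}$ there is exactly one continuous linear functional $f\mapsto\langle f,\varphi\rangle$ on $\mathcal D'^*_{L^1_\eta}$ with $\langle\delta_x,\varphi\rangle=\varphi(x)$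 for all $x\in\mathbb R^d$. Let $\mathcal D^*_{L^\infty_\eta,c}$ be the space $\mathcal D^*_{L^\infty_\eta}$ with the topology of compact convex circled convergence from this duality, i.e. of uniform convergence on the compact convex circled subsets of $\mathcal D'^*_{L^1_\eta}$. Then the strong dual $(\mathcal D^*_{L^\infty_\eta,c})'_b$ is isomorphic as a locally convex space to $\mathcal D'^*_{L^1_\eta}$, and the restriction of functionals to $\dot{\mathcal B}^*_\eta\subseteq\mathcal D^*_{L^\infty_\eta,c}$ is such an isomorphism. -/

import Mathlib

open scoped ContDiff
open Filter Topology

noncomputable section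

namespace Ultra

/-! ## Weight sequences and weight functions -/

/-- The two classes: Beurling, `* = (M_p)`, `† = (A_p)`, and Roumieu, `* = {M_p}`, `† = {A_p}`. -/
inductive UltraClass
  | beurling
  | roumieu

/-- Positive sequences with `M_0 = M_1 = 1` that satisfy `(M.1)` and `(M.2)`. -/
structure IsWeightSequence (M : ℕ → ℝ) : Prop where
  pos : ∀ p, 0 < M p
  zero : M 0 = 1
  one : M 1 = 1
  /-- `(M.1)`: logarithmic convexity. -/
  logConvex : ∀ p, M (p + 1) ^ 2 ≤ M p * M (p + 2)
  /-- `(M.2)`: stability under ultradifferential operators. -/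
  stable : ∃ c₀ H : ℝ, 1 ≤ c₀ ∧ 1 ≤ H ∧
    ∀ p q, q ≤ p → M p ≤ c₀ * H ^ p * (M (p - q) * M q)

/-- The assumptions on `M_p`: `(M.1)`, `(M.2)` and `(M.5)`, the latter saying that some power
`M_p ^ q`, `q > 0`, is strongly non-quasianalytic. In the series `j = p + 1 + k`. -/
structure IsMSequence (M : ℕ → ℝ) : Prop extends IsWeightSequence M where
  strongNonQuasianalytic : ∃ q : ℝ, 0 < q ∧ ∃ c₀ : ℝ, 1 ≤ c₀ ∧ ∀ p : ℕ, 1 ≤ p →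
    Summable (fun k : ℕ => M (p + k) ^ q / M (p + k + 1) ^ q) ∧
    ∑' k : ℕ, M (p + k) ^ q / M (p + k + 1) ^ q ≤ c₀ * p * (M p ^ q / M (p + 1) ^ q)

/-- The assumptions on `A_p`: `(M.1)`, `(M.2)` and `(M.6)`, i.e. `p! ⊂ A_p`. -/
structure IsASequence (A : ℕ → ℝ) : Prop extends IsWeightSequence A where
  factorial_le : ∃ c₀ L₀ : ℝ, 1 ≤ c₀ ∧ 1 ≤ L₀ ∧ ∀ p : ℕ, (p.factorial : ℝ) ≤ c₀ * L₀ ^ p * A p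

/-- The associated function `A(ρ) = sup_p log₊ (ρ^p / A_p)` of a sequence with `A_0 = 1`. -/
def assocFun (A : ℕ → ℝ) (ρ : ℝ) : ℝ := ⨆ p : ℕ, Real.posLog (ρ ^ p / A p)

/-- The Euclidean space `ℝ^d`. -/
abbrev Rd (d : ℕ) : Type := EuclideanSpace ℝ (Fin d)

variable {d : ℕ}

/-- The growth condition `η (x + h) ≤ C η(x) exp (A(τ |h|))`, for some `C, τ > 0` in the Beurling
case, and for every `τ > 0` with some `C > 0` in the Roumieu case. -/
def HasUltrapolynomialGrowth : UltraClass → (ℕ → ℝ) → (Rd d → ℝ) → Prop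
  | .beurling, A, η => ∃ τ > 0, ∃ C > 0, ∀ x h : Rd d,
      η (x + h) ≤ C * η x * Real.exp (assocFun A (τ * ‖h‖))
  | .roumieu, A, η => ∀ τ > 0, ∃ C > 0, ∀ x h : Rd d,
      η (x + h) ≤ C * η x * Real.exp (assocFun A (τ * ‖h‖))

/-- Ultrapolynomially bounded weight functions of class `†`. -/
structure IsUltraWeight (cls : UltraClass) (A : ℕ → ℝ) (η : Rd d → ℝ) : Prop where
  continuous : Continuous η
  pos : ∀ x, 0 < η x
  growth : HasUltrapolynomialGrowth cls A η

/-! ## The spaces of ultradifferentiable functions -/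

/-- The classical partial derivative `∂^α φ` of a smooth function, for a multi-index `α ∈ ℕ^d`:
the `|α|`-th Fréchet derivative, applied to `α_1` times `e_1`, `α_2` times `e_2`, and so on.
(Only absolute values of derivatives matter below, so that `D = ∂` and `D = -i∂` agree.) -/
def mderiv (α : Fin d → ℕ) (φ : Rd d → ℂ) (x : Rd d) : ℂ :=
  iteratedFDeriv ℝ (∑ j, α j) φ x
    (fun k => EuclideanSpace.single (finSigmaFinEquiv.symm k).1 (1 : ℝ))

theorem mderiv_add (α : Fin d → ℕ) {φ ψ : Rd d → ℂ} (hφ : ContDiff ℝ ∞ φ) (hψ : ContDiff ℝ ∞ ψ) :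
    mderiv α (φ + ψ) = mderiv α φ + mderiv α ψ := by
  funext x
  simp only [mderiv, Pi.add_apply]
  rw [iteratedFDeriv_add_apply (hφ.of_le (by exact_mod_cast le_top)).contDiffAt
    (hψ.of_le (by exact_mod_cast le_top)).contDiffAt]
  rfl

theorem mderiv_smul (α : Fin d → ℕ) (c : ℂ) {φ : Rd d → ℂ} (hφ : ContDiff ℝ ∞ φ) :
    mderiv α (c • φ) = c • mderiv α φ := by
  funext x
  simp only [mderiv, Pi.smul_apply]
  rw [iteratedFDeriv_const_smul_apply (hφ.of_le (by exact_mod_cast le_top)).contDiffAt]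
  rfl

theorem mderiv_zero (α : Fin d → ℕ) : mderiv α (0 : Rd d → ℂ) = 0 := by
  simpa using mderiv_smul α (0 : ℂ) (φ := (0 : Rd d → ℂ)) contDiff_const

/-- The norm `‖φ‖_{∞,η} = ‖φ/η‖_∞`; it is used for continuous functions only, for which the
essential supremum is the supremum. -/
def wnorm (η : Rd d → ℝ) (φ : Rd d → ℂ) : ℝ := ⨆ x, ‖φ x‖ / η x

/-- The functions with finite norm `‖φ‖_{∞,η}`. A continuous function belongs to `L^∞_η` if and
only if it belongs to this space. -/
def LinfW (η : Rd d → ℝ) : Submodule ℂ (Rd d → ℂ) where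
  carrier := {φ | ∃ C : ℝ, ∀ x, ‖φ x‖ ≤ C * η x}
  zero_mem' := ⟨0, by simp⟩
  add_mem' := by
    rintro φ ψ ⟨C, hC⟩ ⟨C', hC'⟩
    refine ⟨C + C', fun x => ?_⟩
    have := norm_add_le (φ x) (ψ x)
    have h1 := hC x
    have h2 := hC' x
    simp only [Pi.add_apply]
    linarith
  smul_mem' := by
    rintro c φ ⟨C, hC⟩
    refine ⟨‖c‖ * C, fun x => ?_⟩
    have := mul_le_mul_of_nonneg_left (hC x) (norm_nonneg c)
    simpa [mul_assoc] using this

/-- The space `C_η` of continuous functions `φ` with `φ(x)/η(x) → 0` as `|x| → ∞`. -/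
def CW (η : Rd d → ℝ) : Submodule ℂ (Rd d → ℂ) where
  carrier := {φ | φ ∈ LinfW η ∧ Continuous φ ∧
    Tendsto (fun x => φ x / (η x : ℂ)) (cocompact (Rd d)) (𝓝 0)}
  zero_mem' := ⟨(LinfW η).zero_mem, continuous_const, by simp [tendsto_const_nhds]⟩
  add_mem' := by
    rintro φ ψ ⟨h1, h2, h3⟩ ⟨h1', h2', h3'⟩
    refine ⟨(LinfW η).add_mem h1 h1', h2.add h2', ?_⟩
    simpa [add_div] using h3.add h3'
  smul_mem' := by
    rintro c φ ⟨h1, h2, h3⟩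
    refine ⟨(LinfW η).smul_mem c h1, h2.const_smul c, ?_⟩
    simpa [mul_div_assoc] using h3.const_mul c

/-- The norm `‖φ‖_{E,m} = sup_α m^|α| ‖∂^α φ‖_E / M_|α|`, where `E` is `C_η` or `L^∞_η`. -/
def stepNorm (M : ℕ → ℝ) (η : Rd d → ℝ) (m : ℝ) (φ : Rd d → ℂ) : ℝ :=
  ⨆ α : Fin d → ℕ, m ^ (∑ j, α j) * wnorm η (mderiv α φ) / M (∑ j, α j)

/-- The space `D_E^{M_p,m}`, `m > 0`: the smooth functions `φ` with `∂^α φ ∈ E` for all `α` and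
`‖φ‖_{E,m} < ∞`; here `E` is `C_η` or `L^∞_η`. The last condition is written as
`|∂^α φ(x)| ≤ C η(x) M_|α| / m^|α|` for all `α` and `x`. -/
def step (M : ℕ → ℝ) (η : Rd d → ℝ) (E : Submodule ℂ (Rd d → ℂ)) (m : ℝ) :
    Submodule ℂ (Rd d → ℂ) where
  carrier := {φ | ContDiff ℝ ∞ φ ∧ (∀ α, mderiv α φ ∈ E) ∧
    ∃ C : ℝ, ∀ α x, ‖mderiv α φ x‖ ≤ C * (η x * M (∑ j, α j) / m ^ (∑ j, α j))}
  zero_mem' := by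
    refine ⟨contDiff_const, fun α => ?_, 0, fun α x => ?_⟩
    · rw [mderiv_zero]
      exact E.zero_mem
    · simp [mderiv_zero]
  add_mem' := by
    rintro φ ψ ⟨h1, h2, C, hC⟩ ⟨h1', h2', C', hC'⟩
    refine ⟨h1.add h1', fun α => ?_, C + C', fun α x => ?_⟩
    · rw [mderiv_add α h1 h1']
      exact E.add_mem (h2 α) (h2' α)
    · rw [mderiv_add α h1 h1', add_mul]
      exact (norm_add_le _ _).trans (add_le_add (hC α x) (hC' α x))
  smul_mem' := by
    rintro c φ ⟨h1, h2, C, hC⟩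
    refine ⟨h1.const_smul c, fun α => ?_, ‖c‖ * C, fun α x => ?_⟩
    · rw [mderiv_smul α c h1]
      exact E.smul_mem c (h2 α)
    · rw [mderiv_smul α c h1, Pi.smul_apply, norm_smul, mul_assoc]
      exact mul_le_mul_of_nonneg_left (hC α x) (norm_nonneg c)

theorem step_anti (M : ℕ → ℝ) (η : Rd d → ℝ) (E : Submodule ℂ (Rd d → ℂ)) {m m' : ℝ}
    (hm' : 0 < m') (h : m' ≤ m) : step M η E m ≤ step M η E m' := by
  rintro φ ⟨h1, h2, C, hC⟩
  refine ⟨h1, h2, C, fun α x => (hC α x).trans ?_⟩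
  have h0 : 0 ≤ C * (η x * M (∑ j, α j) / m ^ (∑ j, α j)) := (norm_nonneg _).trans (hC α x)
  have hm : 0 < m := hm'.trans_le h
  have h3 : 0 ≤ C * (η x * M (∑ j, α j)) := by
    have := mul_nonneg h0 (pow_pos hm (∑ j, α j)).le
    have h4 : C * (η x * M (∑ j, α j) / m ^ (∑ j, α j)) * m ^ (∑ j, α j)
        = C * (η x * M (∑ j, α j)) := by
      field_simp
    rwa [h4] at this
  rw [← mul_div_assoc, ← mul_div_assoc]
  exact div_le_div_of_nonneg_left h3 (pow_pos hm' _) (pow_le_pow_left₀ hm'.le h _)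

/-- The underlying set of `D_E^*`: the intersection of all `D_E^{M_p,m}`, `m > 0`, in the Beurling
case, and their union in the Roumieu case. -/
def limitSubmodule (cls : UltraClass) (M : ℕ → ℝ) (η : Rd d → ℝ)
    (E : Submodule ℂ (Rd d → ℂ)) : Submodule ℂ (Rd d → ℂ) :=
  match cls with
  | .beurling => ⨅ (m : ℝ) (_ : 0 < m), step M η E m
  | .roumieu =>
    { carrier := {φ | ∃ m : ℝ, 0 < m ∧ φ ∈ step M η E m}
      zero_mem' := ⟨1, one_pos, Submodule.zero_mem _⟩
      add_mem' := by
        rintro φ ψ ⟨m, hm, h⟩ ⟨m', hm', h'⟩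
        exact ⟨min m m', lt_min hm hm', Submodule.add_mem _
          (step_anti M η E (lt_min hm hm') (min_le_left _ _) h)
          (step_anti M η E (lt_min hm hm') (min_le_right _ _) h')⟩
      smul_mem' := by
        rintro c φ ⟨m, hm, h⟩
        exact ⟨m, hm, Submodule.smul_mem _ c h⟩ }

theorem limitSubmodule_mono (cls : UltraClass) (M : ℕ → ℝ) (η : Rd d → ℝ)
    {E F : Submodule ℂ (Rd d → ℂ)} (h : E ≤ F) :
    limitSubmodule cls M η E ≤ limitSubmodule cls M η F := by
  have hs : ∀ m, step M η E m ≤ step M η F m := fun m φ hφ => ⟨hφ.1, fun α => h (hφ.2.1 α), hφ.2.2⟩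
  cases cls with
  | beurling => exact iInf₂_mono fun m _ => hs m
  | roumieu =>
    rintro φ ⟨m, hm, hφ⟩
    exact ⟨m, hm, hs m hφ⟩

/-- The space `D_E^*`. It is a type of its own, as it does not carry the topology of pointwise
convergence. -/
def DSpace (cls : UltraClass) (M : ℕ → ℝ) (η : Rd d → ℝ) (E : Submodule ℂ (Rd d → ℂ)) : Type :=
  limitSubmodule cls M η E

section DSpace

variable (cls : UltraClass) (M : ℕ → ℝ) (η : Rd d → ℝ) (E : Submodule ℂ (Rd d → ℂ))

instance : AddCommGroup (DSpace cls M η E) := inferInstanceAs (AddCommGroup (limitSubmodule cls M η E))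

instance : Module ℂ (DSpace cls M η E) := inferInstanceAs (Module ℂ (limitSubmodule cls M η E))

variable {cls M η E}

/-- The function on `ℝ^d` that underlies an element of `D_E^*`. -/
def DSpace.toFun (φ : DSpace cls M η E) : Rd d → ℂ := Subtype.val (p := (· ∈ limitSubmodule cls M η E)) φ

/-- The continuous seminorms of `D_E^*`. In the Beurling case (projective limit, `m → ∞`, of a
decreasing family of normed spaces) they are the seminorms dominated by a multiple of one of the
norms `‖·‖_{E,m}`. In the Roumieu case (locally convex inductive limit, `m → 0`) they are the
seminorms with continuous restriction to each of the spaces `D_E^{M_p,m}`. -/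
def IsLimitSeminorm :
    (cls : UltraClass) → (M : ℕ → ℝ) → (η : Rd d → ℝ) → (E : Submodule ℂ (Rd d → ℂ)) →
      Seminorm ℂ (DSpace cls M η E) → Prop
  | .beurling, M, η, _, p => ∃ m > 0, ∃ C : ℝ, ∀ φ, p φ ≤ C * stepNorm M η m φ.toFun
  | .roumieu, M, η, E, p => ∀ m > 0, ∃ C : ℝ, ∀ φ, φ.toFun ∈ step M η E m →
      p φ ≤ C * stepNorm M η m φ.toFun

/-- The locally convex topology of `D_E^*`: the projective limit topology in the Beurling case and
the locally convex inductive limit topology in the Roumieu case. -/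
instance : TopologicalSpace (DSpace cls M η E) :=
  SeminormFamily.moduleFilterBasis (𝕜 := ℂ)
    (fun p : {p : Seminorm ℂ (DSpace cls M η E) // IsLimitSeminorm cls M η E p} => p.1) |>.topology

theorem DSpace.withSeminorms : WithSeminorms
    (fun p : {p : Seminorm ℂ (DSpace cls M η E) // IsLimitSeminorm cls M η E p} => p.1) := ⟨rfl⟩

instance : IsTopologicalAddGroup (DSpace cls M η E) := DSpace.withSeminorms.topologicalAddGroup

instance : ContinuousSMul ℂ (DSpace cls M η E) := DSpace.withSeminorms.continuousSMul

end DSpace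

/-! ## Duality -/

section Duality

variable (cls : UltraClass) (M : ℕ → ℝ) (η : Rd d → ℝ)

/-- The space `Ḃ^*_η = D^*_{C_η}`. -/
abbrev Bdot : Type := DSpace cls M η (CW η)

/-- The space `D'^*_{L^1_η}`: the strong dual of `Ḃ^*_η`. (Mathlib's topology on spaces of
continuous linear maps is that of uniform convergence on the bounded sets.) -/
abbrev DualL1 : Type := StrongDual ℂ (Bdot cls M η)

/-- The space `D^*_{L^∞_η,c}`: the vector space `D^*_{L^∞_η}`, to be equipped below with the
topology of compact convex circled convergence. -/
def DLinfC : Type := DSpace cls M η (LinfW η)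

instance : AddCommGroup (DLinfC cls M η) := inferInstanceAs (AddCommGroup (DSpace cls M η (LinfW η)))

instance : Module ℂ (DLinfC cls M η) := inferInstanceAs (Module ℂ (DSpace cls M η (LinfW η)))

variable {cls M η}

/-- The function on `ℝ^d` that underlies an element of `D^*_{L^∞_η,c}`. -/
def DLinfC.toFun (φ : DLinfC cls M η) : Rd d → ℂ :=
  DSpace.toFun (cls := cls) (M := M) (η := η) (E := LinfW η) φ

/-- The inclusion of `Ḃ^*_η` into `D^*_{L^∞_η}`. -/
def incl : Bdot cls M η →ₗ[ℂ] DLinfC cls M η :=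
  Submodule.inclusion (limitSubmodule_mono cls M η (E := CW η) (F := LinfW η) fun _ h => h.1)

/-- The identification of `D^*_{L^∞_η}` with the bidual of `Ḃ^*_η`: the function `φ` corresponds
to the continuous functional `u` on `D'^*_{L^1_η}` with `u(δ_x) = φ(x)` for all `x`, where
`δ_x ∈ D'^*_{L^1_η}` is the evaluation at `x`. -/
def IsBidualRep (u : StrongDual ℂ (DualL1 cls M η)) (φ : DLinfC cls M η) : Prop :=
  ∀ x : Rd d, ∃ δ : DualL1 cls M η, (∀ ψ : Bdot cls M η, δ ψ = ψ.toFun x) ∧ u δ = φ.toFun x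

open Classical in
/-- The functional `f ↦ ⟨f, φ⟩` on `D'^*_{L^1_η}` given by an element `φ` of `D^*_{L^∞_η}`. -/
def toBidual (φ : DLinfC cls M η) : StrongDual ℂ (DualL1 cls M η) :=
  if h : ∃ u, IsBidualRep u φ then h.choose else 0

/-- The compact convex circled subsets of `D'^*_{L^1_η}`. -/
def compactConvexCircled (cls : UltraClass) (M : ℕ → ℝ) (η : Rd d → ℝ) :
    Set (Set (DualL1 cls M η)) :=
  {K | IsCompact K ∧ Convex ℝ K ∧ Balanced ℂ K}

/-- The topology of `D^*_{L^∞_η,c}`: uniform convergence on the compact convex circled subsets of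
`D'^*_{L^1_η}`, with respect to the duality `⟨D'^*_{L^1_η}, D^*_{L^∞_η}⟩`. -/
instance : TopologicalSpace (DLinfC cls M η) :=
  TopologicalSpace.induced
    (fun φ => UniformConvergenceCLM.ofFun (RingHom.id ℂ) ℂ (compactConvexCircled cls M η)
      (toBidual φ))
    inferInstance

end Duality

end Ultra

end

/-! Write `χ_N` for the dilations `cut d N` of a band-limited Schwartz function with value `1` at
the origin. The `n`-th derivatives of `χ_N` are bounded by `C h ^ n`, and `(M.5)` makes `M_n` grow
faster than every geometric sequence. Multiplication by `χ_N` therefore preserves derivative bounds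
of class `*` and, by the decay of `χ_N`, maps `D^*_{L^∞_η}` into `Ḃ^*_η`. No compactly supported
function of the class is needed. Bounded sets are described by the sets `Ball η b`, with `b`
admissible in the sense of `Dom`; this treats both classes at once.

The pairing is `⟨f, φ⟩ = lim f (χ_N φ)`. The derivatives of the differences `χ_{k+1} - χ_k` are
absolutely summable in `k`, uniformly in `x` (`exists_annulus_bound`). Hence sums `∑ c_k (χ_{k+1} -
χ_k) φ_k` with `|c_k| ≤ 1` and `φ_k` in one ball stay in one ball. Since `f` is bounded there, `f
((χ_{k+1} - χ_k) φ)` is summable uniformly for `φ` in a ball (`DualL1.exists_summable`). The limit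
thus exists uniformly on balls; it extends `f` because `χ_N ψ → ψ` in `Ḃ^*_η`.

A ball, encoded by its jets, is compact for pointwise convergence of all derivatives, and `⟨f, ·⟩`
is continuous on it as a uniform limit of continuous functions. So balls are weakly compact. A
functional dominated by a compact convex circled set belongs to it (`exists_eq_of_forall_norm_le`,
finite-dimensional Hahn–Banach and compactness). Applied to balls this identifies `D^*_{L^∞_η}` with
the bidual of `Ḃ^*_η`, which also gives uniqueness of the functional with prescribed values at the
`δ_x`. Applied to compact convex circled subsets of `D'^*_{L^1_η}` it is the Mackey–Arens theorem,
which identifies the dual of `D^*_{L^∞_η,c}` with `D'^*_{L^1_η}`.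

It remains to compare the strong topologies. Bounded sets of `Ḃ^*_η` are bounded in `D^*_{L^∞_η,c}`,
so restriction is continuous. Conversely, a set in no ball is unbounded along an equicontinuous
sequence of multiples of derivatives of delta functions; damped by `2 ^ (-n)`, this sequence lies in
a compact convex circled set, so the set is unbounded in `D^*_{L^∞_η,c}`. Bounded sets thus lie in
balls, where `⟨f, ·⟩` is uniformly small for `f` near zero. -/

noncomputable section
namespace Ultra

/-! ### Symmetry of iterated derivatives -/

section Symmetry

variable {V F : Type*} [NormedAddCommGroup V] [NormedSpace ℝ V]
  [NormedAddCommGroup F] [NormedSpace ℝ F]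

theorem differentiable_iteratedFDeriv {φ : V → F} (hφ : ContDiff ℝ ∞ φ) (n : ℕ) :
    Differentiable ℝ (iteratedFDeriv ℝ n φ) :=
  hφ.differentiable_iteratedFDeriv (by exact_mod_cast WithTop.coe_lt_top _)

theorem contDiff_iteratedFDeriv {φ : V → F} (hφ : ContDiff ℝ ∞ φ) (n : ℕ) :
    ContDiff ℝ ∞ (iteratedFDeriv ℝ n φ) :=
  hφ.iteratedFDeriv_right (by norm_cast)

/-- Iterated derivatives are invariant under exchange of two adjacent directions. -/
theorem iteratedFDeriv_comp_swap {φ : V → F} (hφ : ContDiff ℝ ∞ φ) (n : ℕ) (i : Fin n) (x : V)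
    (v : Fin (n + 1) → V) :
    iteratedFDeriv ℝ (n + 1) φ x (v ∘ Equiv.swap i.castSucc i.succ) =
      iteratedFDeriv ℝ (n + 1) φ x v := by
  induction n generalizing x with
  | zero => exact i.elim0
  | succ n ih =>
    have key : ∀ (y : V) (w : Fin (n + 2) → V), iteratedFDeriv ℝ (n + 2) φ y w =
        fderiv ℝ (fun z => iteratedFDeriv ℝ (n + 1) φ z (Fin.tail w)) y (w 0) := fun y w => by
      rw [DifferentiableAt.iteratedFDeriv_succ_apply_left'
        ((differentiable_iteratedFDeriv hφ (n + 1)) y)]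
    -- A swap of the two outermost directions is the symmetry of the second derivative of `D^n φ`.
    -- Every other swap fixes the outermost direction, so the induction hypothesis applies under the
    -- outer derivative.
    induction i using Fin.cases with
    | zero =>
      have h2 : ∀ w : Fin (n + 2) → V, iteratedFDeriv ℝ (n + 2) φ x w =
          fderiv ℝ (fderiv ℝ (iteratedFDeriv ℝ n φ)) x (w 0) (w 1) (Fin.tail (Fin.tail w)) := by
        intro w
        rw [key]
        have h3 : (fun z => iteratedFDeriv ℝ (n + 1) φ z (Fin.tail w)) =
            fun z => fderiv ℝ (iteratedFDeriv ℝ n φ) z (w 1) (Fin.tail (Fin.tail w)) := by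
          funext z
          rw [iteratedFDeriv_succ_apply_left]
          rfl
        rw [h3]
        have hd : DifferentiableAt ℝ (fderiv ℝ (iteratedFDeriv ℝ n φ)) x :=
          (((contDiff_iteratedFDeriv hφ n).fderiv_right (m := ∞) (by norm_cast)).differentiable
            (by simp)) x
        have h4 := (hd.hasFDerivAt.clm_apply
          (hasFDerivAt_const (w 1) x)).continuousMultilinear_apply_const (Fin.tail (Fin.tail w))
        rw [h4.fderiv]
        simp
      rw [h2, h2]
      have hs : IsSymmSndFDerivAt ℝ (iteratedFDeriv ℝ n φ) x :=
        (contDiff_iteratedFDeriv hφ n).contDiffAt.isSymmSndFDerivAt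
          (by rw [minSmoothness_of_isRCLikeNormedField]; exact WithTop.coe_le_coe.2 (le_top (a := (2 : ℕ∞))))
      have e0 : (v ∘ Equiv.swap (0 : Fin (n + 1)).castSucc (0 : Fin (n + 1)).succ) 0 = v 1 := by
        simp
      have e1 : (v ∘ Equiv.swap (0 : Fin (n + 1)).castSucc (0 : Fin (n + 1)).succ) 1 = v 0 := by
        simp
      have e2 : Fin.tail (Fin.tail
          (v ∘ Equiv.swap (0 : Fin (n + 1)).castSucc (0 : Fin (n + 1)).succ)) =
          Fin.tail (Fin.tail v) := by
        funext k
        simp only [Fin.tail, Function.comp]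
        rw [Equiv.swap_apply_of_ne_of_ne] <;> simp [Fin.ext_iff]
      rw [e0, e1, e2, hs.eq]
    | succ j =>
      rw [key, key]
      have e0 : (v ∘ Equiv.swap j.succ.castSucc j.succ.succ) 0 = v 0 := by
        simp only [Function.comp]
        rw [Equiv.swap_apply_of_ne_of_ne] <;> simp [Fin.ext_iff]
      have e1 : Fin.tail (v ∘ Equiv.swap j.succ.castSucc j.succ.succ) =
          Fin.tail v ∘ Equiv.swap j.castSucc j.succ := by
        funext k
        simp only [Fin.tail, Function.comp, Fin.castSucc_succ]
        congr 1
        exact (Fin.succ_injective _).swap_apply j.castSucc j.succ k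
      rw [e0, e1]
      simp_rw [ih j]

/-- Adjacent transpositions generate the symmetric group. -/
theorem iteratedFDeriv_comp_perm {φ : V → F} (hφ : ContDiff ℝ ∞ φ) {n : ℕ} (x : V)
    (σ : Equiv.Perm (Fin n)) (v : Fin n → V) :
    iteratedFDeriv ℝ n φ x (v ∘ σ) = iteratedFDeriv ℝ n φ x v := by
  cases n with
  | zero => congr 1; funext k; exact k.elim0
  | succ n =>
    have h : σ ∈ Submonoid.closure
        (Set.range fun i : Fin n => Equiv.swap i.castSucc i.succ) := by
      rw [Equiv.Perm.mclosure_swap_castSucc_succ]; trivial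
    induction h using Submonoid.closure_induction generalizing v with
    | mem σ h =>
      obtain ⟨i, rfl⟩ := h
      exact iteratedFDeriv_comp_swap hφ n i x v
    | one => rfl
    | mul σ τ _ _ h1 h2 =>
      rw [Equiv.Perm.coe_mul, ← Function.comp_assoc, h2, h1]

/-- Two index types are needed because the order in `mderiv` is `∑ j, α j`, which is equal to `n`
only propositionally. -/
theorem iteratedFDeriv_comp_equiv {φ : V → F} (hφ : ContDiff ℝ ∞ φ) {n m : ℕ} (x : V)
    (e : Fin n ≃ Fin m) (v : Fin m → V) :
    iteratedFDeriv ℝ n φ x (v ∘ e) = iteratedFDeriv ℝ m φ x v := by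
  obtain rfl : n = m := by simpa using Fintype.card_congr e
  exact iteratedFDeriv_comp_perm hφ x e v

end Symmetry

/-! ### Partial derivatives and full derivatives -/

variable {d : ℕ}

theorem norm_mderiv_le (α : Fin d → ℕ) (φ : Rd d → ℂ) (x : Rd d) :
    ‖mderiv α φ x‖ ≤ ‖iteratedFDeriv ℝ (∑ j, α j) φ x‖ := by
  refine (ContinuousMultilinearMap.le_opNorm _ _).trans ?_
  simp

/-- A derivative in coordinate directions is one of the partial derivatives `∂^α`. -/
theorem exists_mderiv_eq {φ : Rd d → ℂ} (hφ : ContDiff ℝ ∞ φ) {n : ℕ} (r : Fin n → Fin d) :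
    ∃ α : Fin d → ℕ, ∑ j, α j = n ∧ ∀ x, mderiv α φ x =
      iteratedFDeriv ℝ n φ x (fun k => EuclideanSpace.single (r k) (1 : ℝ)) := by
  classical
  -- `α j` counts the positions at which the direction `e_j` occurs, and `e` sorts the positions by
  -- direction.
  let α : Fin d → ℕ := fun j => Fintype.card {k // r k = j}
  let e : Fin n ≃ Fin (∑ j, α j) :=
    (Equiv.sigmaFiberEquiv r).symm.trans
      ((Equiv.sigmaCongrRight fun j => Fintype.equivFin {k // r k = j}).trans finSigmaFinEquiv)
  refine ⟨α, by simpa using (Fintype.card_congr e).symm, fun x => ?_⟩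
  rw [mderiv, ← iteratedFDeriv_comp_equiv hφ x e]
  congr 1
  funext k
  simp [e, Equiv.sigmaFiberEquiv]

/-- The norm of the `n`-th derivative is controlled by the partial derivatives of order `n`. -/
theorem norm_iteratedFDeriv_le_of_mderiv {φ : Rd d → ℂ} (hφ : ContDiff ℝ ∞ φ) {n : ℕ} {x : Rd d}
    {c : ℝ} (hc : 0 ≤ c) (h : ∀ α : Fin d → ℕ, ∑ j, α j = n → ‖mderiv α φ x‖ ≤ c) :
    ‖iteratedFDeriv ℝ n φ x‖ ≤ (d + 1 : ℝ) ^ n * c := by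
  refine ContinuousMultilinearMap.opNorm_le_bound (by positivity) fun v => ?_
  have hv : v = fun k => ∑ j : Fin d, (v k j) • EuclideanSpace.single j (1 : ℝ) := by
    funext k
    ext i
    simp [Finset.sum_apply, Pi.single_apply]
  have h1 : iteratedFDeriv ℝ n φ x v = ∑ r : Fin n → Fin d, (∏ k, v k (r k)) •
      iteratedFDeriv ℝ n φ x (fun k => EuclideanSpace.single (r k) (1 : ℝ)) := by
    conv_lhs => rw [hv]
    rw [ContinuousMultilinearMap.map_sum]
    refine Finset.sum_congr rfl fun r _ => ?_
    rw [ContinuousMultilinearMap.map_smul_univ]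
  rw [h1]
  have h2 : ∀ r : Fin n → Fin d, ‖(∏ k, v k (r k)) •
      iteratedFDeriv ℝ n φ x (fun k => EuclideanSpace.single (r k) (1 : ℝ))‖ ≤
      (∏ k, ‖v k‖) * c := by
    intro r
    rw [norm_smul, norm_prod]
    obtain ⟨α, hα, hr⟩ := exists_mderiv_eq hφ r
    rw [← hr x]
    gcongr with k
    · exact PiLp.norm_apply_le (v k) (r k)
    · exact h α hα
  refine (norm_sum_le _ _).trans ((Finset.sum_le_sum fun r _ => h2 r).trans ?_)
  simp only [Finset.sum_const, Finset.card_univ, Fintype.card_pi, Fintype.card_fin,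
    Finset.prod_const, nsmul_eq_mul, Nat.cast_pow]
  -- The base `d + 1` instead of `d` can be divided by even for `d = 0`.
  have h3 : (d : ℝ) ^ n ≤ (d + 1 : ℝ) ^ n := by gcongr; linarith
  have h4 : 0 ≤ (∏ k, ‖v k‖) * c := by positivity
  nlinarith [mul_le_mul_of_nonneg_right h3 h4]

end Ultra
end

noncomputable section
namespace Ultra

/-! ### Growth of weight sequences and admissible bounds -/

section Weights

variable {M : ℕ → ℝ}

/-- Logarithmic convexity means that the ratios `M (p + 1) / M p` increase; here the denominators
are cleared. -/
theorem IsWeightSequence.ratio_mono (hM : IsWeightSequence M) (p j : ℕ) :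
    M (p + 1) * M (p + j) ≤ M p * M (p + j + 1) := by
  induction j with
  | zero => simp [mul_comm]
  | succ j ih =>
    have h1 := hM.logConvex (p + j)
    have h0 := hM.pos (p + j)
    have h2 := hM.pos (p + j + 1)
    have h3 := hM.pos (p + j + 2)
    have h4 := hM.pos p
    have h5 := hM.pos (p + 1)
    have h6 : M (p + (j + 1)) = M (p + j + 1) := rfl
    have h7 : M (p + (j + 1) + 1) = M (p + j + 2) := rfl
    rw [h6, h7]
    have h8 : M (p + 1) * M (p + j + 1) * M (p + j) ≤ M p * M (p + j + 2) * M (p + j) := by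
      calc M (p + 1) * M (p + j + 1) * M (p + j) = M (p + j + 1) * (M (p + 1) * M (p + j)) := by
            ring
        _ ≤ M (p + j + 1) * (M p * M (p + j + 1)) := by gcongr
        _ = M p * M (p + j + 1) ^ 2 := by ring
        _ ≤ M p * (M (p + j) * M (p + j + 2)) := by gcongr
        _ = _ := by ring
    exact le_of_mul_le_mul_right h8 h0

theorem IsWeightSequence.mul_le (hM : IsWeightSequence M) (i j : ℕ) :
    M i * M j ≤ M (i + j) := by
  induction i with
  | zero => simp [hM.zero]
  | succ i ih =>
    have h0 := hM.pos i
    have h1 := hM.pos (i + 1)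
    have h2 := hM.ratio_mono i j
    have h3 : M (i + 1) * M j * M i ≤ M (i + 1 + j) * M i := by
      calc M (i + 1) * M j * M i = M (i + 1) * (M i * M j) := by ring
        _ ≤ M (i + 1) * M (i + j) := by gcongr
        _ ≤ M i * M (i + j + 1) := h2
        _ = _ := by rw [show i + 1 + j = i + j + 1 by ring]; ring
    exact le_of_mul_le_mul_right h3 h0

/-- The sequence `M_p` grows faster than every geometric sequence. -/
theorem IsMSequence.exists_pow_le (hM : IsMSequence M) (h : ℝ) :
    ∃ C > 0, ∀ n, h ^ n ≤ C * M n := by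
  wlog hh : 0 < h generalizing h
  · obtain ⟨C, hC, H⟩ := this (|h| + 1) (by positivity)
    refine ⟨C, hC, fun n => le_trans ?_ (H n)⟩
    calc h ^ n ≤ |h| ^ n := by rw [← abs_pow]; exact le_abs_self _
      _ ≤ _ := by gcongr; linarith
  obtain ⟨q, hq, c₀, -, H⟩ := hM.strongNonQuasianalytic
  -- The terms of the convergent series in `(M.5)` tend to zero, so the ratios `M k / M (k + 1)` are
  -- eventually below `1 / h`.
  have h1 := (H 1 le_rfl).1.tendsto_atTop_zero
  have h2 : ∀ᶠ k in atTop, M (1 + k) ^ q / M (1 + k + 1) ^ q < (h⁻¹) ^ q :=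
    h1.eventually_lt_const (by positivity)
  obtain ⟨N, hN⟩ := eventually_atTop.1 h2
  have h3 : ∀ k ≥ N + 1, h * M k ≤ M (k + 1) := by
    intro k hk
    have h4 := hN (k - 1) (by omega)
    rw [show 1 + (k - 1) = k by omega] at h4
    have p0 := hM.pos k
    have p1 := hM.pos (k + 1)
    rw [← Real.div_rpow p0.le p1.le] at h4
    have h5 := (Real.rpow_lt_rpow_iff (by positivity) (by positivity) hq).1 h4
    rw [div_lt_iff₀ p1, inv_mul_eq_div, lt_div_iff₀ hh] at h5
    linarith
  -- `C` settles the indices up to `N + 1`; from there on the ratio bound carries the induction.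
  let C : ℝ := ∑ k ∈ Finset.range (N + 2), h ^ k / M k
  have hpos : ∀ k, 0 < h ^ k / M k := fun k => div_pos (by positivity) (hM.pos k)
  have hC : 0 < C := Finset.sum_pos (fun k _ => hpos k) ⟨0, by simp⟩
  have h6 : ∀ k < N + 2, h ^ k ≤ C * M k := fun k hk => by
    rw [← div_le_iff₀ (hM.pos k)]
    exact Finset.single_le_sum (f := fun k => h ^ k / M k) (fun k _ => (hpos k).le)
      (Finset.mem_range.2 hk)
  refine ⟨C, hC, fun n => ?_⟩
  induction n with
  | zero => exact h6 0 (by omega)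
  | succ n ih =>
    by_cases hn : n < N + 1
    · exact h6 _ (by omega)
    · calc h ^ (n + 1) = h * h ^ n := by ring
        _ ≤ h * (C * M n) := by gcongr
        _ = C * (h * M n) := by ring
        _ ≤ _ := by gcongr; exact h3 n (by omega)

end Weights

/-- The sequences that are admissible as bounds for the derivatives in the class `*`. -/
def Dom (cls : UltraClass) (M : ℕ → ℝ) (b : ℕ → ℝ) : Prop :=
  match cls with
  | .beurling => ∀ m : ℝ, 0 < m → ∃ C : ℝ, ∀ n, b n ≤ C * M n / m ^ n
  | .roumieu => ∃ m : ℝ, 0 < m ∧ ∃ C : ℝ, ∀ n, b n ≤ C * M n / m ^ n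

/-- A loss of a fixed factor in `m` is harmless in both classes: `m` is arbitrary in the Beurling
case and only has to exist in the Roumieu case. -/
theorem Dom.map {cls : UltraClass} {M : ℕ → ℝ} {b b' : ℕ → ℝ} (hb : Dom cls M b)
    (r : ℝ) (hr : 0 < r)
    (h : ∀ m > 0, ∀ C : ℝ, (∀ n, b n ≤ C * M n / m ^ n) →
      ∃ C' : ℝ, ∀ n, b' n ≤ C' * M n / (m / r) ^ n) : Dom cls M b' := by
  cases cls with
  | beurling =>
    intro m hm
    obtain ⟨C, hC⟩ := hb (m * r) (by positivity)
    have := h (m * r) (by positivity) C hC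
    rwa [mul_div_cancel_right₀ _ hr.ne'] at this
  | roumieu =>
    obtain ⟨m, hm, C, hC⟩ := hb
    exact ⟨m / r, by positivity, h m hm C hC⟩

/-- The bound for the derivatives of a product of functions with derivatives bounded by
`C * h ^ n` and `b n`. -/
def prodBound (C h : ℝ) (b : ℕ → ℝ) (n : ℕ) : ℝ :=
  ∑ i ∈ Finset.range (n + 1), (n.choose i : ℝ) * (C * h ^ i) * b (n - i)

/-- The factor `h ^ i` is absorbed into `M i / m ^ i`, then `M i * M (n - i) ≤ M n`. The binomial
coefficients sum to `2 ^ n`, which costs the passage from `m` to `m / 2`. -/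
theorem Dom.prodBound {cls : UltraClass} {M : ℕ → ℝ} (hM : IsMSequence M) {b : ℕ → ℝ}
    (hb : Dom cls M b) {C h : ℝ} (hC : 0 ≤ C) (hh : 0 ≤ h) : Dom cls M (prodBound C h b) := by
  refine hb.map 2 two_pos fun m hm C₁ hC₁ => ?_
  obtain ⟨C₂, hC₂, H⟩ := hM.exists_pow_le (h * m)
  refine ⟨C * C₂ * |C₁|, fun n => ?_⟩
  have h1 : ∀ i ∈ Finset.range (n + 1), (n.choose i : ℝ) * (C * h ^ i) * b (n - i) ≤
      (n.choose i : ℝ) * (C * C₂ * |C₁| * (M n / m ^ n)) := by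
    intro i hi
    have hi : i ≤ n := by simpa [Nat.lt_succ_iff] using hi
    have h2 : h ^ i ≤ C₂ * M i / m ^ i := by
      rw [le_div_iff₀ (by positivity), ← mul_pow]; exact H i
    have h3 : b (n - i) ≤ |C₁| * M (n - i) / m ^ (n - i) := by
      refine (hC₁ _).trans ?_
      have := (hM.pos (n - i)).le
      gcongr
      exact le_abs_self _
    have p1 := hM.pos i
    have p2 := hM.pos (n - i)
    rw [mul_assoc]
    refine mul_le_mul_of_nonneg_left ?_ (Nat.cast_nonneg _)
    calc C * h ^ i * b (n - i) ≤ C * h ^ i * (|C₁| * M (n - i) / m ^ (n - i)) := by gcongr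
      _ ≤ C * (C₂ * M i / m ^ i) * (|C₁| * M (n - i) / m ^ (n - i)) := by gcongr
      _ = C * C₂ * |C₁| * (M i * M (n - i) / (m ^ i * m ^ (n - i))) := by
        field_simp
      _ ≤ _ := by
        rw [← pow_add, Nat.add_sub_cancel' hi]
        have := hM.mul_le i (n - i)
        rw [Nat.add_sub_cancel' hi] at this
        gcongr
  refine (Finset.sum_le_sum h1).trans (le_of_eq ?_)
  rw [← Finset.sum_mul]
  have h4 : ∑ i ∈ Finset.range (n + 1), (n.choose i : ℝ) = 2 ^ n := by
    exact_mod_cast Nat.sum_range_choose n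
  rw [h4, div_pow]
  field_simp

/-! ### The spaces in terms of bounds on full derivatives -/

variable {d : ℕ}

/-- The smooth functions with derivatives bounded by `b n * η`. -/
def Ball (η : Rd d → ℝ) (b : ℕ → ℝ) : Set (Rd d → ℂ) :=
  {φ | ContDiff ℝ ∞ φ ∧ ∀ n x, ‖iteratedFDeriv ℝ n φ x‖ ≤ b n * η x}

/-- The functions with derivatives that vanish at infinity, relative to `η`. -/
def Vanish (η : Rd d → ℝ) : Set (Rd d → ℂ) :=
  {φ | ∀ n, ∀ ε > 0, ∃ R : ℝ, ∀ x, R < ‖x‖ → ‖iteratedFDeriv ℝ n φ x‖ ≤ ε * η x}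

section Spaces

variable {cls : UltraClass} {M : ℕ → ℝ} {η : Rd d → ℝ}

theorem wnorm_nonneg (hη : ∀ x, 0 < η x) (φ : Rd d → ℂ) : 0 ≤ wnorm η φ :=
  Real.iSup_nonneg fun x => div_nonneg (norm_nonneg _) (hη x).le

theorem stepNorm_nonneg (hM : ∀ n, 0 < M n) (hη : ∀ x, 0 < η x) {m : ℝ} (hm : 0 < m)
    (φ : Rd d → ℂ) : 0 ≤ stepNorm M η m φ :=
  Real.iSup_nonneg fun α => div_nonneg (mul_nonneg (by positivity) (wnorm_nonneg hη _)) (hM _).le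

theorem stepNorm_le (hM : ∀ n, 0 < M n) (hη : ∀ x, 0 < η x) {m : ℝ} (hm : 0 < m)
    {φ : Rd d → ℂ} {C : ℝ}
    (hC : ∀ n x, ‖iteratedFDeriv ℝ n φ x‖ ≤ C * M n / m ^ n * η x) : stepNorm M η m φ ≤ C := by
  refine ciSup_le fun α => ?_
  rw [div_le_iff₀ (hM _), ← le_div_iff₀' (by positivity)]
  refine ciSup_le fun x => ?_
  rw [div_le_iff₀ (hη x)]
  exact (norm_mderiv_le α φ x).trans (hC _ x)

theorem le_stepNorm (hM : ∀ n, 0 < M n) (hη : ∀ x, 0 < η x) {m : ℝ} (hm : 0 < m)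
    {E : Submodule ℂ (Rd d → ℂ)} {φ : Rd d → ℂ} (hφ : φ ∈ step M η E m) (α : Fin d → ℕ)
    (x : Rd d) :
    ‖mderiv α φ x‖ ≤ stepNorm M η m φ * M (∑ j, α j) / m ^ (∑ j, α j) * η x := by
  obtain ⟨-, -, C, hC⟩ := hφ
  have h0 : ∀ β x, ‖mderiv β φ x‖ / η x ≤ C * M (∑ j, β j) / m ^ (∑ j, β j) := fun β x => by
    rw [div_le_iff₀ (hη x)]
    exact (hC β x).trans (le_of_eq (by ring))
  have h1 : ‖mderiv α φ x‖ / η x ≤ wnorm η (mderiv α φ) :=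
    le_ciSup (f := fun x => ‖mderiv α φ x‖ / η x)
      ⟨_, by rintro _ ⟨y, rfl⟩; exact h0 α y⟩ x
  have h2 : m ^ (∑ j, α j) * wnorm η (mderiv α φ) / M (∑ j, α j) ≤ stepNorm M η m φ := by
    refine le_ciSup (f := fun α : Fin d → ℕ =>
      m ^ (∑ j, α j) * wnorm η (mderiv α φ) / M (∑ j, α j)) ⟨C, ?_⟩ α
    rintro _ ⟨β, rfl⟩
    dsimp only
    rw [div_le_iff₀ (hM _), ← le_div_iff₀' (by positivity)]
    exact ciSup_le (h0 β)
  rw [div_le_iff₀ (hM _), ← le_div_iff₀' (by positivity)] at h2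
  rw [← div_le_iff₀ (hη x)]
  exact h1.trans h2

theorem mem_step_Linf {m C : ℝ} {φ : Rd d → ℂ}
    (hφ : ContDiff ℝ ∞ φ) (hC : ∀ n x, ‖iteratedFDeriv ℝ n φ x‖ ≤ C * M n / m ^ n * η x) :
    φ ∈ step M η (LinfW η) m :=
  ⟨hφ, fun α => ⟨C * M _ / m ^ _, fun x => (norm_mderiv_le α φ x).trans (hC _ x)⟩, C,
    fun α x => (norm_mderiv_le α φ x).trans ((hC _ x).trans (le_of_eq (by ring)))⟩

theorem continuous_mderiv {φ : Rd d → ℂ} (hφ : ContDiff ℝ ∞ φ) (α : Fin d → ℕ) :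
    Continuous (mderiv α φ) :=
  (ContinuousMultilinearMap.apply ℝ (fun _ => Rd d) ℂ _).continuous.comp
    (hφ.continuous_iteratedFDeriv (by exact_mod_cast le_top))

theorem mem_step_CW_of_vanish (hη : ∀ x, 0 < η x) {m : ℝ} {φ : Rd d → ℂ}
    (hφ : φ ∈ step M η (LinfW η) m) (h0 : φ ∈ Vanish η) : φ ∈ step M η (CW η) m := by
  refine ⟨hφ.1, fun α => ⟨hφ.2.1 α, continuous_mderiv hφ.1 α, ?_⟩, hφ.2.2⟩
  rw [tendsto_zero_iff_norm_tendsto_zero]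
  rw [Metric.tendsto_nhds]
  intro ε hε
  obtain ⟨R, hR⟩ := h0 (∑ j, α j) (ε / 2) (by positivity)
  filter_upwards [(isCompact_closedBall (0 : Rd d) R).compl_mem_cocompact] with x hx
  have hx : R < ‖x‖ := by simpa using hx
  have h1 := (norm_mderiv_le α φ x).trans (hR x hx)
  simp only [norm_div, Complex.norm_real, Real.norm_eq_abs, abs_of_pos (hη x), dist_zero_right]
  rw [abs_norm, div_lt_iff₀ (hη x)]
  have := hη x
  nlinarith

theorem vanish_of_mem_step_CW (hη : ∀ x, 0 < η x) {m : ℝ} {φ : Rd d → ℂ}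
    (hφ : φ ∈ step M η (CW η) m) : φ ∈ Vanish η := by
  intro n ε hε
  have h1 : ∀ α : Fin d → ℕ, ∃ R : ℝ, ∀ x, R < ‖x‖ →
      ‖mderiv α φ x‖ ≤ ε / (d + 1) ^ n * η x := by
    intro α
    have h2 := (hφ.2.1 α).2.2
    rw [tendsto_zero_iff_norm_tendsto_zero, Metric.tendsto_nhds] at h2
    have h3 := h2 (ε / (d + 1) ^ n) (by positivity)
    rw [Filter.eventually_iff, mem_cocompact] at h3
    obtain ⟨t, ht, hts⟩ := h3
    obtain ⟨R, hR⟩ := ht.isBounded.subset_closedBall 0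
    refine ⟨R, fun x hx => ?_⟩
    have h4 : x ∈ tᶜ := fun hxt => by
      have := hR hxt
      simp at this
      linarith
    have h5 := hts h4
    simp only [norm_div, Complex.norm_real, Real.norm_eq_abs, abs_of_pos (hη x), dist_zero_right,
      Set.mem_ofPred_eq] at h5
    rw [abs_norm, div_lt_iff₀ (hη x)] at h5
    exact h5.le
  choose R hR using h1
  -- Only finitely many multi-indices have order `n`, so one radius serves all of them.
  have hfin : {α : Fin d → ℕ | ∑ j, α j = n}.Finite := by
    refine (Set.finite_Iic (fun _ : Fin d => n)).subset fun α hα j => ?_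
    rw [← (hα : ∑ j, α j = n)]
    exact Finset.single_le_sum (f := α) (fun _ _ => Nat.zero_le _) (Finset.mem_univ j)
  obtain ⟨R₀, hR₀⟩ := (hfin.image R).bddAbove
  refine ⟨R₀, fun x hx => ?_⟩
  have := (hη x).le
  refine (norm_iteratedFDeriv_le_of_mderiv hφ.1 (c := ε / (d + 1) ^ n * η x) (by positivity)
    fun α hα => hR α x ((hR₀ ⟨α, hα, rfl⟩).trans_lt hx)).trans (le_of_eq ?_)
  field_simp

theorem mem_limit_of_ball (hη : ∀ x, 0 < η x) {b : ℕ → ℝ}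
    (hb : Dom cls M b) {φ : Rd d → ℂ} (hφ : φ ∈ Ball η b) :
    φ ∈ limitSubmodule cls M η (LinfW η) := by
  cases cls with
  | beurling =>
    simp only [limitSubmodule, Submodule.mem_iInf]
    intro m hm
    obtain ⟨C, hC⟩ := hb m hm
    exact mem_step_Linf hφ.1 (C := C) fun n x => (hφ.2 n x).trans
      (mul_le_mul_of_nonneg_right (hC n) (hη x).le)
  | roumieu =>
    obtain ⟨m, hm, C, hC⟩ := hb
    exact ⟨m, hm, mem_step_Linf hφ.1 (C := C) fun n x => (hφ.2 n x).trans
      (mul_le_mul_of_nonneg_right (hC n) (hη x).le)⟩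

theorem mem_limit_CW (hη : ∀ x, 0 < η x) {φ : Rd d → ℂ}
    (hφ : φ ∈ limitSubmodule cls M η (LinfW η)) (h0 : φ ∈ Vanish η) :
    φ ∈ limitSubmodule cls M η (CW η) := by
  cases cls with
  | beurling =>
    simp only [limitSubmodule, Submodule.mem_iInf] at hφ ⊢
    exact fun m hm => mem_step_CW_of_vanish hη (hφ m hm) h0
  | roumieu =>
    obtain ⟨m, hm, h⟩ := hφ
    exact ⟨m, hm, mem_step_CW_of_vanish hη h h0⟩

theorem vanish_of_mem_limit_CW (hη : ∀ x, 0 < η x) {φ : Rd d → ℂ}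
    (hφ : φ ∈ limitSubmodule cls M η (CW η)) : φ ∈ Vanish η := by
  cases cls with
  | beurling =>
    simp only [limitSubmodule, Submodule.mem_iInf] at hφ
    exact vanish_of_mem_step_CW hη (hφ 1 one_pos)
  | roumieu =>
    obtain ⟨m, hm, h⟩ := hφ
    exact vanish_of_mem_step_CW hη h

/-- A set of functions with derivatives that are uniformly bounded in the sense of the class `*`
is contained in one of the sets `Ball η b`. -/
theorem exists_ball (hM : ∀ n, 0 < M n) (hη : ∀ x, 0 < η x) {S : Set (Rd d → ℂ)}
    (hS : ∀ φ ∈ S, ContDiff ℝ ∞ φ)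
    (h : match cls with
      | .beurling => ∀ m : ℝ, 0 < m → ∃ C : ℝ, ∀ φ ∈ S, ∀ α x,
        ‖mderiv α φ x‖ ≤ C * M (∑ j, α j) / m ^ (∑ j, α j) * η x
      | .roumieu => ∃ m : ℝ, 0 < m ∧ ∃ C : ℝ, ∀ φ ∈ S, ∀ α x,
        ‖mderiv α φ x‖ ≤ C * M (∑ j, α j) / m ^ (∑ j, α j) * η x) :
    ∃ b, Dom cls M b ∧ S ⊆ Ball η b := by
  have key : ∀ m : ℝ, 0 < m → ∀ C : ℝ, (∀ φ ∈ S, ∀ α x,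
      ‖mderiv α φ x‖ ≤ C * M (∑ j, α j) / m ^ (∑ j, α j) * η x) → ∀ φ ∈ S, ∀ n x,
      ‖iteratedFDeriv ℝ n φ x‖ ≤ |C| * M n / (m / (d + 1)) ^ n * η x := by
    intro m hm C hC φ hφ n x
    have h1 := (hM n).le
    have h2 := (hη x).le
    refine (norm_iteratedFDeriv_le_of_mderiv (hS φ hφ)
      (c := |C| * M n / m ^ n * η x) (by positivity) ?_).trans (le_of_eq ?_)
    · rintro α rfl
      refine (hC φ hφ α x).trans ?_
      gcongr
      exact le_abs_self C
    · rw [div_pow]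
      field_simp
  cases cls with
  | beurling =>
    have h' : ∀ k : ℕ, ∃ C : ℝ, 0 ≤ C ∧ ∀ φ ∈ S, ∀ n x,
        ‖iteratedFDeriv ℝ n φ x‖ ≤ C * M n / ((k : ℝ) + 1) ^ n * η x := by
      intro k
      obtain ⟨C, hC⟩ := h (((k : ℝ) + 1) * (d + 1)) (by positivity)
      refine ⟨|C|, abs_nonneg C, ?_⟩
      have := key _ (by positivity) C hC
      rwa [mul_div_cancel_right₀ _ (by positivity)] at this
    choose C hC0 hC using h'
    have hbdd : ∀ n, BddBelow (Set.range fun k : ℕ => C k * M n / ((k : ℝ) + 1) ^ n) := fun n =>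
      ⟨0, by
        rintro _ ⟨k, rfl⟩
        exact div_nonneg (mul_nonneg (hC0 k) (hM n).le) (by positivity)⟩
    -- One sequence has to encode the bounds for all `m`. The infimum over `m = k + 1` lies below
    -- each of them and still bounds the derivatives.
    refine ⟨fun n => ⨅ k : ℕ, C k * M n / ((k : ℝ) + 1) ^ n, fun m hm => ?_, fun φ hφ =>
      ⟨hS φ hφ, fun n x => ?_⟩⟩
    · obtain ⟨k, hk⟩ := exists_nat_gt m
      refine ⟨C k, fun n => (ciInf_le (hbdd n) k).trans ?_⟩
      have h1 := (hM n).le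
      have h2 := hC0 k
      gcongr
      linarith
    · rw [← div_le_iff₀ (hη x)]
      exact le_ciInf fun k => by
        rw [div_le_iff₀ (hη x)]
        exact hC k φ hφ n x
  | roumieu =>
    obtain ⟨m, hm, C, hC⟩ := h
    exact ⟨fun n => |C| * M n / (m / (d + 1)) ^ n, ⟨m / (d + 1), by positivity, |C|, fun n => le_rfl⟩,
      fun φ hφ => ⟨hS φ hφ, key m hm C hC φ hφ⟩⟩

theorem exists_ball_of_mem_limit (hM : ∀ n, 0 < M n) (hη : ∀ x, 0 < η x)
    {E : Submodule ℂ (Rd d → ℂ)} {φ : Rd d → ℂ} (hφ : φ ∈ limitSubmodule cls M η E) :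
    ∃ b, Dom cls M b ∧ φ ∈ Ball η b := by
  cases cls with
  | beurling =>
    simp only [limitSubmodule, Submodule.mem_iInf] at hφ
    obtain ⟨b, hb, h⟩ := exists_ball (cls := .beurling) hM hη (S := {φ})
      (by rintro _ rfl; exact (hφ 1 one_pos).1)
      (fun m hm => ⟨stepNorm M η m φ, by rintro _ rfl; exact le_stepNorm hM hη hm (hφ m hm)⟩)
    exact ⟨b, hb, h rfl⟩
  | roumieu =>
    obtain ⟨m, hm, hφ⟩ := hφ
    obtain ⟨b, hb, h⟩ := exists_ball (cls := .roumieu) hM hη (S := {φ})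
      (by rintro _ rfl; exact hφ.1)
      ⟨m, hm, stepNorm M η m φ, by rintro _ rfl; exact le_stepNorm hM hη hm hφ⟩
    exact ⟨b, hb, h rfl⟩

end Spaces

end Ultra
end

noncomputable section
namespace Ultra

/-! ### Band-limited cut-off functions and the partition of unity -/

section Cutoff

open MeasureTheory FourierTransform in
/-- There is a band-limited Schwartz function with value `1` at the origin. -/
theorem exists_bandLimited (d : ℕ) : ∃ χ : Rd d → ℂ, ContDiff ℝ ∞ χ ∧ χ 0 = 1 ∧
    (∃ C h : ℝ, 0 ≤ C ∧ 0 ≤ h ∧ ∀ n x, ‖iteratedFDeriv ℝ n χ x‖ ≤ C * h ^ n) ∧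
    ∀ n, ∃ K : ℝ, ∀ x, ‖x‖ * ‖iteratedFDeriv ℝ n χ x‖ ≤ K := by
  -- The function is the Fourier transform of a bump with integral `1`, supported in the ball of
  -- radius `2`. Differentiation multiplies the bump by factors of size at most `2π * 2`, whence `h
  -- = 4π`; the decay holds because the transform is a Schwartz function.
  let ρ : ContDiffBump (0 : Rd d) := ⟨1, 2, one_pos, one_lt_two⟩
  let f : Rd d → ℂ := fun v => (ρ.normed volume v : ℂ)
  have hf : ContDiff ℝ ∞ f := Complex.ofRealCLM.contDiff.comp ρ.contDiff_normed
  have hsupp : HasCompactSupport f :=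
    (ρ.hasCompactSupport_normed (μ := volume)).comp_left (g := fun t : ℝ => (t : ℂ)) (by simp)
  let S : SchwartzMap (Rd d) ℂ := hsupp.toSchwartzMap hf
  have hint : ∀ n : ℕ, Integrable (fun v => ‖v‖ ^ n * ‖f v‖) := fun n =>
    S.integrable_pow_mul volume n
  refine ⟨𝓕 f, ?_, ?_, ?_, ?_⟩
  · exact (𝓕 S).smooth'
  · rw [Real.fourier_eq]
    simp only [inner_zero_right, neg_zero, AddChar.map_zero_eq_one, one_smul, f]
    rw [integral_complex_ofReal, ρ.integral_normed]
    simp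
  · refine ⟨∫ v, ‖f v‖, 4 * Real.pi, integral_nonneg fun _ => norm_nonneg _, by positivity,
      fun n x => ?_⟩
    rw [Real.iteratedFDeriv_fourier (N := ⊤) (fun n _ => hint n) hf.continuous.aestronglyMeasurable
      (by exact_mod_cast le_top)]
    refine (VectorFourier.norm_fourierIntegral_le_integral_norm _ _ _ _ _).trans ?_
    rw [mul_comm, ← integral_const_mul]
    refine integral_mono_of_nonneg (Eventually.of_forall fun _ => norm_nonneg _)
      ((by simpa using hint 0 : Integrable (fun v => ‖f v‖)).const_mul _)
      (Eventually.of_forall fun v => ?_)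
    refine (VectorFourier.norm_fourierPowSMulRight_le (innerSL ℝ) f v n).trans ?_
    dsimp only
    by_cases hv : f v = 0
    · simp [hv]
    have hv2 : ‖v‖ ≤ 2 := by
      have h1 : v ∈ Function.support (ρ.normed volume) := fun h => hv (by simp [f, h])
      rw [ρ.support_normed_eq] at h1
      simpa using (Metric.mem_ball.1 h1).le
    have hL : ‖(innerSL ℝ : Rd d →L[ℝ] Rd d →L[ℝ] ℝ)‖ ≤ 1 := norm_innerSL_le ℝ
    rw [← mul_pow]
    refine mul_le_mul_of_nonneg_right (pow_le_pow_left₀ (by positivity) ?_ n) (norm_nonneg _)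
    calc 2 * Real.pi * ‖(innerSL ℝ : Rd d →L[ℝ] Rd d →L[ℝ] ℝ)‖ * ‖v‖ ≤ 2 * Real.pi * 1 * 2 := by
          gcongr
      _ = _ := by ring
  · intro n
    obtain ⟨K, -, hK⟩ := (𝓕 S).decay 1 n
    exact ⟨K, fun x => by
      have := hK x
      rw [pow_one] at this
      exact this⟩

/-- A band-limited Schwartz function with value `1` at the origin. -/
def bandLimited (d : ℕ) : Rd d → ℂ := (exists_bandLimited d).choose

/-- Dilations of a band-limited Schwartz function, which tend to `1`. -/
def cut (d N : ℕ) (x : Rd d) : ℂ := bandLimited d ((2⁻¹ : ℝ) ^ N • x)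

variable {d : ℕ}

theorem contDiff_cut (N : ℕ) : ContDiff ℝ ∞ (cut d N) :=
  (exists_bandLimited d).choose_spec.1.comp (contDiff_const_smul _)

theorem iteratedFDeriv_cut (N n : ℕ) (x : Rd d) : iteratedFDeriv ℝ n (cut d N) x =
    ((2⁻¹ : ℝ) ^ N) ^ n • iteratedFDeriv ℝ n (bandLimited d) ((2⁻¹ : ℝ) ^ N • x) :=
  congrFun (iteratedFDeriv_comp_const_smul (𝕜 := ℝ) (i := n) ((2⁻¹ : ℝ) ^ N)
    ((exists_bandLimited d).choose_spec.1.of_le (by exact_mod_cast le_top))) x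

theorem norm_iteratedFDeriv_cut (N n : ℕ) (x : Rd d) : ‖iteratedFDeriv ℝ n (cut d N) x‖ =
    ((2⁻¹ : ℝ) ^ N) ^ n * ‖iteratedFDeriv ℝ n (bandLimited d) ((2⁻¹ : ℝ) ^ N • x)‖ := by
  rw [iteratedFDeriv_cut, norm_smul, Real.norm_eq_abs, abs_of_nonneg (by positivity)]

/-- The dilation factor is kept because it makes the derivatives of order `n ≥ 1` summable over `N`.
-/
theorem exists_cut_bound (d : ℕ) : ∃ C h : ℝ, 0 ≤ C ∧ 0 ≤ h ∧ ∀ N n, ∀ x : Rd d,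
    ‖iteratedFDeriv ℝ n (cut d N) x‖ ≤ ((2⁻¹ : ℝ) ^ N) ^ n * (C * h ^ n) := by
  obtain ⟨C, h, hC, hh, H⟩ := (exists_bandLimited d).choose_spec.2.2.1
  refine ⟨C, h, hC, hh, fun N n x => ?_⟩
  rw [norm_iteratedFDeriv_cut]
  gcongr
  exact H n _

theorem cut_decay (N n : ℕ) : ∃ K : ℝ, 0 ≤ K ∧
    ∀ x : Rd d, ‖x‖ * ‖iteratedFDeriv ℝ n (cut d N) x‖ ≤ K := by
  obtain ⟨K, H⟩ := (exists_bandLimited d).choose_spec.2.2.2 n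
  refine ⟨2 ^ N * |K|, by positivity, fun x => ?_⟩
  rw [norm_iteratedFDeriv_cut]
  have h1 := H ((2⁻¹ : ℝ) ^ N • x)
  rw [norm_smul, Real.norm_eq_abs, abs_of_nonneg (by positivity)] at h1
  have h2 : ((2⁻¹ : ℝ) ^ N) ^ n ≤ 1 :=
    pow_le_one₀ (by positivity) (pow_le_one₀ (by positivity) (by norm_num))
  have h3 : (2 : ℝ) ^ N * (2⁻¹ : ℝ) ^ N = 1 := by rw [← mul_pow]; norm_num
  set a := ‖iteratedFDeriv ℝ n (bandLimited d) ((2⁻¹ : ℝ) ^ N • x)‖ with ha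
  have ha0 : 0 ≤ a := norm_nonneg _
  calc ‖x‖ * (((2⁻¹ : ℝ) ^ N) ^ n * a) ≤ ‖x‖ * (1 * a) := by gcongr
    _ = (2 ^ N * (2⁻¹ : ℝ) ^ N) * (‖x‖ * a) := by rw [h3]; ring
    _ = 2 ^ N * ((2⁻¹ : ℝ) ^ N * ‖x‖ * a) := by ring
    _ ≤ 2 ^ N * K := by gcongr; exact h1
    _ ≤ _ := by gcongr; exact le_abs_self K

theorem cut_zero_apply (N : ℕ) : cut d N 0 = 1 := by
  simp only [cut, smul_zero]
  exact (exists_bandLimited d).choose_spec.2.1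

theorem exists_cut_sub_one_le (d : ℕ) : ∃ L : ℝ, 0 ≤ L ∧ ∀ N, ∀ x : Rd d,
    ‖cut d N x - 1‖ ≤ L * ((2⁻¹ : ℝ) ^ N * ‖x‖) := by
  obtain ⟨C, h, hC, hh, H⟩ := exists_cut_bound d
  refine ⟨C * h, by positivity, fun N x => ?_⟩
  have h1 : ∀ y ∈ (Set.univ : Set (Rd d)), ‖fderiv ℝ (cut d N) y‖ ≤ (2⁻¹ : ℝ) ^ N * (C * h) := by
    intro y _
    rw [← norm_iteratedFDeriv_one]
    simpa using H N 1 y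
  have h2 := convex_univ.norm_image_sub_le_of_norm_fderiv_le (𝕜 := ℝ) (f := cut d N)
    (fun y _ => ((contDiff_cut N).differentiable (by simp)) y) h1 (Set.mem_univ 0) (Set.mem_univ x)
  rw [cut_zero_apply, sub_zero] at h2
  exact h2.trans (le_of_eq (by ring))

/-- The pieces of a partition of unity, `1 = cut d 0 + ∑ k, annulus d k`. -/
def annulus (d k : ℕ) : Rd d → ℂ := fun x => cut d (k + 1) x - cut d k x

theorem contDiff_annulus (k : ℕ) : ContDiff ℝ ∞ (annulus d k) := (contDiff_cut _).sub (contDiff_cut _)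

theorem iteratedFDeriv_annulus (k n : ℕ) (x : Rd d) : iteratedFDeriv ℝ n (annulus d k) x =
    iteratedFDeriv ℝ n (cut d (k + 1)) x - iteratedFDeriv ℝ n (cut d k) x :=
  iteratedFDeriv_sub_apply ((contDiff_cut _).of_le (by exact_mod_cast le_top)).contDiffAt
    ((contDiff_cut _).of_le (by exact_mod_cast le_top)).contDiffAt

/-- A quantity of size `min t (1 / t)` is dominated by the increment of `s ↦ s / (1 + s)` between
`t` and `2 t`. For `t = 2 ^ (-k) ‖x‖` these increments telescope in `k`, with a total independent of
`x`. -/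
theorem le_telescope {a A t : ℝ} (ha : 0 ≤ a) (ht : 0 ≤ t) (hA : 0 ≤ A) (h1 : a ≤ A * t)
    (h2 : t * a ≤ A) : a ≤ 6 * A * (2 * t / (1 + 2 * t) - t / (1 + t)) := by
  have h3 : a ≤ A := by
    have : a * a ≤ A * A := by nlinarith
    nlinarith
  have h4 : 2 * t / (1 + 2 * t) - t / (1 + t) = t / ((1 + 2 * t) * (1 + t)) := by
    field_simp
    ring
  rw [h4, ← mul_div_assoc, le_div_iff₀ (by positivity)]
  -- The constant: `(1 + 2t)(1 + t) a = a + 3ta + 2t²a ≤ (1 + 3 + 2) A t`.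
  nlinarith [mul_le_mul_of_nonneg_left h2 ht, mul_le_mul_of_nonneg_left h3 ht]

/-- In order zero the dilation gives no gain. With `t = 2 ^ (-k) ‖x‖`, the piece is `O(t)` because
both cut-offs differ from `1` by `O(t)`, and it is `O(1 / t)` by the decay of the cut-offs, so
`le_telescope` applies. -/
theorem exists_sum_annulus_zero (d : ℕ) : ∃ C : ℝ, 0 ≤ C ∧ ∀ (F : Finset ℕ) (x : Rd d),
    ∑ k ∈ F, ‖annulus d k x‖ ≤ C := by
  obtain ⟨L, hL, H⟩ := exists_cut_sub_one_le d
  obtain ⟨K, H'⟩ := (exists_bandLimited d).choose_spec.2.2.2 0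
  have H' : ∀ x : Rd d, ‖x‖ * ‖bandLimited d x‖ ≤ |K| := fun x =>
    by
    have := H' x
    rw [norm_iteratedFDeriv_zero] at this
    exact this.trans (le_abs_self K)
  have hcut : ∀ N, ∀ x : Rd d, (2⁻¹ : ℝ) ^ N * ‖x‖ * ‖cut d N x‖ ≤ |K| := by
    intro N x
    have := H' ((2⁻¹ : ℝ) ^ N • x)
    rwa [norm_smul, Real.norm_eq_abs, abs_of_nonneg (by positivity)] at this
  let A : ℝ := 2 * L + 3 * |K|
  have hA : 0 ≤ A := by positivity
  refine ⟨6 * A, by positivity, fun F x => ?_⟩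
  let t : ℕ → ℝ := fun k => (2⁻¹ : ℝ) ^ k * ‖x‖
  have ht : ∀ k, 0 ≤ t k := fun k => by positivity
  have ht1 : ∀ k, t (k + 1) = t k / 2 := fun k => by simp only [t, pow_succ]; ring
  let u : ℕ → ℝ := fun k => 2 * t k / (1 + 2 * t k)
  have hk : ∀ k, ‖annulus d k x‖ ≤ 6 * A * (u k - u (k + 1)) := by
    intro k
    have e : u k - u (k + 1) = 2 * t k / (1 + 2 * t k) - t k / (1 + t k) := by
      simp only [u, ht1]
      congr 2 <;> ring
    rw [e]
    refine le_telescope (norm_nonneg _) (ht k) hA ?_ ?_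
    · have h1 := H (k + 1) x
      have h2 := H k x
      have h3 : ‖annulus d k x‖ ≤ ‖cut d (k + 1) x - 1‖ + ‖cut d k x - 1‖ := by
        have : annulus d k x = (cut d (k + 1) x - 1) - (cut d k x - 1) := by simp [annulus]
        rw [this]
        exact norm_sub_le _ _
      change _ ≤ L * t (k + 1) at h1
      change _ ≤ L * t k at h2
      rw [ht1] at h1
      have h4 : 0 ≤ L * t k := mul_nonneg hL (ht k)
      have h5 : 0 ≤ |K| * t k := mul_nonneg (abs_nonneg K) (ht k)
      simp only [A]
      nlinarith
    · have h1 := hcut (k + 1) x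
      have h2 := hcut k x
      change t (k + 1) * _ ≤ _ at h1
      change t k * _ ≤ _ at h2
      rw [ht1] at h1
      have h3 : ‖annulus d k x‖ ≤ ‖cut d (k + 1) x‖ + ‖cut d k x‖ := norm_sub_le _ _
      have h4 := mul_le_mul_of_nonneg_left h3 (ht k)
      simp only [A]
      nlinarith
  have hu : ∀ k, 0 ≤ 6 * A * (u k - u (k + 1)) := fun k => (norm_nonneg _).trans (hk k)
  obtain ⟨N, hN⟩ := F.exists_nat_subset_range
  calc ∑ k ∈ F, ‖annulus d k x‖ ≤ ∑ k ∈ F, 6 * A * (u k - u (k + 1)) :=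
        Finset.sum_le_sum fun k _ => hk k
    _ ≤ ∑ k ∈ Finset.range N, 6 * A * (u k - u (k + 1)) :=
        Finset.sum_le_sum_of_subset_of_nonneg hN fun k _ _ => hu k
    _ = 6 * A * (u 0 - u N) := by rw [← Finset.mul_sum, Finset.sum_range_sub']
    _ ≤ 6 * A * 1 := by
        gcongr
        have h1 : u 0 ≤ 1 := by
          have := ht 0
          simp only [u]
          rw [div_le_one (by positivity)]
          linarith
        have h2 : 0 ≤ u N := by
          have := ht N
          simp only [u]
          positivity
        linarith
    _ = _ := mul_one _

/-- The derivatives of the cut-off functions, and the sums of the derivatives of the pieces of the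
partition of unity, are uniformly bounded by a geometric sequence. -/
theorem exists_annulus_bound (d : ℕ) : ∃ C h : ℝ, 0 ≤ C ∧ 0 ≤ h ∧
    (∀ N n, ∀ x : Rd d, ‖iteratedFDeriv ℝ n (cut d N) x‖ ≤ C * h ^ n) ∧
    ∀ (F : Finset ℕ) (n : ℕ) (x : Rd d),
      ∑ k ∈ F, ‖iteratedFDeriv ℝ n (annulus d k) x‖ ≤ C * h ^ n := by
  obtain ⟨C, h, hC, hh, H⟩ := exists_cut_bound d
  obtain ⟨C', hC', H'⟩ := exists_sum_annulus_zero d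
  refine ⟨C' + 4 * C, h, by positivity, hh, fun N n x => ?_, fun F n x => ?_⟩
  · refine (H N n x).trans ?_
    have : ((2⁻¹ : ℝ) ^ N) ^ n ≤ 1 :=
      pow_le_one₀ (by positivity) (pow_le_one₀ (by positivity) (by norm_num))
    calc ((2⁻¹ : ℝ) ^ N) ^ n * (C * h ^ n) ≤ 1 * (C * h ^ n) := by gcongr
      _ ≤ _ := by rw [one_mul]; gcongr; linarith
  · rcases Nat.eq_zero_or_pos n with rfl | hn
    · simp only [norm_iteratedFDeriv_zero, pow_zero, mul_one]
      exact (H' F x).trans (by linarith)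
    · have hcut : ∀ k, ‖iteratedFDeriv ℝ n (cut d k) x‖ ≤ (2⁻¹ : ℝ) ^ k * (C * h ^ n) := by
        intro k
        refine (H k n x).trans ?_
        gcongr
        exact pow_le_of_le_one (by positivity) (pow_le_one₀ (by positivity) (by norm_num)) hn.ne'
      have h1 : ∀ k ∈ F, ‖iteratedFDeriv ℝ n (annulus d k) x‖ ≤
          (1 / 2 : ℝ) ^ k * (2 * (C * h ^ n)) := by
        intro k _
        rw [iteratedFDeriv_annulus]
        refine (norm_sub_le _ _).trans ?_
        have h2 := hcut (k + 1)
        have h3 := hcut k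
        have h4 : (2⁻¹ : ℝ) ^ (k + 1) ≤ (2⁻¹ : ℝ) ^ k :=
          pow_le_pow_of_le_one (by norm_num) (by norm_num) (Nat.le_succ k)
        have h5 : 0 ≤ C * h ^ n := by positivity
        have h6 := mul_le_mul_of_nonneg_right h4 h5
        rw [one_div]
        linarith
      refine (Finset.sum_le_sum h1).trans ?_
      rw [← Finset.sum_mul]
      have h7 : ∑ k ∈ F, (1 / 2 : ℝ) ^ k ≤ 2 := by
        refine (summable_geometric_two.sum_le_tsum F fun k _ => by positivity).trans ?_
        exact tsum_geometric_two.le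
      calc (∑ k ∈ F, (1 / 2 : ℝ) ^ k) * (2 * (C * h ^ n)) ≤ 2 * (2 * (C * h ^ n)) := by gcongr
        _ = 4 * C * h ^ n := by ring
        _ ≤ _ := by gcongr; linarith

end Cutoff

end Ultra
end

noncomputable section
namespace Ultra

variable {d : ℕ}

/-- The assumptions on the defining sequence and on the weight function that are needed below. -/
class Admissible (M : ℕ → ℝ) (η : Rd d → ℝ) : Prop where
  mseq : IsMSequence M
  continuous : Continuous η
  pos : ∀ x, 0 < η x

/-! ### Balls and multiplication by cut-off functions -/

section Balls

variable {η : Rd d → ℝ} {b : ℕ → ℝ}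

theorem iteratedFDeriv_add_fun {φ ψ : Rd d → ℂ} (hφ : ContDiff ℝ ∞ φ) (hψ : ContDiff ℝ ∞ ψ)
    (n : ℕ) (x : Rd d) : iteratedFDeriv ℝ n (φ + ψ) x =
      iteratedFDeriv ℝ n φ x + iteratedFDeriv ℝ n ψ x :=
  iteratedFDeriv_add_apply (hφ.of_le (by exact_mod_cast le_top)).contDiffAt
    (hψ.of_le (by exact_mod_cast le_top)).contDiffAt

theorem iteratedFDeriv_sub_fun {φ ψ : Rd d → ℂ} (hφ : ContDiff ℝ ∞ φ) (hψ : ContDiff ℝ ∞ ψ)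
    (n : ℕ) (x : Rd d) : iteratedFDeriv ℝ n (φ - ψ) x =
      iteratedFDeriv ℝ n φ x - iteratedFDeriv ℝ n ψ x :=
  iteratedFDeriv_sub_apply (hφ.of_le (by exact_mod_cast le_top)).contDiffAt
    (hψ.of_le (by exact_mod_cast le_top)).contDiffAt

theorem iteratedFDeriv_smul_fun {φ : Rd d → ℂ} (hφ : ContDiff ℝ ∞ φ) (c : ℂ)
    (n : ℕ) (x : Rd d) : iteratedFDeriv ℝ n (c • φ) x = c • iteratedFDeriv ℝ n φ x :=
  iteratedFDeriv_const_smul_apply (hφ.of_le (by exact_mod_cast le_top)).contDiffAt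

theorem norm_iteratedFDeriv_mul {φ ψ : Rd d → ℂ} (hφ : ContDiff ℝ ∞ φ) (hψ : ContDiff ℝ ∞ ψ)
    (n : ℕ) (x : Rd d) : ‖iteratedFDeriv ℝ n (φ * ψ) x‖ ≤ ∑ i ∈ Finset.range (n + 1),
      (n.choose i : ℝ) * ‖iteratedFDeriv ℝ i φ x‖ * ‖iteratedFDeriv ℝ (n - i) ψ x‖ :=
  norm_iteratedFDeriv_mul_le hφ hψ x (by exact_mod_cast le_top)

/-- In the Leibniz formula only the sums over `k` of the derivatives of `a k` enter. Each `k` may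
therefore carry its own function and coefficient, and this freedom is what `DualL1.exists_summable`
exploits. -/
theorem sum_smul_mul_mem_ball {ι : Type*} {F : Finset ι} {a φ : ι → Rd d → ℂ} {c : ι → ℂ}
    {C h : ℝ} (ha : ∀ k ∈ F, ContDiff ℝ ∞ (a k)) (hc : ∀ k ∈ F, ‖c k‖ ≤ 1)
    (hφ : ∀ k ∈ F, φ k ∈ Ball η b)
    (hsum : ∀ n x, ∑ k ∈ F, ‖iteratedFDeriv ℝ n (a k) x‖ ≤ C * h ^ n) (hb : ∀ n, 0 ≤ b n)
    (hη : ∀ x, 0 < η x) : ∑ k ∈ F, c k • (a k * φ k) ∈ Ball η (prodBound C h b) := by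
  have h1 : ∀ k ∈ F, ContDiff ℝ ∞ (c k • (a k * φ k)) := fun k hk =>
    contDiff_const.smul ((ha k hk).mul (hφ k hk).1)
  have e1 : ∑ k ∈ F, c k • (a k * φ k) = fun x => ∑ k ∈ F, (c k • (a k * φ k)) x := by
    funext x
    simp
  refine ⟨by rw [e1]; exact ContDiff.sum h1, fun n x => ?_⟩
  have e2 : iteratedFDeriv ℝ n (∑ k ∈ F, c k • (a k * φ k)) x =
      ∑ k ∈ F, iteratedFDeriv ℝ n (c k • (a k * φ k)) x := by
    rw [e1, iteratedFDeriv_fun_sum_apply (fun k hk =>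
      ((h1 k hk).of_le (by exact_mod_cast le_top)).contDiffAt)]
  rw [e2]
  calc ‖∑ k ∈ F, iteratedFDeriv ℝ n (c k • (a k * φ k)) x‖
      ≤ ∑ k ∈ F, ‖iteratedFDeriv ℝ n (c k • (a k * φ k)) x‖ := norm_sum_le _ _
    _ ≤ ∑ k ∈ F, ∑ i ∈ Finset.range (n + 1), (n.choose i : ℝ) * ‖iteratedFDeriv ℝ i (a k) x‖ *
          (b (n - i) * η x) := by
        refine Finset.sum_le_sum fun k hk => ?_
        rw [iteratedFDeriv_smul_fun (φ := a k * φ k) ((ha k hk).mul (hφ k hk).1), norm_smul]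
        have h2 := norm_iteratedFDeriv_mul (ha k hk) (hφ k hk).1 n x
        have h3 : ‖c k‖ * ‖iteratedFDeriv ℝ n (a k * φ k) x‖ ≤
            1 * ‖iteratedFDeriv ℝ n (a k * φ k) x‖ := by gcongr; exact hc k hk
        rw [one_mul] at h3
        refine h3.trans (h2.trans (Finset.sum_le_sum fun i _ => ?_))
        gcongr
        exact (hφ k hk).2 _ x
    _ = ∑ i ∈ Finset.range (n + 1), (n.choose i : ℝ) *
          (∑ k ∈ F, ‖iteratedFDeriv ℝ i (a k) x‖) * (b (n - i) * η x) := by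
        rw [Finset.sum_comm]
        refine Finset.sum_congr rfl fun i _ => ?_
        rw [Finset.mul_sum, Finset.sum_mul]
    _ ≤ ∑ i ∈ Finset.range (n + 1), (n.choose i : ℝ) * (C * h ^ i) * (b (n - i) * η x) := by
        refine Finset.sum_le_sum fun i _ => ?_
        have := hb (n - i)
        have := (hη x).le
        gcongr
        exact hsum i x
    _ = prodBound C h b n * η x := by
        rw [prodBound, Finset.sum_mul]
        exact Finset.sum_congr rfl fun i _ => by ring

theorem nonneg_of_mem_ball (hη : ∀ x, 0 < η x) {φ : Rd d → ℂ} (hφ : φ ∈ Ball η b) (n : ℕ) :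
    0 ≤ b n :=
  nonneg_of_mul_nonneg_left ((norm_nonneg _).trans (hφ.2 n 0)) (hη 0)

theorem vanish_of_decay {φ : Rd d → ℂ} (hη : ∀ x, 0 < η x)
    (h : ∀ n, ∃ K : ℝ, 0 ≤ K ∧ ∀ x, ‖x‖ * ‖iteratedFDeriv ℝ n φ x‖ ≤ K * η x) : φ ∈ Vanish η := by
  intro n ε hε
  obtain ⟨K, hK, H⟩ := h n
  refine ⟨K / ε, fun x hx => ?_⟩
  have h1 : 0 < ‖x‖ := (div_nonneg hK hε.le).trans_lt hx
  rw [div_lt_iff₀ hε] at hx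
  have h2 := H x
  have h3 := hη x
  refine le_of_mul_le_mul_left (h2.trans ?_) h1
  calc K * η x ≤ ‖x‖ * ε * η x := by gcongr
    _ = _ := by ring

theorem cut_mul_decay (hη : ∀ x, 0 < η x) {φ : Rd d → ℂ} (hφ : φ ∈ Ball η b) (N n : ℕ) :
    ∃ K : ℝ, 0 ≤ K ∧ ∀ x, ‖x‖ * ‖iteratedFDeriv ℝ n (cut d N * φ) x‖ ≤ K * η x := by
  choose K hK H using fun n => cut_decay (d := d) N n
  have hb := nonneg_of_mem_ball hη hφ
  refine ⟨∑ i ∈ Finset.range (n + 1), (n.choose i : ℝ) * K i * b (n - i),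
    Finset.sum_nonneg fun i _ => mul_nonneg (mul_nonneg (Nat.cast_nonneg _) (hK i)) (hb _),
    fun x => ?_⟩
  calc ‖x‖ * ‖iteratedFDeriv ℝ n (cut d N * φ) x‖
      ≤ ‖x‖ * ∑ i ∈ Finset.range (n + 1), (n.choose i : ℝ) * ‖iteratedFDeriv ℝ i (cut d N) x‖ *
          ‖iteratedFDeriv ℝ (n - i) φ x‖ := by
        gcongr
        exact norm_iteratedFDeriv_mul (contDiff_cut N) hφ.1 n x
    _ = ∑ i ∈ Finset.range (n + 1), (n.choose i : ℝ) *
          (‖x‖ * ‖iteratedFDeriv ℝ i (cut d N) x‖) * ‖iteratedFDeriv ℝ (n - i) φ x‖ := by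
        rw [Finset.mul_sum]
        exact Finset.sum_congr rfl fun i _ => by ring
    _ ≤ ∑ i ∈ Finset.range (n + 1), (n.choose i : ℝ) * K i * (b (n - i) * η x) := by
        refine Finset.sum_le_sum fun i _ => ?_
        have := hK i
        gcongr
        · exact H i x
        · exact hφ.2 _ x
    _ = _ := by
        rw [Finset.sum_mul]
        exact Finset.sum_congr rfl fun i _ => by ring

/-- The bound for the derivatives of products with cut-off functions. -/
def cutBound (d : ℕ) (b : ℕ → ℝ) : ℕ → ℝ :=
  prodBound (exists_annulus_bound d).choose (exists_annulus_bound d).choose_spec.choose b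

theorem Dom.cutBound {cls : UltraClass} {M : ℕ → ℝ} (hM : IsMSequence M) (hb : Dom cls M b) :
    Dom cls M (cutBound d b) :=
  hb.prodBound hM (exists_annulus_bound d).choose_spec.choose_spec.1
    (exists_annulus_bound d).choose_spec.choose_spec.2.1

theorem cut_mul_mem_ball (hη : ∀ x, 0 < η x) {φ : Rd d → ℂ} (hφ : φ ∈ Ball η b) (N : ℕ) :
    cut d N * φ ∈ Ball η (cutBound d b) := by
  have := sum_smul_mul_mem_ball (F := {N}) (a := fun _ => cut d N) (φ := fun _ => φ)
    (c := fun _ => 1) (η := η) (b := b) (fun _ _ => contDiff_cut N) (fun _ _ => by simp)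
    (fun _ _ => hφ) (fun n x => by
      simpa using (exists_annulus_bound d).choose_spec.choose_spec.2.2.1 N n x)
    (nonneg_of_mem_ball hη hφ) hη
  simpa [cutBound] using this

theorem sum_annulus_mul_mem_ball (hη : ∀ x, 0 < η x) {F : Finset ℕ} {φ : ℕ → Rd d → ℂ}
    {c : ℕ → ℂ} (hc : ∀ k, ‖c k‖ ≤ 1) (hφ : ∀ k, φ k ∈ Ball η b) :
    ∑ k ∈ F, c k • (annulus d k * φ k) ∈ Ball η (cutBound d b) :=
  sum_smul_mul_mem_ball (fun k _ => contDiff_annulus k) (fun k _ => hc k) (fun k _ => hφ k)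
    (fun n x => (exists_annulus_bound d).choose_spec.choose_spec.2.2.2 F n x)
    (nonneg_of_mem_ball hη (hφ 0)) hη

theorem sub_mem_ball {b' : ℕ → ℝ} {φ ψ : Rd d → ℂ} (hφ : φ ∈ Ball η b) (hψ : ψ ∈ Ball η b') :
    φ - ψ ∈ Ball η (b + b') :=
  ⟨hφ.1.sub hψ.1, fun n x => by
    rw [iteratedFDeriv_sub_fun hφ.1 hψ.1, Pi.add_apply, add_mul]
    exact (norm_sub_le _ _).trans (add_le_add (hφ.2 n x) (hψ.2 n x))⟩

theorem Dom.add {cls : UltraClass} {M : ℕ → ℝ} (hM : ∀ n, 0 < M n) {b' : ℕ → ℝ}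
    (hb : Dom cls M b) (hb' : Dom cls M b') : Dom cls M (b + b') := by
  cases cls with
  | beurling =>
    intro m hm
    obtain ⟨C, hC⟩ := hb m hm
    obtain ⟨C', hC'⟩ := hb' m hm
    exact ⟨C + C', fun n => by
      rw [Pi.add_apply, add_mul, add_div]; exact add_le_add (hC n) (hC' n)⟩
  | roumieu =>
    obtain ⟨m, hm, C, hC⟩ := hb
    obtain ⟨m', hm', C', hC'⟩ := hb'
    refine ⟨min m m', lt_min hm hm', |C| + |C'|, fun n => ?_⟩
    have h1 := (hM n).le
    have h2 : 0 < min m m' := lt_min hm hm'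
    rw [Pi.add_apply, add_mul, add_div]
    refine add_le_add ((hC n).trans ?_) ((hC' n).trans ?_)
    · gcongr
      · exact le_abs_self C
      · exact min_le_left _ _
    · gcongr
      · exact le_abs_self C'
      · exact min_le_right _ _

end Balls

/-! ### Continuous seminorms and balls -/

section Seminorms

variable {cls : UltraClass} {M : ℕ → ℝ} {η : Rd d → ℝ}

theorem stepNorm_le_of_mderiv (hM : ∀ n, 0 < M n) (hη : ∀ x, 0 < η x) {m : ℝ} (hm : 0 < m)
    {φ : Rd d → ℂ} {C : ℝ}
    (hC : ∀ α x, ‖mderiv α φ x‖ ≤ C * M (∑ j, α j) / m ^ (∑ j, α j) * η x) :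
    stepNorm M η m φ ≤ C := by
  refine ciSup_le fun α => ?_
  rw [div_le_iff₀ (hM _), ← le_div_iff₀' (by positivity)]
  refine ciSup_le fun x => ?_
  rw [div_le_iff₀ (hη x)]
  exact hC α x

theorem stepNorm_mono (hM : ∀ n, 0 < M n) (hη : ∀ x, 0 < η x) {m m' : ℝ} (hm : 0 < m)
    (hmm : m ≤ m') {E : Submodule ℂ (Rd d → ℂ)} {φ : Rd d → ℂ} (hφ : φ ∈ step M η E m') :
    stepNorm M η m φ ≤ stepNorm M η m' φ := by
  have hm' := hm.trans_le hmm
  refine stepNorm_le_of_mderiv hM hη hm fun α x => (le_stepNorm hM hη hm' hφ α x).trans ?_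
  have h1 := (hM (∑ j, α j)).le
  have h2 := (hη x).le
  have h3 := stepNorm_nonneg hM hη hm' φ
  gcongr

theorem DSpace.mem_step {E : Submodule ℂ (Rd d → ℂ)} (φ : DSpace .beurling M η E) {m : ℝ}
    (hm : 0 < m) : φ.toFun ∈ step M η E m := by
  have h : φ.toFun ∈ limitSubmodule .beurling M η E := φ.2
  simp only [limitSubmodule, Submodule.mem_iInf] at h
  exact h m hm

variable {E : Submodule ℂ (Rd d → ℂ)}

theorem IsLimitSeminorm.mono {p q : Seminorm ℂ (DSpace cls M η E)}
    (hp : IsLimitSeminorm cls M η E p) (h : q ≤ p) : IsLimitSeminorm cls M η E q := by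
  cases cls with
  | beurling =>
    obtain ⟨m, hm, C, hC⟩ := hp
    exact ⟨m, hm, C, fun φ => (h φ).trans (hC φ)⟩
  | roumieu =>
    intro m hm
    obtain ⟨C, hC⟩ := hp m hm
    exact ⟨C, fun φ hφ => (h φ).trans (hC φ hφ)⟩

theorem IsLimitSeminorm.smul {p : Seminorm ℂ (DSpace cls M η E)}
    (hp : IsLimitSeminorm cls M η E p) (a : NNReal) : IsLimitSeminorm cls M η E (a • p) := by
  cases cls with
  | beurling =>
    obtain ⟨m, hm, C, hC⟩ := hp
    refine ⟨m, hm, a * C, fun φ => ?_⟩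
    rw [smul_apply, NNReal.smul_def, smul_eq_mul, mul_assoc]
    exact mul_le_mul_of_nonneg_left (hC φ) a.2
  | roumieu =>
    intro m hm
    obtain ⟨C, hC⟩ := hp m hm
    refine ⟨a * C, fun φ hφ => ?_⟩
    rw [smul_apply, NNReal.smul_def, smul_eq_mul, mul_assoc]
    exact mul_le_mul_of_nonneg_left (hC φ hφ) a.2

theorem IsLimitSeminorm.sup (hM : ∀ n, 0 < M n) (hη : ∀ x, 0 < η x)
    {p q : Seminorm ℂ (DSpace cls M η E)} (hp : IsLimitSeminorm cls M η E p)
    (hq : IsLimitSeminorm cls M η E q) : IsLimitSeminorm cls M η E (p ⊔ q) := by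
  cases cls with
  | beurling =>
    obtain ⟨m, hm, C, hC⟩ := hp
    obtain ⟨m', hm', C', hC'⟩ := hq
    refine ⟨max m m', lt_max_of_lt_left hm, max |C| |C'|, fun φ => ?_⟩
    have h0 : 0 < max m m' := lt_max_of_lt_left hm
    have h1 := stepNorm_mono hM hη hm (le_max_left m m') (φ.mem_step h0)
    have h2 := stepNorm_mono hM hη hm' (le_max_right m m') (φ.mem_step h0)
    have h3 := stepNorm_nonneg hM hη hm φ.toFun
    have h4 := stepNorm_nonneg hM hη hm' φ.toFun
    refine max_le ((hC φ).trans ?_) ((hC' φ).trans ?_)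
    · exact mul_le_mul ((le_abs_self C).trans (le_max_left _ _)) h1 h3 (by positivity)
    · exact mul_le_mul ((le_abs_self C').trans (le_max_right _ _)) h2 h4 (by positivity)
  | roumieu =>
    intro m hm
    obtain ⟨C, hC⟩ := hp m hm
    obtain ⟨C', hC'⟩ := hq m hm
    refine ⟨max C C', fun φ hφ => ?_⟩
    have h3 := stepNorm_nonneg hM hη hm φ.toFun
    refine max_le ((hC φ hφ).trans ?_) ((hC' φ hφ).trans ?_)
    · gcongr; exact le_max_left _ _
    · gcongr; exact le_max_right _ _

theorem IsLimitSeminorm.bot : IsLimitSeminorm cls M η E ⊥ := by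
  cases cls with
  | beurling => exact ⟨1, one_pos, 0, fun φ => by simp⟩
  | roumieu => exact fun m _ => ⟨0, fun φ _ => by simp⟩

theorem IsLimitSeminorm.continuous {p : Seminorm ℂ (DSpace cls M η E)}
    (hp : IsLimitSeminorm cls M η E p) : Continuous p :=
  DSpace.withSeminorms.continuous_seminorm ⟨p, hp⟩

/-- The defining family is closed under finite suprema, multiples and passage to smaller seminorms,
so it already contains every continuous seminorm. -/
theorem isLimitSeminorm_of_continuous (hM : ∀ n, 0 < M n) (hη : ∀ x, 0 < η x)
    {p : Seminorm ℂ (DSpace cls M η E)} (hp : Continuous p) : IsLimitSeminorm cls M η E p := by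
  obtain ⟨s, C, -, h⟩ := Seminorm.bound_of_continuous DSpace.withSeminorms p hp
  refine IsLimitSeminorm.mono (IsLimitSeminorm.smul ?_ C) h
  exact Finset.sup_induction IsLimitSeminorm.bot (fun _ h1 _ h2 => h1.sup hM hη h2)
    fun i _ => i.2

/-- Limit seminorms are bounded on the sets `Ball η b`. -/
theorem IsLimitSeminorm.exists_le_of_mem_ball (hM : ∀ n, 0 < M n) (hη : ∀ x, 0 < η x)
    {p : Seminorm ℂ (Bdot cls M η)} (hp : IsLimitSeminorm cls M η (CW η) p) {b : ℕ → ℝ}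
    (hb : Dom cls M b) : ∃ C : ℝ, ∀ ψ : Bdot cls M η, ψ.toFun ∈ Ball η b → p ψ ≤ C := by
  cases cls with
  | beurling =>
    obtain ⟨m, hm, C, hC⟩ := hp
    obtain ⟨C', hC'⟩ := hb m hm
    refine ⟨|C| * C', fun ψ hψ => (hC ψ).trans ?_⟩
    have h1 : stepNorm M η m ψ.toFun ≤ C' := stepNorm_le hM hη hm fun n x =>
      (hψ.2 n x).trans (mul_le_mul_of_nonneg_right (hC' n) (hη x).le)
    exact mul_le_mul (le_abs_self C) h1 (stepNorm_nonneg hM hη hm _) (abs_nonneg _)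
  | roumieu =>
    obtain ⟨m, hm, C', hC'⟩ := hb
    obtain ⟨C, hC⟩ := hp m hm
    refine ⟨|C| * C', fun ψ hψ => ?_⟩
    have h0 : ∀ n x, ‖iteratedFDeriv ℝ n ψ.toFun x‖ ≤ C' * M n / m ^ n * η x := fun n x =>
      (hψ.2 n x).trans (mul_le_mul_of_nonneg_right (hC' n) (hη x).le)
    refine (hC ψ (mem_step_CW_of_vanish hη (mem_step_Linf hψ.1 h0)
      (vanish_of_mem_limit_CW hη ψ.2))).trans ?_
    exact mul_le_mul (le_abs_self C) (stepNorm_le hM hη hm h0) (stepNorm_nonneg hM hη hm _)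
      (abs_nonneg _)

theorem exists_pos_le_of_lt (a : ℕ → ℝ) (ha : ∀ n, 0 < a n) (N : ℕ) :
    ∃ δ > 0, ∀ n < N, δ ≤ a n := by
  induction N with
  | zero => exact ⟨1, one_pos, by simp⟩
  | succ N ih =>
    obtain ⟨δ, hδ, h⟩ := ih
    refine ⟨min δ (a N), lt_min hδ (ha N), fun n hn => ?_⟩
    rcases Nat.lt_succ_iff_lt_or_eq.1 hn with h1 | rfl
    · exact (min_le_left _ _).trans (h n h1)
    · exact min_le_right _ _

/-- A bound with parameter `2 * m` gains the factor `2 ^ (-n)` over one with parameter `m`. Large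
orders are thus automatically small and only finitely many need control. -/
theorem exists_forall_bound_le (hM : ∀ n, 0 < M n) (hη : ∀ x, 0 < η x) {b : ℕ → ℝ} {m C : ℝ}
    (hm : 0 < m) (hb : ∀ n, b n ≤ C * M n / (2 * m) ^ n) {ε : ℝ} (hε : 0 < ε) :
    ∃ N : ℕ, ∃ δ > 0, ∀ ψ ∈ Ball η b, (∀ n < N, ∀ x, ‖iteratedFDeriv ℝ n ψ x‖ ≤ δ * η x) →
      ∀ n x, ‖iteratedFDeriv ℝ n ψ x‖ ≤ ε * M n / m ^ n * η x := by
  obtain ⟨N, hN⟩ := exists_pow_lt_of_lt_one (show 0 < ε / (|C| + 1) by positivity)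
    (show (1 / 2 : ℝ) < 1 by norm_num)
  obtain ⟨δ, hδ, h⟩ := exists_pos_le_of_lt (fun n => ε * M n / m ^ n)
    (fun n => by have := hM n; positivity) N
  refine ⟨N, δ, hδ, fun ψ hψ hsmall n x => ?_⟩
  have h2 := (hη x).le
  by_cases hn : n < N
  · exact (hsmall n hn x).trans (by gcongr; exact h n hn)
  · refine (hψ.2 n x).trans ?_
    gcongr
    refine (hb n).trans ?_
    have h1 := (hM n).le
    have h3 : |C| * (1 / 2 : ℝ) ^ n ≤ ε := by
      rw [lt_div_iff₀ (by positivity)] at hN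
      have h4 : (1 / 2 : ℝ) ^ n ≤ (1 / 2 : ℝ) ^ N :=
        pow_le_pow_of_le_one (by norm_num) (by norm_num) (not_lt.1 hn)
      have h5 : 0 ≤ (1 / 2 : ℝ) ^ n := by positivity
      nlinarith [abs_nonneg C]
    calc C * M n / (2 * m) ^ n ≤ |C| * M n / (2 * m) ^ n := by gcongr; exact le_abs_self C
      _ = |C| * (1 / 2 : ℝ) ^ n * M n / m ^ n := by
        rw [mul_pow, div_pow, one_pow]
        field_simp
      _ ≤ _ := by gcongr

/-- A limit seminorm is small on those elements of `Ball η b` that have finitely many derivatives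
that are uniformly small. -/
theorem IsLimitSeminorm.exists_le_of_small (hM : ∀ n, 0 < M n) (hη : ∀ x, 0 < η x)
    {p : Seminorm ℂ (Bdot cls M η)} (hp : IsLimitSeminorm cls M η (CW η) p) {b : ℕ → ℝ}
    (hb : Dom cls M b) {ε : ℝ} (hε : 0 < ε) : ∃ N : ℕ, ∃ δ > 0, ∀ ψ : Bdot cls M η,
      ψ.toFun ∈ Ball η b → (∀ n < N, ∀ x, ‖iteratedFDeriv ℝ n ψ.toFun x‖ ≤ δ * η x) →
        p ψ ≤ ε := by
  have key : ∀ C s : ℝ, 0 ≤ s → s ≤ ε / (|C| + 1) → C * s ≤ ε := by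
    intro C s h0 h1
    rw [le_div_iff₀ (by positivity)] at h1
    nlinarith [le_abs_self C]
  cases cls with
  | beurling =>
    obtain ⟨m, hm, C, hC⟩ := hp
    obtain ⟨C', hC'⟩ := hb (2 * m) (by positivity)
    obtain ⟨N, δ, hδ, H⟩ := exists_forall_bound_le hM hη hm hC'
      (show 0 < ε / (|C| + 1) by positivity)
    exact ⟨N, δ, hδ, fun ψ hψ hs => (hC ψ).trans (key C _ (stepNorm_nonneg hM hη hm _)
      (stepNorm_le hM hη hm (H _ hψ hs)))⟩
  | roumieu =>
    obtain ⟨m, hm, C', hC'⟩ := hb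
    obtain ⟨C, hC⟩ := hp (m / 2) (by positivity)
    have hm2 : 0 < m / 2 := by positivity
    obtain ⟨N, δ, hδ, H⟩ := exists_forall_bound_le (η := η) hM hη hm2
      (by rwa [mul_div_cancel₀ m two_ne_zero] : ∀ n, b n ≤ C' * M n / (2 * (m / 2)) ^ n)
      (show 0 < ε / (|C| + 1) by positivity)
    exact ⟨N, δ, hδ, fun ψ hψ hs => (hC ψ (mem_step_CW_of_vanish hη
      (mem_step_Linf hψ.1 (H _ hψ hs)) (vanish_of_mem_limit_CW hη ψ.2))).trans
        (key C _ (stepNorm_nonneg hM hη hm2 _) (stepNorm_le hM hη hm2 (H _ hψ hs)))⟩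

theorem isVonNBounded_of_ball (hM : ∀ n, 0 < M n) (hη : ∀ x, 0 < η x) {b : ℕ → ℝ}
    (hb : Dom cls M b) {S : Set (Bdot cls M η)} (hS : ∀ ψ ∈ S, ψ.toFun ∈ Ball η b) :
    Bornology.IsVonNBounded ℂ S := by
  rw [DSpace.withSeminorms.isVonNBounded_iff_seminorm_bounded]
  rintro ⟨p, hp⟩
  obtain ⟨C, hC⟩ := hp.exists_le_of_mem_ball hM hη hb
  exact ⟨|C| + 1, by positivity, fun ψ hψ =>
    ((hC ψ (hS ψ hψ)).trans (le_abs_self C)).trans_lt (lt_add_one _)⟩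

theorem isLimitSeminorm_dual (hM : ∀ n, 0 < M n) (hη : ∀ x, 0 < η x) (f : DualL1 cls M η) :
    IsLimitSeminorm cls M η (CW η) ((normSeminorm ℂ ℂ).comp f.toLinearMap) :=
  isLimitSeminorm_of_continuous hM hη (f.continuous.norm)

end Seminorms

end Ultra
end

noncomputable section
namespace Ultra

variable {d : ℕ}

/-! ### Convergence of products with cut-off functions -/

section SmallProducts

variable {η : Rd d → ℝ}

theorem eventually_norm_iteratedFDeriv_mul_le {ι : Type*} {l : Filter ι} {a ψ : ι → Rd d → ℂ}
    (ha : ∀ i, ContDiff ℝ ∞ (a i)) (hψ : ∀ i, ContDiff ℝ ∞ (ψ i))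
    (h : ∀ j k, ∀ ε > 0, ∀ᶠ i in l, ∀ x,
      ‖iteratedFDeriv ℝ j (a i) x‖ * ‖iteratedFDeriv ℝ k (ψ i) x‖ ≤ ε * η x)
    (n : ℕ) {ε : ℝ} (hε : 0 < ε) :
    ∀ᶠ i in l, ∀ x, ‖iteratedFDeriv ℝ n (a i * ψ i) x‖ ≤ ε * η x := by
  have h1 : ∀ᶠ i in l, ∀ j ∈ Finset.range (n + 1), ∀ x,
      ‖iteratedFDeriv ℝ j (a i) x‖ * ‖iteratedFDeriv ℝ (n - j) (ψ i) x‖ ≤ ε / 2 ^ n * η x :=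
    (Filter.eventually_all_finset _).2 fun j _ => h j (n - j) _ (by positivity)
  filter_upwards [h1] with i hi x
  refine (norm_iteratedFDeriv_mul (ha i) (hψ i) n x).trans ?_
  calc ∑ j ∈ Finset.range (n + 1), (n.choose j : ℝ) * ‖iteratedFDeriv ℝ j (a i) x‖ *
        ‖iteratedFDeriv ℝ (n - j) (ψ i) x‖
      ≤ ∑ j ∈ Finset.range (n + 1), (n.choose j : ℝ) * (ε / 2 ^ n * η x) := by
        refine Finset.sum_le_sum fun j hj => ?_
        rw [mul_assoc]
        exact mul_le_mul_of_nonneg_left (hi j hj x) (Nat.cast_nonneg _)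
    _ = ε * η x := by
        rw [← Finset.sum_mul]
        have h4 : ∑ i ∈ Finset.range (n + 1), (n.choose i : ℝ) = 2 ^ n := by
          exact_mod_cast Nat.sum_range_choose n
        rw [h4]
        field_simp

theorem contDiff_cut_sub_one (N : ℕ) : ContDiff ℝ ∞ (cut d N - 1) :=
  (contDiff_cut N).sub contDiff_const

/-- The uniform bound serves near infinity, where the other factor is small; the bound with `2 ^
(-N)` serves on bounded sets. In order zero the latter is the Lipschitz estimate at the origin, and
in higher order the constant `1` drops out. -/
theorem exists_cut_sub_one_bound (d n : ℕ) : ∃ A : ℝ, 0 ≤ A ∧ ∀ N, ∀ x : Rd d,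
    ‖iteratedFDeriv ℝ n (cut d N - 1) x‖ ≤ A ∧
    ‖iteratedFDeriv ℝ n (cut d N - 1) x‖ ≤ (2⁻¹ : ℝ) ^ N * (A * (1 + ‖x‖)) := by
  obtain ⟨C, h, hC, hh, H⟩ := exists_cut_bound d
  have h1 : ∀ N, ((2⁻¹ : ℝ) ^ N) ^ n ≤ 1 := fun N =>
    pow_le_one₀ (by positivity) (pow_le_one₀ (by positivity) (by norm_num))
  rcases Nat.eq_zero_or_pos n with rfl | hn
  · obtain ⟨L, hL, H'⟩ := exists_cut_sub_one_le d
    refine ⟨C + 1 + L, by positivity, fun N x => ⟨?_, ?_⟩⟩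
    · rw [norm_iteratedFDeriv_zero]
      have h2 := H N 0 x
      simp only [pow_zero, one_mul, mul_one, norm_iteratedFDeriv_zero] at h2
      have h3 : ‖(cut d N - 1) x‖ ≤ ‖cut d N x‖ + ‖(1 : ℂ)‖ := norm_sub_le _ _
      rw [norm_one] at h3
      linarith
    · rw [norm_iteratedFDeriv_zero]
      refine (H' N x).trans ?_
      have h3 := norm_nonneg x
      rw [mul_left_comm]
      gcongr
      · linarith
      · linarith
  · have e : ∀ N x, iteratedFDeriv ℝ n (cut d N - 1) x = iteratedFDeriv ℝ n (cut d N) x := by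
      intro N x
      rw [iteratedFDeriv_sub_fun (ψ := 1) (contDiff_cut N) contDiff_const]
      have : iteratedFDeriv ℝ n (1 : Rd d → ℂ) = 0 := iteratedFDeriv_const_of_ne hn.ne' 1
      simp [this]
    refine ⟨C * h ^ n, by positivity, fun N x => ?_⟩
    rw [e]
    have h5 : 0 ≤ C * h ^ n := by positivity
    refine ⟨(H N n x).trans (mul_le_of_le_one_left h5 (h1 N)), (H N n x).trans ?_⟩
    have h3 := norm_nonneg x
    refine mul_le_mul ?_ ?_ h5 (by positivity)
    · exact pow_le_of_le_one (by positivity) (pow_le_one₀ (by positivity) (by norm_num)) hn.ne'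
    · exact le_mul_of_one_le_right h5 (by linarith)

/-- The products of a function that vanishes at infinity with the cut-off functions converge. -/
theorem eventually_cut_sub_one_mul_le (hη : ∀ x, 0 < η x) {b : ℕ → ℝ} {ψ : Rd d → ℂ}
    (hψ : ψ ∈ Ball η b) (h0 : ψ ∈ Vanish η) (n : ℕ) {ε : ℝ} (hε : 0 < ε) :
    ∀ᶠ N in atTop, ∀ x, ‖iteratedFDeriv ℝ n ((cut d N - 1) * ψ) x‖ ≤ ε * η x := by
  refine eventually_norm_iteratedFDeriv_mul_le (ψ := fun _ => ψ) contDiff_cut_sub_one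
    (fun _ => hψ.1) (fun j k ε hε => ?_) n hε
  obtain ⟨A, hA, H⟩ := exists_cut_sub_one_bound d j
  obtain ⟨R, hR⟩ := h0 k (ε / (A + 1)) (by positivity)
  have h1 : Tendsto (fun N : ℕ => (2⁻¹ : ℝ) ^ N * (A * (1 + |R|) * b k)) atTop (𝓝 0) := by
    simpa using (tendsto_pow_atTop_nhds_zero_of_lt_one (r := (2⁻¹ : ℝ)) (by norm_num)
      (by norm_num)).mul_const (A * (1 + |R|) * b k)
  filter_upwards [h1.eventually_lt_const hε] with N hN x
  have h2 := hη x
  have hb := nonneg_of_mem_ball hη hψ k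
  by_cases hx : R < ‖x‖
  · calc _ ≤ A * (ε / (A + 1) * η x) := by
          gcongr
          · exact (H N x).1
          · exact hR x hx
      _ = A / (A + 1) * (ε * η x) := by field_simp
      _ ≤ 1 * (ε * η x) := by
          gcongr
          rw [div_le_one (by positivity)]
          linarith
      _ = _ := one_mul _
  · have hx' : ‖x‖ ≤ |R| := (not_lt.1 hx).trans (le_abs_self R)
    calc _ ≤ (2⁻¹ : ℝ) ^ N * (A * (1 + ‖x‖)) * (b k * η x) := by
          gcongr
          · exact (H N x).2
          · exact hψ.2 k x
      _ ≤ (2⁻¹ : ℝ) ^ N * (A * (1 + |R|)) * (b k * η x) := by gcongr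
      _ = (2⁻¹ : ℝ) ^ N * (A * (1 + |R|) * b k) * η x := by ring
      _ ≤ _ := by gcongr

theorem tendsto_iteratedFDeriv_cut_mul {b : ℕ → ℝ} {φ : Rd d → ℂ} (hφ : φ ∈ Ball η b) (n : ℕ)
    (x : Rd d) :
    Tendsto (fun N => iteratedFDeriv ℝ n (cut d N * φ) x) atTop (𝓝 (iteratedFDeriv ℝ n φ x)) := by
  rw [tendsto_iff_norm_sub_tendsto_zero]
  choose A hA H using fun j => exists_cut_sub_one_bound d j
  have h1 : ∀ N, ‖iteratedFDeriv ℝ n (cut d N * φ) x - iteratedFDeriv ℝ n φ x‖ ≤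
      (2⁻¹ : ℝ) ^ N * ∑ j ∈ Finset.range (n + 1), (n.choose j : ℝ) * (A j * (1 + ‖x‖)) *
        ‖iteratedFDeriv ℝ (n - j) φ x‖ := by
    intro N
    rw [← iteratedFDeriv_sub_fun (φ := cut d N * φ) ((contDiff_cut N).mul hφ.1) hφ.1,
      show cut d N * φ - φ = (cut d N - 1) * φ by ring]
    refine (norm_iteratedFDeriv_mul (contDiff_cut_sub_one N) hφ.1 n x).trans ?_
    rw [Finset.mul_sum]
    refine Finset.sum_le_sum fun j _ => ?_
    calc _ ≤ (n.choose j : ℝ) * ((2⁻¹ : ℝ) ^ N * (A j * (1 + ‖x‖))) *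
          ‖iteratedFDeriv ℝ (n - j) φ x‖ := by
          gcongr
          exact (H j N x).2
      _ = _ := by ring
  refine squeeze_zero (fun _ => norm_nonneg _) h1 ?_
  simpa using (tendsto_pow_atTop_nhds_zero_of_lt_one (r := (2⁻¹ : ℝ)) (by norm_num)
      (by norm_num)).mul_const _

end SmallProducts

/-! ### The pairing of the dual with bounded ultradifferentiable functions -/

section Spaces

variable {cls : UltraClass} {M : ℕ → ℝ} {η : Rd d → ℝ}

/-- The element of `Ḃ^*_η` given by a function. -/
def Bdot.mk (φ : Rd d → ℂ) (h : φ ∈ limitSubmodule cls M η (CW η)) : Bdot cls M η :=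
  (⟨φ, h⟩ : limitSubmodule cls M η (CW η))

/-- The element of `D^*_{L^∞_η}` given by a function. -/
def DLinfC.mk (φ : Rd d → ℂ) (h : φ ∈ limitSubmodule cls M η (LinfW η)) : DLinfC cls M η :=
  (⟨φ, h⟩ : limitSubmodule cls M η (LinfW η))

@[simp] theorem Bdot.toFun_mk (φ : Rd d → ℂ) (h : φ ∈ limitSubmodule cls M η (CW η)) :
    (Bdot.mk φ h).toFun = φ := rfl

@[simp] theorem DSpace.toFun_add {E : Submodule ℂ (Rd d → ℂ)} (φ ψ : DSpace cls M η E) :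
    (φ + ψ).toFun = φ.toFun + ψ.toFun := rfl

@[simp] theorem DSpace.toFun_sub {E : Submodule ℂ (Rd d → ℂ)} (φ ψ : DSpace cls M η E) :
    (φ - ψ).toFun = φ.toFun - ψ.toFun := rfl

@[simp] theorem DSpace.toFun_smul {E : Submodule ℂ (Rd d → ℂ)} (c : ℂ) (φ : DSpace cls M η E) :
    (c • φ).toFun = c • φ.toFun := rfl

/-- The inclusion of `D_E^*` into the space of functions. -/
def DSpace.toFunLinear (E : Submodule ℂ (Rd d → ℂ)) : DSpace cls M η E →ₗ[ℂ] (Rd d → ℂ) where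
  toFun := DSpace.toFun
  map_add' := DSpace.toFun_add
  map_smul' := DSpace.toFun_smul

@[simp] theorem DSpace.toFun_sum {E : Submodule ℂ (Rd d → ℂ)} {ι : Type*} (F : Finset ι)
    (φ : ι → DSpace cls M η E) : (∑ k ∈ F, φ k).toFun = ∑ k ∈ F, (φ k).toFun :=
  map_sum (DSpace.toFunLinear E) φ F

theorem DSpace.ext_toFun {E : Submodule ℂ (Rd d → ℂ)} {φ ψ : DSpace cls M η E}
    (h : φ.toFun = ψ.toFun) : φ = ψ := Subtype.ext h

theorem DLinfC.ext_toFun {φ ψ : DLinfC cls M η} (h : φ.toFun = ψ.toFun) : φ = ψ := Subtype.ext h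

theorem toFun_incl_mk (φ : Rd d → ℂ) (h : φ ∈ limitSubmodule cls M η (CW η)) :
    (incl (Bdot.mk φ h)).toFun = φ := rfl

theorem Bdot.exists_eq_mk (ψ : Bdot cls M η) : ∃ φ h, ψ = Bdot.mk φ h := ⟨ψ.1, ψ.2, rfl⟩

@[simp] theorem toFun_incl (ψ : Bdot cls M η) : (incl ψ).toFun = ψ.toFun := by
  obtain ⟨φ, h, rfl⟩ := ψ.exists_eq_mk
  rw [toFun_incl_mk, Bdot.toFun_mk]

variable [hadm : Admissible M η]

theorem mpos (M : ℕ → ℝ) (η : Rd d → ℝ) [h : Admissible M η] (n : ℕ) : 0 < M n := h.mseq.pos n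

theorem DLinfC.exists_ball (φ : DLinfC cls M η) : ∃ b, Dom cls M b ∧ φ.toFun ∈ Ball η b :=
  exists_ball_of_mem_limit (mpos M η) hadm.pos φ.2

theorem DSpace.exists_ball {E : Submodule ℂ (Rd d → ℂ)} (φ : DSpace cls M η E) :
    ∃ b, Dom cls M b ∧ φ.toFun ∈ Ball η b :=
  exists_ball_of_mem_limit (mpos M η) hadm.pos φ.2

theorem Bdot.vanish (ψ : Bdot cls M η) : ψ.toFun ∈ Vanish η :=
  vanish_of_mem_limit_CW hadm.pos ψ.2

theorem cut_mul_mem (φ : DLinfC cls M η) (N : ℕ) :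
    cut d N * φ.toFun ∈ limitSubmodule cls M η (CW η) := by
  obtain ⟨b, hb, hφ⟩ := φ.exists_ball
  exact mem_limit_CW hadm.pos
    (mem_limit_of_ball hadm.pos (hb.cutBound hadm.mseq) (cut_mul_mem_ball hadm.pos hφ N))
    (vanish_of_decay hadm.pos (cut_mul_decay hadm.pos hφ N))

/-- Multiplication with a cut-off function, as a map from `D^*_{L^∞_η}` to `Ḃ^*_η`. -/
def cutMap (N : ℕ) : DLinfC cls M η →ₗ[ℂ] Bdot cls M η where
  toFun φ := Bdot.mk (cut d N * φ.toFun) (cut_mul_mem φ N)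
  map_add' _ _ := DSpace.ext_toFun (mul_add _ _ _)
  map_smul' _ _ := DSpace.ext_toFun (mul_smul_comm _ _ _)

@[simp] theorem toFun_cutMap (N : ℕ) (φ : DLinfC cls M η) :
    (cutMap N φ).toFun = cut d N * φ.toFun := rfl

theorem cutMap_mem_ball {b : ℕ → ℝ} {φ : DLinfC cls M η} (hφ : φ.toFun ∈ Ball η b) (N : ℕ) :
    (cutMap N φ).toFun ∈ Ball η (cutBound d b) :=
  cut_mul_mem_ball hadm.pos hφ N

theorem DualL1.exists_norm_le (f : DualL1 cls M η) {b : ℕ → ℝ} (hb : Dom cls M b) :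
    ∃ C : ℝ, ∀ ψ : Bdot cls M η, ψ.toFun ∈ Ball η b → ‖f ψ‖ ≤ C :=
  (isLimitSeminorm_dual (mpos M η) hadm.pos f).exists_le_of_mem_ball (mpos M η) hadm.pos hb

theorem toFun_cutMap_succ_sub (k : ℕ) (φ : DLinfC cls M η) :
    (cutMap (k + 1) φ - cutMap k φ).toFun = annulus d k * φ.toFun := by
  funext x
  simp [annulus, sub_mul]

/-- The values of a functional on the pieces of a function given by the partition of unity are
summable, uniformly on the sets `Ball η b`. -/
theorem DualL1.exists_summable (f : DualL1 cls M η) {b : ℕ → ℝ} (hb : Dom cls M b) :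
    ∃ s : ℕ → ℝ, Summable s ∧ ∀ φ : DLinfC cls M η, φ.toFun ∈ Ball η b →
      ∀ k, ‖f (cutMap (k + 1) φ - cutMap k φ)‖ ≤ s k := by
  obtain ⟨C, hC⟩ := f.exists_norm_le (hb.cutBound (d := d) hadm.mseq)
  let P : Type := {φ : DLinfC cls M η // φ.toFun ∈ Ball η b}
  rcases isEmpty_or_nonempty P with hP | hP
  · exact ⟨0, summable_zero, fun φ hφ => hP.elim ⟨φ, hφ⟩⟩
  -- Unimodular coefficients `c k` turn the sum of absolute values into the value of `f` at one
  -- element of a fixed ball, on which `f` is bounded.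
  have key : ∀ (F : Finset ℕ) (φ : ℕ → P),
      ∑ k ∈ F, ‖f (cutMap (k + 1) (φ k).1 - cutMap k (φ k).1)‖ ≤ C := by
    intro F φ
    choose c hc1 hc2 using fun k =>
      RCLike.exists_norm_eq_mul_self (f (cutMap (k + 1) (φ k).1 - cutMap k (φ k).1))
    let ψ : Bdot cls M η := ∑ k ∈ F, c k • (cutMap (k + 1) (φ k).1 - cutMap k (φ k).1)
    have h1 : ψ.toFun = ∑ k ∈ F, c k • (annulus d k * (φ k).1.toFun) := by
      simp only [ψ, DSpace.toFun_sum, DSpace.toFun_smul, toFun_cutMap_succ_sub]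
    have h2 : ψ.toFun ∈ Ball η (cutBound d b) := by
      rw [h1]
      exact sum_annulus_mul_mem_ball hadm.pos (φ := fun k => (φ k).1.toFun) (fun k => (hc1 k).le)
        fun k => (φ k).2
    have h3 : f ψ = ((∑ k ∈ F, ‖f (cutMap (k + 1) (φ k).1 - cutMap k (φ k).1)‖ : ℝ) : ℂ) := by
      simp only [ψ, map_sum, map_smul, smul_eq_mul, Complex.ofReal_sum]
      exact Finset.sum_congr rfl fun k _ => (hc2 k).symm
    have h4 := hC ψ h2
    rw [h3, Complex.norm_real, Real.norm_eq_abs] at h4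
    exact (le_abs_self _).trans h4
  have hbdd : ∀ k, BddAbove (Set.range fun φ : P =>
      ‖f (cutMap (k + 1) φ.1 - cutMap k φ.1)‖) := fun k => ⟨C, by
    rintro _ ⟨φ, rfl⟩
    simpa using key {k} fun _ => φ⟩
  let s : ℕ → ℝ := fun k => ⨆ φ : P, ‖f (cutMap (k + 1) φ.1 - cutMap k φ.1)‖
  -- Each supremum `s k` is attained up to a factor `2`, by a function that depends on `k`; hence
  -- the bound `2 * C` for the sums.
  have hs : ∀ k, ∃ φ : P, s k / 2 ≤ ‖f (cutMap (k + 1) φ.1 - cutMap k φ.1)‖ := by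
    intro k
    by_cases h0 : s k ≤ 0
    · exact ⟨hP.some, le_trans (by linarith) (norm_nonneg _)⟩
    · obtain ⟨φ, hφ⟩ := exists_lt_of_lt_ciSup (show s k / 2 < s k by linarith)
      exact ⟨φ, hφ.le⟩
  choose φ hφ using hs
  refine ⟨s, summable_of_sum_le (c := 2 * C) (fun k => Real.iSup_nonneg fun _ => norm_nonneg _)
    fun F => ?_, fun ψ hψ k => le_ciSup (hbdd k) ⟨ψ, hψ⟩⟩
  have h1 := Finset.sum_le_sum fun k (_ : k ∈ F) => hφ k
  have h2 := key F φ
  rw [← Finset.sum_div] at h1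
  linarith

/-- The pairing of `D'^*_{L^1_η}` with `D^*_{L^∞_η}`. -/
def pairing (f : DualL1 cls M η) (φ : DLinfC cls M η) : ℂ :=
  limUnder atTop fun N => f (cutMap N φ)

/-- The error is a tail of the series from `DualL1.exists_summable`. That it is uniform on balls
makes the pairing continuous on jets later on. -/
theorem exists_pairing_bound (f : DualL1 cls M η) {b : ℕ → ℝ} (hb : Dom cls M b) :
    ∃ s : ℕ → ℝ, Tendsto s atTop (𝓝 0) ∧ ∀ φ : DLinfC cls M η, φ.toFun ∈ Ball η b →
      ∀ N, ‖f (cutMap N φ) - pairing f φ‖ ≤ s N := by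
  obtain ⟨s, hs, H⟩ := f.exists_summable hb
  refine ⟨fun N => ∑' k, s (N + k), ?_, fun φ hφ N => ?_⟩
  · simpa only [add_comm] using tendsto_sum_nat_add s
  · have h1 : ∀ n, dist (f (cutMap n φ)) (f (cutMap n.succ φ)) ≤ s n := fun n => by
      rw [dist_comm, dist_eq_norm, ← map_sub]
      exact H φ hφ n
    have h2 := (cauchySeq_of_dist_le_of_summable s h1 hs).tendsto_limUnder
    rw [← dist_eq_norm]
    exact dist_le_tsum_of_dist_le_of_tendsto s h1 hs h2 N

theorem tendsto_pairing (f : DualL1 cls M η) (φ : DLinfC cls M η) :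
    Tendsto (fun N => f (cutMap N φ)) atTop (𝓝 (pairing f φ)) := by
  obtain ⟨b, hb, hφ⟩ := φ.exists_ball
  obtain ⟨s, hs, H⟩ := exists_pairing_bound f hb
  rw [tendsto_iff_norm_sub_tendsto_zero]
  exact squeeze_zero (fun _ => norm_nonneg _) (H φ hφ) hs

theorem pairing_eq {f : DualL1 cls M η} {φ : DLinfC cls M η} {z : ℂ}
    (h : Tendsto (fun N => f (cutMap N φ)) atTop (𝓝 z)) : pairing f φ = z :=
  tendsto_nhds_unique (tendsto_pairing f φ) h

theorem norm_pairing_le {f : DualL1 cls M η} {φ : DLinfC cls M η} {c : ℝ}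
    (h : ∀ N, ‖f (cutMap N φ)‖ ≤ c) : ‖pairing f φ‖ ≤ c :=
  le_of_tendsto (tendsto_pairing f φ).norm (Eventually.of_forall h)

theorem pairing_add_right (f : DualL1 cls M η) (φ ψ : DLinfC cls M η) :
    pairing f (φ + ψ) = pairing f φ + pairing f ψ :=
  pairing_eq (by simpa using (tendsto_pairing f φ).add (tendsto_pairing f ψ))

theorem pairing_smul_right (f : DualL1 cls M η) (c : ℂ) (φ : DLinfC cls M η) :
    pairing f (c • φ) = c * pairing f φ :=
  pairing_eq (by simpa using (tendsto_pairing f φ).const_mul c)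

theorem pairing_add_left (f g : DualL1 cls M η) (φ : DLinfC cls M η) :
    pairing (f + g) φ = pairing f φ + pairing g φ :=
  pairing_eq (by simpa using (tendsto_pairing f φ).add (tendsto_pairing g φ))

theorem pairing_smul_left (c : ℂ) (f : DualL1 cls M η) (φ : DLinfC cls M η) :
    pairing (c • f) φ = c * pairing f φ :=
  pairing_eq (by simpa using (tendsto_pairing f φ).const_mul c)

theorem DualL1.exists_norm_le_of_small (f : DualL1 cls M η) {b : ℕ → ℝ} (hb : Dom cls M b)
    {ε : ℝ} (hε : 0 < ε) : ∃ N : ℕ, ∃ δ > 0, ∀ ψ : Bdot cls M η,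
      ψ.toFun ∈ Ball η b → (∀ n < N, ∀ x, ‖iteratedFDeriv ℝ n ψ.toFun x‖ ≤ δ * η x) →
        ‖f ψ‖ ≤ ε :=
  (isLimitSeminorm_dual (mpos M η) hadm.pos f).exists_le_of_small (mpos M η) hadm.pos hb hε

theorem toFun_cutMap_incl_sub (N : ℕ) (ψ : Bdot cls M η) :
    (cutMap N (incl ψ) - ψ).toFun = (cut d N - 1) * ψ.toFun := by
  rw [DSpace.toFun_sub, toFun_cutMap, toFun_incl, sub_mul, one_mul]

/-- All differences `χ_N ψ - ψ` lie in one ball. As `ψ` vanishes at infinity, any finitely many of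
their derivatives become uniformly small, and this suffices for `f`. -/
theorem tendsto_cutMap_incl (f : DualL1 cls M η) (ψ : Bdot cls M η) :
    Tendsto (fun N => f (cutMap N (incl ψ))) atTop (𝓝 (f ψ)) := by
  obtain ⟨b, hb, hψ⟩ := ψ.exists_ball
  rw [tendsto_iff_norm_sub_tendsto_zero, Metric.tendsto_nhds]
  intro ε hε
  obtain ⟨N, δ, hδ, H⟩ := f.exists_norm_le_of_small
    ((hb.cutBound (d := d) hadm.mseq).add (mpos M η) hb) (half_pos hε)
  have h1 : ∀ᶠ k in atTop, ∀ n ∈ Finset.range N, ∀ x,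
      ‖iteratedFDeriv ℝ n ((cut d k - 1) * ψ.toFun) x‖ ≤ δ * η x :=
    (Filter.eventually_all_finset _).2 fun n _ =>
      eventually_cut_sub_one_mul_le hadm.pos hψ ψ.vanish n hδ
  filter_upwards [h1] with k hk
  have h2 : (cutMap k (incl ψ) - ψ).toFun ∈ Ball η (cutBound d b + b) :=
    sub_mem_ball (cutMap_mem_ball (φ := incl ψ) (by rwa [toFun_incl]) k) hψ
  have h3 : ‖f (cutMap k (incl ψ)) - f ψ‖ ≤ ε / 2 := by
    rw [← map_sub]
    refine H _ h2 fun n hn x => ?_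
    rw [toFun_cutMap_incl_sub]
    exact hk n (Finset.mem_range.2 hn) x
  rw [dist_zero_right, norm_norm]
  linarith

theorem pairing_incl (f : DualL1 cls M η) (ψ : Bdot cls M η) : pairing f (incl ψ) = f ψ :=
  pairing_eq (tendsto_cutMap_incl f ψ)

/-- It evaluates the pairing with functionals known only on `Ḃ^*_η`: delta functions and multiples
of their derivatives. -/
theorem pairing_of_mderiv {f : DualL1 cls M η} {a : ℂ} {α : Fin d → ℕ} {x : Rd d}
    (hf : ∀ ψ : Bdot cls M η, f ψ = a * mderiv α ψ.toFun x) (φ : DLinfC cls M η) :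
    pairing f φ = a * mderiv α φ.toFun x := by
  obtain ⟨b, hb, hφ⟩ := φ.exists_ball
  refine pairing_eq ?_
  simp only [hf, toFun_cutMap, mderiv]
  exact (((ContinuousMultilinearMap.apply ℝ (fun _ => Rd d) ℂ _).continuous.tendsto _).comp
    (tendsto_iteratedFDeriv_cut_mul hφ _ x)).const_mul a

/-- A linear functional on `Ḃ^*_η` with absolute value dominated by a continuous seminorm. -/
def dualOfLe (f : Bdot cls M η →ₗ[ℂ] ℂ) (p : Seminorm ℂ (Bdot cls M η))
    (hp : IsLimitSeminorm cls M η (CW η) p) (h : ∀ ψ, ‖f ψ‖ ≤ p ψ) : DualL1 cls M η where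
  toLinearMap := f
  cont := by
    refine continuous_of_continuousAt_zero f ?_
    rw [ContinuousAt, map_zero, tendsto_zero_iff_norm_tendsto_zero]
    refine squeeze_zero (fun _ => norm_nonneg _) h ?_
    simpa using hp.continuous.tendsto 0

end Spaces

end Ultra
end

/-! ### Functionals dominated by compact convex circled sets -/

noncomputable section
namespace Ultra

/-- A linear functional that is dominated by the absolute values of a compact convex circled set
of functionals belongs to this set. -/
theorem exists_eq_of_forall_norm_le {V K : Type*} [AddCommGroup V] [Module ℂ V]
    [TopologicalSpace K] [CompactSpace K] (J : K → V →ₗ[ℂ] ℂ)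
    (hJ : ∀ v, Continuous fun k => J k v)
    (hconv : ∀ (k k' : K) (a b : ℝ), 0 ≤ a → 0 ≤ b → a + b = 1 →
      ∃ k'', ∀ v, J k'' v = a * J k v + b * J k' v)
    (hbal : ∀ (k : K) (c : ℂ), ‖c‖ ≤ 1 → ∃ k', ∀ v, J k' v = c * J k v)
    (T : V →ₗ[ℂ] ℂ) (hT : ∀ (v : V) (c : ℝ), (∀ k, ‖J k v‖ ≤ c) → ‖T v‖ ≤ c) :
    ∃ k, ∀ v, J k v = T v := by
  classical
  by_contra hcon
  push Not at hcon
  -- If no `k` represents `T`, then by compactness finitely many vectors already show this, which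
  -- reduces the claim to the finite-dimensional space `F → ℂ`.
  obtain ⟨F, hF⟩ := isCompact_univ.elim_finite_subfamily_closed
    (fun v : V => {k | J k v = T v}) (fun v => isClosed_eq (hJ v) continuous_const) (by
      rw [Set.univ_inter, Set.eq_empty_iff_forall_notMem]
      intro k hk
      obtain ⟨v, hv⟩ := hcon k
      exact hv (Set.mem_iInter.1 hk v))
  let r : K → (F → ℂ) := fun k v => J k v
  have hr : Continuous r := continuous_pi fun v => hJ v
  have hS : IsCompact (Set.range r) := isCompact_range hr
  have hSc : Convex ℝ (Set.range r) := by
    rintro _ ⟨k, rfl⟩ _ ⟨k', rfl⟩ a b ha hb hab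
    obtain ⟨k'', h⟩ := hconv k k' a b ha hb hab
    refine ⟨k'', funext fun v => ?_⟩
    simp [r, h v]
  have hT' : (fun v : F => T v) ∉ Set.range r := by
    rintro ⟨k, hk⟩
    have : k ∈ Set.univ ∩ ⋂ v ∈ F, {k | J k v = T v} :=
      ⟨trivial, Set.mem_iInter₂.2 fun v hv => congrFun hk ⟨v, hv⟩⟩
    rw [hF] at this
    exact this
  obtain ⟨f, u, h1, h2⟩ := RCLike.geometric_hahn_banach_closed_point (𝕜 := ℂ) hSc hS.isClosed hT'
  -- The separating functional on `F → ℂ` is evaluation at a combination `v₀` of the vectors in `F`.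
  let v₀ : V := ∑ v : F, f (Pi.single v 1) • (v : V)
  have hv₀ : ∀ L : V →ₗ[ℂ] ℂ, L v₀ = f (fun v : F => L v) := by
    intro L
    have e := LinearMap.pi_apply_eq_sum_univ f.toLinearMap (fun v : F => L v)
    simp only [ContinuousLinearMap.coe_coe, smul_eq_mul] at e
    rw [e]
    simp only [v₀, map_sum, map_smul, smul_eq_mul]
    refine Finset.sum_congr rfl fun v _ => ?_
    rw [mul_comm]
    congr 2
    funext w
    simp [Pi.single_apply, eq_comm]
  -- Circledness turns the bound on real parts into one on absolute values.
  have h3 : ∀ k, ‖J k v₀‖ ≤ u := by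
    intro k
    obtain ⟨c, hc, hc'⟩ := RCLike.exists_norm_eq_mul_self (J k v₀)
    obtain ⟨k', hk'⟩ := hbal k c hc.le
    have h4 := h1 _ ⟨k', rfl⟩
    have h5 : f (r k') = ((‖J k v₀‖ : ℝ) : ℂ) := by
      rw [← hv₀ (J k'), hk' v₀]
      exact hc'.symm
    rw [h5] at h4
    simpa using h4.le
  have h6 := hT v₀ u h3
  rw [hv₀ T] at h6
  exact absurd (h2.trans_le ((RCLike.re_le_norm _).trans h6)) (lt_irrefl _)

variable {d : ℕ}

/-! ### Compactness of the sets of jets -/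

section Jets

instance (n : ℕ) : FiniteDimensional ℝ (ContinuousMultilinearMap ℝ (fun _ : Fin n => Rd d) ℂ) :=
  FiniteDimensional.of_injective
    (ContinuousMultilinearMap.toMultilinearMapLinear :
      ContinuousMultilinearMap ℝ (fun _ : Fin n => Rd d) ℂ →ₗ[ℝ] _)
    ContinuousMultilinearMap.toMultilinearMap_injective

instance (n : ℕ) : ProperSpace (ContinuousMultilinearMap ℝ (fun _ : Fin n => Rd d) ℂ) :=
  FiniteDimensional.proper ℝ _

/-- The maximum of the weight on the unit ball around a point. -/
def localMax (η : Rd d → ℝ) (x : Rd d) : ℝ := sSup (η '' Metric.closedBall x 1)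

theorem le_localMax {η : Rd d → ℝ} (hη : Continuous η) {x y : Rd d} (h : ‖y - x‖ ≤ 1) :
    η y ≤ localMax η x :=
  le_csSup ((isCompact_closedBall x 1).bddAbove_image hη.continuousOn)
    ⟨y, by rwa [Metric.mem_closedBall, dist_eq_norm], rfl⟩

/-- The jets of the functions in `Ball η b`. -/
def Jet (η : Rd d → ℝ) (b : ℕ → ℝ) :
    Set (∀ n : ℕ, Rd d → ContinuousMultilinearMap ℝ (fun _ : Fin n => Rd d) ℂ) :=
  {g | (∀ n x, ‖g n x‖ ≤ b n * η x) ∧ ∀ n x h, ‖h‖ ≤ 1 →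
    ‖g n (x + h) - g n x - (g (n + 1) x).curryLeft h‖ ≤ b (n + 2) * localMax η x * ‖h‖ ^ 2}

variable {η : Rd d → ℝ} {b : ℕ → ℝ}

theorem continuous_jet_apply (n : ℕ) (x : Rd d) : Continuous fun g : ∀ n : ℕ, Rd d →
    ContinuousMultilinearMap ℝ (fun _ : Fin n => Rd d) ℂ => g n x :=
  (continuous_apply x).comp (continuous_apply n)

/-- By Tychonoff's theorem the size bounds cut out a compact product of closed balls. The quadratic
remainder estimate in `Jet` is, for fixed `n`, `x`, `h`, a condition closed under pointwise
convergence, which differentiability alone is not. -/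
theorem isCompact_jet : IsCompact (Jet η b) := by
  have h1 : IsCompact (Set.pi Set.univ fun n : ℕ => Set.pi Set.univ fun x : Rd d =>
      Metric.closedBall (0 : ContinuousMultilinearMap ℝ (fun _ : Fin n => Rd d) ℂ) (b n * η x)) :=
    isCompact_univ_pi fun n => isCompact_univ_pi fun x => isCompact_closedBall _ _
  refine h1.of_isClosed_subset ?_ fun g hg n _ x _ => by simpa using hg.1 n x
  have hc := continuous_jet_apply (d := d)
  have hl : ∀ n x h, Continuous fun g : ∀ n : ℕ, Rd d →
      ContinuousMultilinearMap ℝ (fun _ : Fin n => Rd d) ℂ => (g (n + 1) x).curryLeft h :=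
    fun n x h => ((continuousMultilinearCurryLeftEquiv ℝ
      (fun _ : Fin (n + 1) => Rd d) ℂ).continuous.comp (hc (n + 1) x)).clm_apply continuous_const
  simp only [Jet, Set.ofPred_and, Set.ofPred_forall]
  refine IsClosed.inter ?_ ?_
  · exact isClosed_iInter fun n => isClosed_iInter fun x =>
      isClosed_le (hc n x).norm continuous_const
  · exact isClosed_iInter fun n => isClosed_iInter fun x => isClosed_iInter fun h =>
      isClosed_iInter fun _ => isClosed_le
        (((hc n (x + h)).sub (hc n x)).sub (hl n x h)).norm continuous_const

/-- The function with a given jet. -/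
def jetFun (g : ∀ n : ℕ, Rd d → ContinuousMultilinearMap ℝ (fun _ : Fin n => Rd d) ℂ)
    (x : Rd d) : ℂ := (g 0 x).curry0

/-- The constant does not depend on `g`. This equicontinuity upgrades pointwise convergence of jets
to uniform convergence on compact sets. -/
theorem jet_lipschitz {g} (hg : g ∈ Jet η b) (n : ℕ) {x y : Rd d} (h : ‖y - x‖ ≤ 1)
    (hL : 0 ≤ b (n + 2) * localMax η x) :
    ‖g n y - g n x‖ ≤ (b (n + 1) * η x + b (n + 2) * localMax η x) * ‖y - x‖ := by
  have h1 := hg.2 n x (y - x) h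
  rw [add_sub_cancel] at h1
  have h2 : ‖(g (n + 1) x).curryLeft (y - x)‖ ≤ b (n + 1) * η x * ‖y - x‖ := by
    refine (ContinuousLinearMap.le_opNorm _ _).trans ?_
    rw [ContinuousMultilinearMap.curryLeft_norm]
    gcongr
    exact hg.1 _ _
  have h3 : ‖g n y - g n x‖ ≤ ‖g n y - g n x - (g (n + 1) x).curryLeft (y - x)‖ +
      ‖(g (n + 1) x).curryLeft (y - x)‖ := by
    simpa using norm_add_le (g n y - g n x - (g (n + 1) x).curryLeft (y - x))
      ((g (n + 1) x).curryLeft (y - x))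
  have h4 : ‖y - x‖ ^ 2 ≤ ‖y - x‖ := by
    rw [sq]
    exact mul_le_of_le_one_left (norm_nonneg _) h
  have h5 := mul_le_mul_of_nonneg_left h4 hL
  rw [add_mul]
  linarith

/-- The quadratic remainder forces `g (n + 1)` to be the derivative of `g n`, so every element of
`Jet η b` is the jet of a smooth function. -/
theorem hasFTaylorSeriesUpTo_jet {g} (hg : g ∈ Jet η b) :
    HasFTaylorSeriesUpTo ∞ (jetFun g) fun x n => g n x := by
  have hd : ∀ (n : ℕ) (x : Rd d), HasFDerivAt (g n) (g (n + 1) x).curryLeft x := by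
    intro n x
    rw [hasFDerivAt_iff_isLittleO_nhds_zero]
    refine Asymptotics.IsBigO.trans_isLittleO (g := fun h : Rd d => ‖h‖ ^ 2) ?_ ?_
    · refine Asymptotics.IsBigO.of_bound (b (n + 2) * localMax η x) ?_
      filter_upwards [Metric.closedBall_mem_nhds (0 : Rd d) one_pos] with h hh
      simpa using hg.2 n x h (by simpa using hh)
    · simpa using (Asymptotics.isLittleO_norm_pow_id (E' := Rd d) one_lt_two)
  exact ⟨fun x => rfl, fun m _ x => hd m x, fun m _ =>
    continuous_iff_continuousAt.2 fun x => (hd m x).continuousAt⟩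

theorem iteratedFDeriv_jetFun {g} (hg : g ∈ Jet η b) (n : ℕ) (x : Rd d) :
    iteratedFDeriv ℝ n (jetFun g) x = g n x :=
  ((hasFTaylorSeriesUpTo_jet hg).eq_iteratedFDeriv (by exact_mod_cast le_top) x).symm

theorem jetFun_mem_ball {g} (hg : g ∈ Jet η b) : jetFun g ∈ Ball η b :=
  ⟨(hasFTaylorSeriesUpTo_jet hg).contDiff, fun n x => by
    rw [iteratedFDeriv_jetFun hg]
    exact hg.1 n x⟩

/-- The mean value inequality is used twice: the bound of order `n + 2` makes the derivative of
order `n + 1` Lipschitz near `x`, which bounds the Taylor remainder of order `n`. -/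
theorem iteratedFDeriv_mem_jet (hc : Continuous η) (hη : ∀ x, 0 < η x) {φ : Rd d → ℂ}
    (hφ : φ ∈ Ball η b) : (fun n x => iteratedFDeriv ℝ n φ x) ∈ Jet η b := by
  refine ⟨hφ.2, fun n x h hh => ?_⟩
  have hb := nonneg_of_mem_ball hη hφ
  have hT : HasFTaylorSeriesUpTo ∞ φ (ftaylorSeries ℝ φ) := hφ.1.ftaylorSeries
  have hfd : ∀ (m : ℕ) (y : Rd d), HasFDerivAt (iteratedFDeriv ℝ m φ)
      (iteratedFDeriv ℝ (m + 1) φ y).curryLeft y := fun m y =>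
    hT.fderiv m (by exact_mod_cast WithTop.coe_lt_top _) y
  have hball : ∀ y ∈ Metric.closedBall x ‖h‖, ‖y - x‖ ≤ ‖h‖ := fun y hy => by
    rwa [Metric.mem_closedBall, dist_eq_norm] at hy
  have hlip : ∀ y ∈ Metric.closedBall x ‖h‖, ‖(iteratedFDeriv ℝ (n + 1) φ y).curryLeft -
      (iteratedFDeriv ℝ (n + 1) φ x).curryLeft‖ ≤ b (n + 2) * localMax η x * ‖h‖ := by
    intro y hy
    have e : (iteratedFDeriv ℝ (n + 1) φ y).curryLeft - (iteratedFDeriv ℝ (n + 1) φ x).curryLeft =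
        (iteratedFDeriv ℝ (n + 1) φ y - iteratedFDeriv ℝ (n + 1) φ x).curryLeft := rfl
    rw [e, ContinuousMultilinearMap.curryLeft_norm]
    have h1 := (convex_closedBall x ‖h‖).norm_image_sub_le_of_norm_hasFDerivWithin_le
      (f := iteratedFDeriv ℝ (n + 1) φ) (C := b (n + 2) * localMax η x)
      (fun z _ => (hfd (n + 1) z).hasFDerivWithinAt) (fun z hz => by
        rw [ContinuousMultilinearMap.curryLeft_norm]
        refine (hφ.2 (n + 2) z).trans (mul_le_mul_of_nonneg_left ?_ (hb _))
        exact le_localMax hc ((hball z hz).trans hh))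
      (Metric.mem_closedBall_self (norm_nonneg _)) hy
    refine h1.trans (mul_le_mul_of_nonneg_left (hball y hy) (mul_nonneg (hb _) ?_))
    exact (hη x).le.trans (le_localMax hc (by simp))
  have h2 := (convex_closedBall x ‖h‖).norm_image_sub_le_of_norm_hasFDerivWithin_le'
    (f := iteratedFDeriv ℝ n φ) (φ := (iteratedFDeriv ℝ (n + 1) φ x).curryLeft)
    (fun z _ => (hfd n z).hasFDerivWithinAt) hlip
    (Metric.mem_closedBall_self (norm_nonneg _)) (y := x + h) (by simp)
  rw [add_sub_cancel_left] at h2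
  exact h2.trans (le_of_eq (by ring))

theorem jetFun_iteratedFDeriv (φ : Rd d → ℂ) : jetFun (fun n x => iteratedFDeriv ℝ n φ x) = φ := by
  funext x
  simp [jetFun, ContinuousMultilinearMap.curry0]

end Jets

/-! ### Weak compactness of balls -/

section Pairing

variable {cls : UltraClass} {M : ℕ → ℝ} {η : Rd d → ℝ} {b : ℕ → ℝ} [hadm : Admissible M η]

/-- The products of a cut-off function with the differences of functions in `Ball η b` depend
continuously on their jets. -/
theorem eventually_cut_mul_jet_sub_le (N : ℕ) (g₀ : Jet η b) (hb : ∀ n, 0 ≤ b n) (n : ℕ) {ε : ℝ}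
    (hc : Continuous η) (hη : ∀ x, 0 < η x) (hε : 0 < ε) : ∀ᶠ g : Jet η b in 𝓝 g₀, ∀ x,
      ‖iteratedFDeriv ℝ n (cut d N * (jetFun g.1 - jetFun g₀.1)) x‖ ≤ ε * η x := by
  have hm : ∀ g : Jet η b, jetFun g.1 ∈ Ball η b := fun g => jetFun_mem_ball g.2
  refine eventually_norm_iteratedFDeriv_mul_le (a := fun _ => cut d N)
    (ψ := fun g : Jet η b => jetFun g.1 - jetFun g₀.1) (fun _ => contDiff_cut N)
    (fun g => (hm g).1.sub (hm g₀).1) (fun j k ε hε => ?_) n hε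
  have e : ∀ (g : Jet η b) x, iteratedFDeriv ℝ k (jetFun g.1 - jetFun g₀.1) x =
      g.1 k x - g₀.1 k x := fun g x => by
    rw [iteratedFDeriv_sub_fun (hm g).1 (hm g₀).1, iteratedFDeriv_jetFun g.2,
      iteratedFDeriv_jetFun g₀.2]
  simp only [e]
  obtain ⟨K, hK, HK⟩ := cut_decay (d := d) N j
  obtain ⟨A, hA, HA⟩ : ∃ A : ℝ, 0 < A ∧ ∀ x : Rd d, ‖iteratedFDeriv ℝ j (cut d N) x‖ ≤ A := by
    obtain ⟨C, h, hC, hh, H, -⟩ := exists_annulus_bound d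
    exact ⟨C * h ^ j + 1, by positivity, fun x => (H N j x).trans (by linarith)⟩
  -- Beyond the radius `R` the decay of the cut-off outweighs the trivial bound `2 * b k * η x`;
  -- inside, compactness is used.
  let R : ℝ := K * (2 * b k) / ε
  have hin : ∀ᶠ g : Jet η b in 𝓝 g₀, ∀ x ∈ Metric.closedBall (0 : Rd d) R,
      A * ‖g.1 k x - g₀.1 k x‖ ≤ ε * η x := by
    -- It suffices to have the estimate for `(g, x)` near each `(g₀, x₀)`: pointwise convergence
    -- handles the value at `x₀`, the common Lipschitz bound the passage to `x`.
    refine (isCompact_closedBall _ _).eventually_forall_of_forall_eventually fun x₀ _ => ?_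
    let L : ℝ := b (k + 1) * η x₀ + b (k + 2) * localMax η x₀
    have hloc : 0 ≤ b (k + 2) * localMax η x₀ :=
      mul_nonneg (hb _) ((hη x₀).le.trans (le_localMax hc (by simp)))
    have hcont : Continuous fun g : Jet η b => g.1 k x₀ :=
      (continuous_jet_apply k x₀).comp continuous_subtype_val
    have h1 : Continuous fun z : Jet η b × Rd d =>
        A * (‖z.1.1 k x₀ - g₀.1 k x₀‖ + 2 * (L * ‖z.2 - x₀‖)) :=
      continuous_const.mul ((((hcont.comp continuous_fst).sub continuous_const).norm).add
        (continuous_const.mul (continuous_const.mul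
          ((continuous_snd.sub continuous_const).norm))))
    have h2 : Continuous fun z : Jet η b × Rd d => ε * η z.2 :=
      continuous_const.mul (hc.comp continuous_snd)
    have h3 : ∀ᶠ z : Jet η b × Rd d in 𝓝 (g₀, x₀),
        A * (‖z.1.1 k x₀ - g₀.1 k x₀‖ + 2 * (L * ‖z.2 - x₀‖)) < ε * η z.2 := by
      refine (h1.tendsto (g₀, x₀)).eventually_lt (h2.tendsto (g₀, x₀)) ?_
      have := hη x₀
      simp only [sub_self, norm_zero, mul_zero, add_zero]
      positivity
    have h4 : ∀ᶠ z : Jet η b × Rd d in 𝓝 (g₀, x₀), ‖z.2 - x₀‖ < 1 := by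
      refine ((continuous_snd.sub continuous_const).norm.tendsto (g₀, x₀)).eventually_lt_const ?_
      simp
    filter_upwards [h3, h4] with z hz hz'
    refine le_trans (mul_le_mul_of_nonneg_left ?_ hA.le) hz.le
    have h5 := jet_lipschitz z.1.2 k hz'.le hloc
    have h6 := jet_lipschitz g₀.2 k hz'.le hloc
    calc ‖z.1.1 k z.2 - g₀.1 k z.2‖
        = ‖(z.1.1 k x₀ - g₀.1 k x₀) + ((z.1.1 k z.2 - z.1.1 k x₀) -
            (g₀.1 k z.2 - g₀.1 k x₀))‖ := by congr 1; abel
      _ ≤ ‖z.1.1 k x₀ - g₀.1 k x₀‖ + (‖z.1.1 k z.2 - z.1.1 k x₀‖ +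
            ‖g₀.1 k z.2 - g₀.1 k x₀‖) :=
          (norm_add_le _ _).trans (add_le_add le_rfl (norm_sub_le _ _))
      _ ≤ _ := by
          simp only [L]
          linarith
  filter_upwards [hin] with g hg x
  by_cases hx : x ∈ Metric.closedBall (0 : Rd d) R
  · exact (mul_le_mul_of_nonneg_right (HA x) (norm_nonneg _)).trans (hg x hx)
  · have hx : R < ‖x‖ := by simpa using hx
    have hbk := hb k
    have hR : 0 ≤ R := by positivity
    have hx0 : 0 < ‖x‖ := hR.trans_lt hx
    have hηx := hη x
    simp only [R] at hx
    rw [div_lt_iff₀ hε] at hx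
    have h7 : ‖g.1 k x - g₀.1 k x‖ ≤ 2 * b k * η x := by
      refine (norm_sub_le _ _).trans ?_
      have := g.2.1 k x
      have := g₀.2.1 k x
      linarith
    refine le_of_mul_le_mul_left ?_ hx0
    calc ‖x‖ * (‖iteratedFDeriv ℝ j (cut d N) x‖ * ‖g.1 k x - g₀.1 k x‖)
        = (‖x‖ * ‖iteratedFDeriv ℝ j (cut d N) x‖) * ‖g.1 k x - g₀.1 k x‖ := by ring
      _ ≤ K * (2 * b k * η x) := by gcongr; exact HK x
      _ = K * (2 * b k) * η x := by ring
      _ ≤ ‖x‖ * ε * η x := by gcongr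
      _ = _ := by ring

/-- The element of `D^*_{L^∞_η}` with a given jet. -/
def ofJet (hb : Dom cls M b) (g : Jet η b) : DLinfC cls M η :=
  DLinfC.mk (jetFun g.1) (mem_limit_of_ball hadm.pos hb (jetFun_mem_ball g.2))

theorem ofJet_mem_ball (hb : Dom cls M b) (g : Jet η b) : (ofJet hb g).toFun ∈ Ball η b :=
  jetFun_mem_ball g.2

theorem exists_ofJet_eq (hb : Dom cls M b) {φ : DLinfC cls M η} (hφ : φ.toFun ∈ Ball η b) :
    ∃ g : Jet η b, ofJet hb g = φ :=
  ⟨⟨_, iteratedFDeriv_mem_jet hadm.continuous hadm.pos hφ⟩,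
    DLinfC.ext_toFun (jetFun_iteratedFDeriv _)⟩

theorem continuous_cutMap_ofJet (hb : Dom cls M b) (hb0 : ∀ n, 0 ≤ b n) (f : DualL1 cls M η)
    (N : ℕ) : Continuous fun g : Jet η b => f (cutMap N (ofJet hb g)) := by
  refine continuous_iff_continuousAt.2 fun g₀ => ?_
  rw [ContinuousAt, tendsto_iff_norm_sub_tendsto_zero, Metric.tendsto_nhds]
  intro ε hε
  have hcb := hb.cutBound (d := d) hadm.mseq
  obtain ⟨m, δ, hδ, H⟩ := f.exists_norm_le_of_small (hcb.add (mpos M η) hcb) (half_pos hε)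
  have h1 : ∀ᶠ g : Jet η b in 𝓝 g₀, ∀ n ∈ Finset.range m, ∀ x,
      ‖iteratedFDeriv ℝ n (cut d N * (jetFun g.1 - jetFun g₀.1)) x‖ ≤ δ * η x :=
    (Filter.eventually_all_finset _).2 fun n _ =>
      eventually_cut_mul_jet_sub_le N g₀ hb0 n hadm.continuous hadm.pos hδ
  filter_upwards [h1] with g hg
  have h2 : ‖f (cutMap N (ofJet hb g)) - f (cutMap N (ofJet hb g₀))‖ ≤ ε / 2 := by
    rw [← map_sub]
    refine H _ (sub_mem_ball (cutMap_mem_ball (ofJet_mem_ball hb g) N)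
      (cutMap_mem_ball (ofJet_mem_ball hb g₀) N)) fun n hn x => ?_
    have e : (cutMap N (ofJet hb g) - cutMap N (ofJet hb g₀)).toFun =
        cut d N * (jetFun g.1 - jetFun g₀.1) := by
      rw [DSpace.toFun_sub, toFun_cutMap, toFun_cutMap, mul_sub]
      rfl
    rw [e]
    exact hg n (Finset.mem_range.2 hn) x
  rw [dist_zero_right, norm_norm]
  linarith

/-- The pairing is a uniform limit on the ball of the continuous maps `f (χ_N ·)`. With
`isCompact_jet`, balls are compact in the weak topology of the pairing. -/
theorem continuous_pairing_ofJet (hb : Dom cls M b) (hb0 : ∀ n, 0 ≤ b n) (f : DualL1 cls M η) :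
    Continuous fun g : Jet η b => pairing f (ofJet hb g) := by
  obtain ⟨s, hs, H⟩ := exists_pairing_bound f hb
  have h : TendstoUniformly (fun N (g : Jet η b) => f (cutMap N (ofJet hb g)))
      (fun g => pairing f (ofJet hb g)) atTop := by
    rw [Metric.tendstoUniformly_iff]
    intro ε hε
    filter_upwards [hs.eventually_lt_const hε] with N hN g
    rw [dist_comm, dist_eq_norm]
    exact (H _ (ofJet_mem_ball hb g) N).trans_lt hN
  exact h.continuous (Frequently.of_forall fun N => continuous_cutMap_ofJet hb hb0 f N)

theorem smul_mem_ball {φ : Rd d → ℂ} {c : ℂ} (hc : ‖c‖ ≤ 1)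
    (hφ : φ ∈ Ball η b) : c • φ ∈ Ball η b :=
  ⟨contDiff_const.smul hφ.1, fun n x => by
    rw [iteratedFDeriv_smul_fun hφ.1, norm_smul]
    exact (mul_le_of_le_one_left (norm_nonneg _) hc).trans (hφ.2 n x)⟩

theorem combination_mem_ball {φ ψ : Rd d → ℂ} {s t : ℝ} (hs : 0 ≤ s) (ht : 0 ≤ t)
    (hst : s + t = 1) (hφ : φ ∈ Ball η b) (hψ : ψ ∈ Ball η b) :
    (s : ℂ) • φ + (t : ℂ) • ψ ∈ Ball η b := by
  have h1 : ContDiff ℝ ∞ ((s : ℂ) • φ) := contDiff_const.smul hφ.1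
  have h2 : ContDiff ℝ ∞ ((t : ℂ) • ψ) := contDiff_const.smul hψ.1
  refine ⟨h1.add h2, fun n x => ?_⟩
  rw [iteratedFDeriv_add_fun h1 h2, iteratedFDeriv_smul_fun hφ.1, iteratedFDeriv_smul_fun hψ.1]
  refine (norm_add_le _ _).trans ?_
  rw [norm_smul, norm_smul, Complex.norm_real, Complex.norm_real, Real.norm_eq_abs,
    Real.norm_eq_abs, abs_of_nonneg hs, abs_of_nonneg ht]
  have h3 := mul_le_mul_of_nonneg_left (hφ.2 n x) hs
  have h4 := mul_le_mul_of_nonneg_left (hψ.2 n x) ht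
  calc _ ≤ s * (b n * η x) + t * (b n * η x) := add_le_add h3 h4
    _ = _ := by rw [← add_mul, hst, one_mul]

/-- A functional on `D'^*_{L^1_η}` that is dominated by the supremum over the elements of a set
`Ball η b` is the pairing with an element of `D^*_{L^∞_η}`. -/
theorem exists_eq_pairing (hb : Dom cls M b) (hb0 : ∀ n, 0 ≤ b n) (u : DualL1 cls M η →ₗ[ℂ] ℂ)
    (hu : ∀ (f : DualL1 cls M η) (c : ℝ),
      (∀ ψ : Bdot cls M η, ψ.toFun ∈ Ball η b → ‖f ψ‖ ≤ c) → ‖u f‖ ≤ c) :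
    ∃ φ : DLinfC cls M η, ∀ f, pairing f φ = u f := by
  have : CompactSpace (Jet η b) := isCompact_iff_compactSpace.1 isCompact_jet
  let J : Jet η b → DualL1 cls M η →ₗ[ℂ] ℂ := fun g =>
    { toFun := fun f => pairing f (ofJet hb g)
      map_add' := fun f f' => pairing_add_left f f' _
      map_smul' := fun c f => pairing_smul_left c f _ }
  obtain ⟨g, hg⟩ := exists_eq_of_forall_norm_le J (continuous_pairing_ofJet hb hb0)
    (fun g g' s t hs ht hst => by
      obtain ⟨k, hk⟩ := exists_ofJet_eq hb
        (φ := (s : ℂ) • ofJet hb g + (t : ℂ) • ofJet hb g')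
        (combination_mem_ball hs ht hst (ofJet_mem_ball hb g) (ofJet_mem_ball hb g'))
      refine ⟨k, fun f => ?_⟩
      change pairing f (ofJet hb k) = _
      rw [hk, pairing_add_right, pairing_smul_right, pairing_smul_right]
      rfl)
    (fun g c hc => by
      obtain ⟨k, hk⟩ := exists_ofJet_eq hb (φ := c • ofJet hb g)
        (smul_mem_ball hc (ofJet_mem_ball hb g))
      refine ⟨k, fun f => ?_⟩
      change pairing f (ofJet hb k) = _
      rw [hk, pairing_smul_right]
      rfl)
    u fun f c hc => hu f c fun ψ hψ => by
      obtain ⟨g, hg⟩ := exists_ofJet_eq hb (φ := incl ψ) (by rwa [toFun_incl])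
      have h1 : ‖pairing f (ofJet hb g)‖ ≤ c := hc g
      rwa [hg, pairing_incl] at h1
  exact ⟨ofJet hb g, hg⟩

end Pairing

end Ultra
end

open scoped Pointwise
noncomputable section
namespace Ultra

variable {d : ℕ} {cls : UltraClass} {M : ℕ → ℝ} {η : Rd d → ℝ}

/-! ### Bounded sets are contained in balls -/

section Functionals

theorem mderiv_zero_index (φ : Rd d → ℂ) (x : Rd d) : mderiv (0 : Fin d → ℕ) φ x = φ x := by
  have key : ∀ n : ℕ, n = 0 → ∀ v : Fin n → Rd d, iteratedFDeriv ℝ n φ x v = φ x := by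
    rintro n rfl v
    simp
  exact key _ (by simp) _

/-- An equicontinuous sequence of linear functionals is dominated by a continuous seminorm. -/
theorem exists_seminorm_of_equicontinuous (F : ℕ → Bdot cls M η →ₗ[ℂ] ℂ)
    (h : match cls, F with
      | .beurling, F => ∃ m > 0, ∀ n ψ, ‖F n ψ‖ ≤ stepNorm M η m ψ.toFun
      | .roumieu, F => ∀ m > 0, ∃ C : ℝ, ∀ n ψ, ψ.toFun ∈ step M η (CW η) m →
        ‖F n ψ‖ ≤ C * stepNorm M η m ψ.toFun) :
    ∃ p : Seminorm ℂ (Bdot cls M η), IsLimitSeminorm cls M η (CW η) p ∧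
      ∀ n ψ, ‖F n ψ‖ ≤ p ψ := by
  let q : ℕ → Seminorm ℂ (Bdot cls M η) := fun n => (normSeminorm ℂ ℂ).comp (F n)
  have hbdd : BddAbove (Set.range q) := by
    rw [Seminorm.bddAbove_range_iff]
    intro ψ
    cases cls with
    | beurling =>
      obtain ⟨m, hm, H⟩ := h
      exact ⟨_, by rintro _ ⟨n, rfl⟩; exact H n ψ⟩
    | roumieu =>
      obtain ⟨m, hm, hψ⟩ := ψ.2
      obtain ⟨C, H⟩ := h m hm
      exact ⟨_, by rintro _ ⟨n, rfl⟩; exact H n ψ hψ⟩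
  have happ : ∀ ψ, (⨆ n, q n) ψ = ⨆ n, ‖F n ψ‖ := fun ψ => by
    rw [Seminorm.coe_iSup_eq hbdd, iSup_apply]
    rfl
  refine ⟨⨆ n, q n, ?_, fun n ψ => ?_⟩
  · cases cls with
    | beurling =>
      obtain ⟨m, hm, H⟩ := h
      refine ⟨m, hm, 1, fun ψ => ?_⟩
      rw [happ, one_mul]
      exact ciSup_le fun n => H n ψ
    | roumieu =>
      intro m hm
      obtain ⟨C, H⟩ := h m hm
      refine ⟨C, fun ψ hψ => ?_⟩
      rw [happ]
      exact ciSup_le fun n => H n ψ hψ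
  · rw [happ]
    exact le_ciSup (f := fun n => ‖F n ψ‖) (Seminorm.bddAbove_range_iff.1 hbdd ψ) n

/-- The base is at most `1` as soon as `n ≥ 1 / m`, whatever the exponents are. This gives
equicontinuity on every step space in the Roumieu case. -/
theorem exists_pow_bound {m : ℝ} (hm : 0 < m) (k : ℕ → ℕ) :
    ∃ C : ℝ, ∀ n : ℕ, (1 / ((n : ℝ) + 1) / m) ^ k n ≤ C := by
  obtain ⟨N, hN⟩ := exists_nat_gt (1 / m)
  refine ⟨1 + ∑ n ∈ Finset.range N, (1 / ((n : ℝ) + 1) / m) ^ k n, fun n => ?_⟩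
  have h0 : ∀ n ∈ Finset.range N, 0 ≤ (1 / ((n : ℝ) + 1) / m) ^ k n := fun n _ => by positivity
  by_cases hn : n < N
  · have := Finset.single_le_sum h0 (Finset.mem_range.2 hn)
    linarith
  · have h1 : (1 / ((n : ℝ) + 1) / m) ^ k n ≤ 1 := by
      refine pow_le_one₀ (by positivity) ?_
      rw [div_right_comm, div_le_one (by positivity)]
      have : (N : ℝ) ≤ n := by exact_mod_cast not_lt.1 hn
      linarith
    have := Finset.sum_nonneg h0
    linarith

variable [hadm : Admissible M η]

/-- A multiple of the derivative `∂^α` at a point, as a linear functional on `Ḃ^*_η`. -/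
def derivFunctional (a : ℂ) (α : Fin d → ℕ) (x : Rd d) : Bdot cls M η →ₗ[ℂ] ℂ where
  toFun ψ := a * mderiv α ψ.toFun x
  map_add' φ ψ := by
    obtain ⟨_, -, h1⟩ := φ.exists_ball
    obtain ⟨_, -, h2⟩ := ψ.exists_ball
    rw [DSpace.toFun_add, mderiv_add α h1.1 h2.1, Pi.add_apply, mul_add]
  map_smul' c φ := by
    obtain ⟨_, -, h1⟩ := φ.exists_ball
    rw [DSpace.toFun_smul, mderiv_smul α c h1.1, Pi.smul_apply, smul_eq_mul, RingHom.id_apply,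
      smul_eq_mul, mul_left_comm]

theorem derivFunctional_apply (a : ℂ) (α : Fin d → ℕ) (x : Rd d) (ψ : Bdot cls M η) :
    derivFunctional a α x ψ = a * mderiv α ψ.toFun x := rfl

/-- A set of smooth functions that is not bounded in the class `*` is unbounded on an
equicontinuous sequence of derivatives of delta functions. -/
theorem exists_derivFunctional_unbounded {S : Set (Rd d → ℂ)} (hS : ∀ φ ∈ S, ContDiff ℝ ∞ φ)
    (h : ¬ ∃ b, Dom cls M b ∧ S ⊆ Ball η b) :
    ∃ (a : ℕ → ℂ) (α : ℕ → Fin d → ℕ) (x : ℕ → Rd d) (φ : ℕ → Rd d → ℂ), (∀ n, φ n ∈ S) ∧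
      (∀ n, 4 ^ n < ‖a n * mderiv (α n) (φ n) (x n)‖) ∧
      ∃ p : Seminorm ℂ (Bdot cls M η), IsLimitSeminorm cls M η (CW η) p ∧
        ∀ n ψ, ‖derivFunctional (cls := cls) (M := M) (η := η) (a n) (α n) (x n) ψ‖ ≤ p ψ := by
  have hM := mpos M η
  have hη := hadm.pos
  have hnorm : ∀ (m : ℝ) (α : Fin d → ℕ) (x : Rd d), 0 < m →
      ‖((m ^ (∑ j, α j) / (M (∑ j, α j) * η x) : ℝ) : ℂ)‖ =
        m ^ (∑ j, α j) / (M (∑ j, α j) * η x) := by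
    intro m α x hm
    have := hM (∑ j, α j)
    have := hη x
    rw [Complex.norm_real, Real.norm_eq_abs, abs_of_nonneg (by positivity)]
  have hlarge : ∀ (m C : ℝ) (α : Fin d → ℕ) (x : Rd d) (φ : Rd d → ℂ), 0 < m →
      C * M (∑ j, α j) / m ^ (∑ j, α j) * η x < ‖mderiv α φ x‖ →
      C < ‖((m ^ (∑ j, α j) / (M (∑ j, α j) * η x) : ℝ) : ℂ) * mderiv α φ x‖ := by
    intro m C α x φ hm hlt
    have h1 := hM (∑ j, α j)
    have h2 := hη x
    rw [norm_mul, hnorm m α x hm, div_mul_eq_mul_div, lt_div_iff₀ (by positivity)]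
    rw [div_mul_eq_mul_div, div_lt_iff₀ (by positivity)] at hlt
    linarith
  have hsmall : ∀ (m m' : ℝ) (α : Fin d → ℕ) (x : Rd d) (φ : Rd d → ℂ), 0 < m → 0 < m' →
      φ ∈ step M η (CW η) m' →
      ‖((m ^ (∑ j, α j) / (M (∑ j, α j) * η x) : ℝ) : ℂ) * mderiv α φ x‖ ≤
        (m / m') ^ (∑ j, α j) * stepNorm M η m' φ := by
    intro m m' α x φ hm hm' hφ
    have h1 := hM (∑ j, α j)
    have h2 := hη x
    rw [norm_mul, hnorm m α x hm]
    calc _ ≤ m ^ (∑ j, α j) / (M (∑ j, α j) * η x) *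
          (stepNorm M η m' φ * M (∑ j, α j) / m' ^ (∑ j, α j) * η x) := by
          gcongr
          exact le_stepNorm hM hη hm' hφ α x
      _ = _ := by
          rw [div_pow]
          field_simp
  cases cls with
  | beurling =>
    have h1 : ∃ m : ℝ, 0 < m ∧ ∀ C : ℝ, ∃ φ ∈ S, ∃ α x,
        C * M (∑ j, α j) / m ^ (∑ j, α j) * η x < ‖mderiv α φ x‖ := by
      by_contra hcon
      push Not at hcon
      exact h (exists_ball (cls := .beurling) hM hη hS hcon)
    obtain ⟨m, hm, H⟩ := h1
    -- With the growth `4 ^ n`, a factor `2 ^ n` survives the damping by `2 ^ (-n)` in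
    -- `exists_compactConvexCircled`.
    choose φ hφ α x hx using fun n : ℕ => H (4 ^ n)
    refine ⟨_, α, x, φ, hφ, fun n => hlarge m _ _ _ _ hm (hx n), ?_⟩
    refine exists_seminorm_of_equicontinuous (cls := .beurling) _ ⟨m, hm, fun n ψ => ?_⟩
    refine (hsmall m m (α n) (x n) ψ.toFun hm hm (ψ.mem_step hm)).trans (le_of_eq ?_)
    rw [div_self hm.ne', one_pow, one_mul]
  | roumieu =>
    have h1 : ∀ m : ℝ, 0 < m → ∀ C : ℝ, ∃ φ ∈ S, ∃ α x,
        C * M (∑ j, α j) / m ^ (∑ j, α j) * η x < ‖mderiv α φ x‖ := by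
      by_contra hcon
      push Not at hcon
      obtain ⟨m, hm, C, hC⟩ := hcon
      exact h (exists_ball (cls := .roumieu) hM hη hS ⟨m, hm, C, hC⟩)
    have hpos : ∀ n : ℕ, 0 < 1 / ((n : ℝ) + 1) := fun n => by positivity
    -- The parameter `1 / (n + 1)` tends to zero, so that a single sequence of functionals is
    -- bounded on every step space.
    choose φ hφ α x hx using fun n : ℕ => h1 (1 / ((n : ℝ) + 1)) (hpos n) (4 ^ n)
    refine ⟨_, α, x, φ, hφ, fun n => hlarge _ _ _ _ _ (hpos n) (hx n), ?_⟩
    refine exists_seminorm_of_equicontinuous (cls := .roumieu) _ fun m hm => ?_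
    obtain ⟨C, hC⟩ := exists_pow_bound hm fun n => ∑ j, α n j
    refine ⟨C, fun n ψ hψ => ?_⟩
    refine (hsmall _ m (α n) (x n) ψ.toFun (hpos n) hm hψ).trans ?_
    exact mul_le_mul_of_nonneg_right (hC n) (stepNorm_nonneg hM hη hm _)

theorem dom_zero : Dom cls M 0 := by
  cases cls with
  | beurling => exact fun m _ => ⟨0, fun n => by simp⟩
  | roumieu => exact ⟨1, one_pos, 0, fun n => by simp⟩

/-- Bounded subsets of `Ḃ^*_η` are bounded in the class `*`. -/
theorem exists_ball_of_isVonNBounded {S : Set (Bdot cls M η)}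
    (hS : Bornology.IsVonNBounded ℂ S) :
    ∃ b, Dom cls M b ∧ (∀ n, 0 ≤ b n) ∧ ∀ ψ ∈ S, ψ.toFun ∈ Ball η b := by
  rcases S.eq_empty_or_nonempty with rfl | ⟨ψ₀, hψ₀⟩
  · exact ⟨0, dom_zero, fun _ => le_rfl, by simp⟩
  by_contra hcon
  have h1 : ¬ ∃ b, Dom cls M b ∧ DSpace.toFun '' S ⊆ Ball η b := by
    rintro ⟨b, hb, h⟩
    exact hcon ⟨b, hb, nonneg_of_mem_ball hadm.pos (h ⟨ψ₀, hψ₀, rfl⟩),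
      fun ψ hψ => h ⟨ψ, hψ, rfl⟩⟩
  obtain ⟨a, α, x, φ, hφ, hlt, p, hp, hle⟩ := exists_derivFunctional_unbounded (cls := cls)
    (M := M) (η := η) (by
      rintro _ ⟨ψ, -, rfl⟩
      obtain ⟨_, -, h⟩ := ψ.exists_ball
      exact h.1) h1
  obtain ⟨r, -, hr⟩ := (DSpace.withSeminorms.isVonNBounded_iff_seminorm_bounded.1 hS) ⟨p, hp⟩
  obtain ⟨n, hn⟩ := pow_unbounded_of_one_lt r (show (1 : ℝ) < 4 by norm_num)
  obtain ⟨ψ, hψ, hψ'⟩ := hφ n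
  have h2 := hlt n
  rw [← hψ'] at h2
  have h3 := hle n ψ
  rw [derivFunctional_apply] at h3
  have h4 := hr ψ hψ
  exact absurd (hn.trans (h2.trans_le (h3.trans h4.le))) (lt_irrefl r)

end Functionals

/-! ### Compact convex circled sets in the dual -/

section CompactSets

/-- The absolutely convergent series with terms dominated by a geometric series form a compact
convex circled set. -/
theorem exists_compactConvexCircled (F : ℕ → Bdot cls M η →ₗ[ℂ] ℂ)
    {p : Seminorm ℂ (Bdot cls M η)} (hp : IsLimitSeminorm cls M η (CW η) p)
    (hF : ∀ n ψ, ‖F n ψ‖ ≤ p ψ) :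
    ∃ K ∈ compactConvexCircled cls M η, ∀ n, ∃ f ∈ K, ∀ ψ, f ψ = (1 / 2 : ℂ) ^ n * F n ψ := by
  classical
  -- The set is the image of the compact product of unit discs under `c ↦ ∑ 2 ^ (-n) c_n F_n`;
  -- convexity and circledness are inherited from the discs.
  let B : Type := ℕ → Metric.closedBall (0 : ℂ) 1
  have hB : ∀ (c : B) n, ‖(c n : ℂ)‖ ≤ 1 := fun c n => mem_closedBall_zero_iff.1 (c n).2
  have hterm : ∀ (c : B) ψ n, ‖(1 / 2 : ℂ) ^ n * (c n * F n ψ)‖ ≤ (1 / 2 : ℝ) ^ n * p ψ := by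
    intro c ψ n
    rw [norm_mul, norm_mul, norm_pow]
    have h1 : ‖(1 / 2 : ℂ)‖ = 1 / 2 := by norm_num
    rw [h1]
    gcongr
    calc ‖(c n : ℂ)‖ * ‖F n ψ‖ ≤ 1 * p ψ := by
          gcongr
          · exact hB c n
          · exact hF n ψ
      _ = _ := one_mul _
  have hgeo : ∀ t : ℝ, Summable fun n : ℕ => (1 / 2 : ℝ) ^ n * t := fun t =>
    summable_geometric_two.mul_right t
  have hsum : ∀ (c : B) ψ, Summable fun n => (1 / 2 : ℂ) ^ n * (c n * F n ψ) := fun c ψ =>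
    Summable.of_norm_bounded (hgeo (p ψ)) (hterm c ψ)
  let L : B → Bdot cls M η →ₗ[ℂ] ℂ := fun c =>
    { toFun := fun ψ => ∑' n, (1 / 2 : ℂ) ^ n * (c n * F n ψ)
      map_add' := fun ψ χ => by
        rw [← (hsum c ψ).tsum_add (hsum c χ)]
        exact tsum_congr fun n => by rw [map_add]; ring
      map_smul' := fun t ψ => by
        rw [RingHom.id_apply, smul_eq_mul, ← tsum_mul_left]
        exact tsum_congr fun n => by rw [map_smul, smul_eq_mul]; ring }
  have hL : ∀ c ψ, L c ψ = ∑' n, (1 / 2 : ℂ) ^ n * (c n * F n ψ) := fun _ _ => rfl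
  have hLp : ∀ c ψ, ‖L c ψ‖ ≤ ((2 : NNReal) • p) ψ := by
    intro c ψ
    rw [hL]
    refine (tsum_of_norm_bounded ((hasSum_geometric_two).mul_right (p ψ)) (hterm c ψ)).trans ?_
    rw [smul_apply, NNReal.smul_def, smul_eq_mul]
    rfl
  let G : B → DualL1 cls M η := fun c => dualOfLe (L c) _ (hp.smul 2) (hLp c)
  have hG : ∀ c ψ, G c ψ = ∑' n, (1 / 2 : ℂ) ^ n * (c n * F n ψ) := fun _ _ => rfl
  have hcont : Continuous G := by
    refine continuous_iff_continuousAt.2 fun c₀ => ?_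
    rw [ContinuousAt, ← tendsto_sub_nhds_zero_iff,
      ContinuousLinearMap.hasBasis_nhds_zero.tendsto_right_iff]
    rintro ⟨S, V⟩ ⟨hS, hV⟩
    obtain ⟨ε, hε, hεV⟩ := Metric.mem_nhds_iff.1 hV
    obtain ⟨r, hr0, hr⟩ := (DSpace.withSeminorms.isVonNBounded_iff_seminorm_bounded.1 hS) ⟨p, hp⟩
    -- On a bounded set `p` is below `r`, so the difference from the functional at `c₀` is uniformly
    -- dominated there by this series, which is continuous in `c` and zero at `c₀`.
    have hc : Continuous fun c : B => ∑' n, (1 / 2 : ℝ) ^ n * (‖(c n : ℂ) - c₀ n‖ * r) := by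
      refine continuous_tsum (u := fun n => (1 / 2 : ℝ) ^ n * (2 * r)) (fun n => ?_) (hgeo _)
        fun n c => ?_
      · exact continuous_const.mul ((((continuous_subtype_val.comp
          (continuous_apply n)).sub continuous_const).norm).mul continuous_const)
      · have h1 := (norm_sub_le (c n : ℂ) (c₀ n)).trans (add_le_add (hB c n) (hB c₀ n))
        rw [Real.norm_eq_abs, abs_of_nonneg (by positivity)]
        gcongr
        linarith
    have h0 : ∑' n, (1 / 2 : ℝ) ^ n * (‖(c₀ n : ℂ) - c₀ n‖ * r) = 0 := by simp
    have h1 := (hc.tendsto c₀).eventually_lt_const (u := ε) (by rw [h0]; exact hε)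
    filter_upwards [h1] with c hc ψ hψ
    refine hεV ?_
    rw [mem_ball_zero_iff]
    refine lt_of_le_of_lt ?_ hc
    rw [sub_apply, hG, hG, ← (hsum c ψ).tsum_sub (hsum c₀ ψ)]
    have hle : ∀ n, ‖(1 / 2 : ℂ) ^ n * (c n * F n ψ) - (1 / 2 : ℂ) ^ n * (c₀ n * F n ψ)‖ ≤
        (1 / 2 : ℝ) ^ n * (‖(c n : ℂ) - c₀ n‖ * r) := by
      intro n
      have h2 : (1 / 2 : ℂ) ^ n * (c n * F n ψ) - (1 / 2 : ℂ) ^ n * (c₀ n * F n ψ) =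
          (1 / 2 : ℂ) ^ n * (((c n : ℂ) - c₀ n) * F n ψ) := by ring
      have h3 : ‖(1 / 2 : ℂ)‖ = 1 / 2 := by norm_num
      rw [h2, norm_mul, norm_mul, norm_pow, h3]
      gcongr
      exact (hF n ψ).trans (hr ψ hψ).le
    have hs : Summable fun n => (1 / 2 : ℝ) ^ n * (‖(c n : ℂ) - c₀ n‖ * r) := by
      refine Summable.of_nonneg_of_le (fun n => by positivity) (fun n => ?_) (hgeo (2 * r))
      have h1 := (norm_sub_le (c n : ℂ) (c₀ n)).trans (add_le_add (hB c n) (hB c₀ n))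
      gcongr
      linarith
    exact tsum_of_norm_bounded hs.hasSum hle
  refine ⟨Set.range G, ⟨isCompact_range hcont, ?_, ?_⟩, fun n => ?_⟩
  · rintro _ ⟨c, rfl⟩ _ ⟨c', rfl⟩ s t hs ht hst
    have hmem : ∀ n, (s : ℂ) * c n + t * c' n ∈ Metric.closedBall (0 : ℂ) 1 := fun n => by
      have := (convex_closedBall (0 : ℂ) 1) (c n).2 (c' n).2 hs ht hst
      simpa using this
    refine ⟨fun n => ⟨_, hmem n⟩, ContinuousLinearMap.ext fun ψ => ?_⟩
    have e : (s • G c + t • G c') ψ = (s : ℂ) * G c ψ + t * G c' ψ := rfl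
    rw [e, hG, hG, hG, ← tsum_mul_left, ← tsum_mul_left,
      ← ((hsum c ψ).mul_left _).tsum_add ((hsum c' ψ).mul_left _)]
    exact tsum_congr fun n => by ring
  · rintro a ha _ ⟨_, ⟨c, rfl⟩, rfl⟩
    have hmem : ∀ n, a * c n ∈ Metric.closedBall (0 : ℂ) 1 := fun n => by
      rw [mem_closedBall_zero_iff, norm_mul]
      exact mul_le_one₀ ha (norm_nonneg _) (hB c n)
    refine ⟨fun n => ⟨_, hmem n⟩, ContinuousLinearMap.ext fun ψ => ?_⟩
    have e : (a • G c) ψ = a * G c ψ := rfl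
    rw [e, hG, hG, ← tsum_mul_left]
    exact tsum_congr fun n => by ring
  · let c : B := fun k => if k = n then ⟨1, by simp⟩ else ⟨0, by simp⟩
    refine ⟨G c, ⟨c, rfl⟩, fun ψ => ?_⟩
    rw [hG, tsum_eq_single n]
    · simp [c]
    · intro k hk
      simp [c, hk]

theorem span_isCompact_convex_balanced {E : Type*} [AddCommGroup E] [Module ℂ E]
    [TopologicalSpace E] [ContinuousSMul ℂ E] (f : E) :
    IsCompact ((fun c : ℂ => c • f) '' Metric.closedBall 0 1) ∧
      Convex ℝ ((fun c : ℂ => c • f) '' Metric.closedBall 0 1) ∧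
      Balanced ℂ ((fun c : ℂ => c • f) '' Metric.closedBall 0 1) := by
  refine ⟨(isCompact_closedBall _ _).image (continuous_id.smul continuous_const), ?_, ?_⟩
  · exact (convex_closedBall (0 : ℂ) 1).linear_image
      ((LinearMap.toSpanSingleton ℂ E f).restrictScalars ℝ)
  · rintro a ha _ ⟨_, ⟨c, hc, rfl⟩, rfl⟩
    refine ⟨a * c, ?_, mul_smul a c f⟩
    rw [mem_closedBall_zero_iff] at hc ⊢
    rw [norm_mul]
    exact mul_le_one₀ ha (norm_nonneg _) hc

theorem exists_isCompact_convex_balanced_superset {E : Type*} [AddCommGroup E] [Module ℂ E]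
    [TopologicalSpace E] [IsTopologicalAddGroup E] {K K' : Set E}
    (hK : IsCompact K ∧ Convex ℝ K ∧ Balanced ℂ K)
    (hK' : IsCompact K' ∧ Convex ℝ K' ∧ Balanced ℂ K') :
    ∃ L : Set E, (IsCompact L ∧ Convex ℝ L ∧ Balanced ℂ L) ∧ K ⊆ L ∧ K' ⊆ L := by
  rcases K.eq_empty_or_nonempty with rfl | hne
  · exact ⟨K', hK', Set.empty_subset _, subset_rfl⟩
  rcases K'.eq_empty_or_nonempty with rfl | hne'
  · exact ⟨K, hK, subset_rfl, Set.empty_subset _⟩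
  exact ⟨K + K', ⟨hK.1.add hK'.1, hK.2.1.add hK'.2.1, hK.2.2.add hK'.2.2⟩,
    Set.subset_add_left K (hK'.2.2.zero_mem hne'), Set.subset_add_right K' (hK.2.2.zero_mem hne)⟩

theorem span_mem_compactConvexCircled (f : DualL1 cls M η) :
    (fun c : ℂ => c • f) '' Metric.closedBall 0 1 ∈ compactConvexCircled cls M η :=
  span_isCompact_convex_balanced f

theorem directedOn_compactConvexCircled :
    DirectedOn (· ⊆ ·) (compactConvexCircled cls M η) := fun K hK K' hK' => by
  obtain ⟨L, hL, h, h'⟩ := exists_isCompact_convex_balanced_superset (K := K) (K' := K') hK hK'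
  exact ⟨L, hL, h, h'⟩

end CompactSets

end Ultra
end

noncomputable section
namespace Ultra

variable {d : ℕ} {cls : UltraClass} {M : ℕ → ℝ} {η : Rd d → ℝ} [hadm : Admissible M η]

/-! ### Identification of the bidual -/

section Bidual

theorem exists_delta (cls : UltraClass) (M : ℕ → ℝ) (η : Rd d → ℝ) [hadm : Admissible M η]
    (x : Rd d) : ∃ δ : DualL1 cls M η, ∀ ψ : Bdot cls M η, δ ψ = ψ.toFun x := by
  have hM := mpos M η
  have hδ : ∀ ψ : Bdot cls M η, derivFunctional 1 0 x ψ = ψ.toFun x := fun ψ => by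
    rw [derivFunctional_apply, one_mul, mderiv_zero_index]
  have hbd : ∀ m > 0, ∀ φ ∈ step M η (CW η) m, ‖φ x‖ ≤ M 0 * η x * stepNorm M η m φ := by
    intro m hm φ hφ
    have h := le_stepNorm hM hadm.pos hm hφ 0 x
    rw [mderiv_zero_index] at h
    simp only [Pi.zero_apply, Finset.sum_const_zero, pow_zero, div_one] at h
    linarith
  have hp : IsLimitSeminorm cls M η (CW η)
      ((normSeminorm ℂ ℂ).comp (derivFunctional (cls := cls) (M := M) (η := η) 1 0 x)) := by
    cases cls with
    | beurling =>
      refine ⟨1, one_pos, M 0 * η x, fun ψ => ?_⟩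
      rw [Seminorm.comp_apply, coe_normSeminorm, hδ]
      exact hbd 1 one_pos _ (ψ.mem_step one_pos)
    | roumieu =>
      refine fun m hm => ⟨M 0 * η x, fun ψ hψ => ?_⟩
      rw [Seminorm.comp_apply, coe_normSeminorm, hδ]
      exact hbd m hm _ hψ
  exact ⟨dualOfLe (derivFunctional 1 0 x) _ hp fun ψ => le_rfl, hδ⟩

theorem pairing_delta {x : Rd d} {δ : DualL1 cls M η} (hδ : ∀ ψ : Bdot cls M η, δ ψ = ψ.toFun x)
    (φ : DLinfC cls M η) : pairing δ φ = φ.toFun x := by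
  have h : pairing δ φ = 1 * mderiv 0 φ.toFun x :=
    pairing_of_mderiv (fun ψ => by rw [hδ, one_mul, mderiv_zero_index]) φ
  rw [h, one_mul, mderiv_zero_index]

/-- A set of elements of `D^*_{L^∞_η}` that is bounded in the class `*` is bounded on a
neighbourhood of zero. -/
theorem eventually_norm_pairing_le {b : ℕ → ℝ} (hb : Dom cls M b) {ε : ℝ} (hε : 0 < ε) :
    ∀ᶠ f : DualL1 cls M η in 𝓝 0, ∀ φ : DLinfC cls M η, φ.toFun ∈ Ball η b →
      ‖pairing f φ‖ ≤ ε := by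
  -- The products `χ_N φ`, over all `N` and all `φ` in the ball, form a bounded set in `Ḃ^*_η`, so
  -- strong neighbourhoods of zero control them simultaneously.
  have hS : Bornology.IsVonNBounded ℂ
      {ψ : Bdot cls M η | ∃ (N : ℕ) (φ : DLinfC cls M η), φ.toFun ∈ Ball η b ∧ cutMap N φ = ψ} :=
    isVonNBounded_of_ball (mpos M η) hadm.pos (hb.cutBound (d := d) hadm.mseq) (by
      rintro _ ⟨N, φ, hφ, rfl⟩
      exact cutMap_mem_ball hφ N)
  filter_upwards [ContinuousLinearMap.eventually_nhds_zero_mapsTo hS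
    (Metric.closedBall_mem_nhds (0 : ℂ) hε)] with f hf φ hφ
  exact norm_pairing_le fun N => mem_closedBall_zero_iff.1 (hf ⟨N, φ, hφ, rfl⟩)

/-- The continuous functional on `D'^*_{L^1_η}` given by an element of `D^*_{L^∞_η}`. -/
def bidualFunctional (φ : DLinfC cls M η) : StrongDual ℂ (DualL1 cls M η) where
  toFun f := pairing f φ
  map_add' f g := pairing_add_left f g φ
  map_smul' c f := pairing_smul_left c f φ
  cont := by
    let L : DualL1 cls M η →ₗ[ℂ] ℂ :=
      { toFun := fun f => pairing f φ
        map_add' := fun f g => pairing_add_left f g φ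
        map_smul' := fun c f => pairing_smul_left c f φ }
    refine continuous_of_continuousAt_zero L ?_
    obtain ⟨b, hb, hφ⟩ := φ.exists_ball
    rw [ContinuousAt, map_zero, Metric.nhds_basis_closedBall.tendsto_right_iff]
    intro ε hε
    filter_upwards [eventually_norm_pairing_le hb hε] with f hf
    exact mem_closedBall_zero_iff.2 (hf φ hφ)

theorem bidualFunctional_apply (φ : DLinfC cls M η) (f : DualL1 cls M η) :
    bidualFunctional φ f = pairing f φ := rfl

theorem isBidualRep_bidualFunctional (φ : DLinfC cls M η) :
    IsBidualRep (bidualFunctional φ) φ := fun x => by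
  obtain ⟨δ, hδ⟩ := exists_delta cls M η x
  exact ⟨δ, hδ, pairing_delta hδ φ⟩

theorem Dom.const_mul {b : ℕ → ℝ} (hb : Dom cls M b) {s : ℝ} (hs : 0 ≤ s) :
    Dom cls M fun n => s * b n :=
  hb.map 1 one_pos fun m _ C hC => ⟨s * C, fun n => by
    rw [div_one, mul_assoc, mul_div_assoc]
    exact mul_le_mul_of_nonneg_left (hC n) hs⟩

/-- The continuous functionals on `D'^*_{L^1_η}` are given by the elements of `D^*_{L^∞_η}`. -/
theorem exists_bidualFunctional_eq (u : StrongDual ℂ (DualL1 cls M η)) :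
    ∃ φ : DLinfC cls M η, bidualFunctional φ = u := by
  have hu : {f : DualL1 cls M η | ‖u f‖ < 1} ∈ 𝓝 0 := by
    have := (u.continuous.norm.tendsto 0).eventually_lt_const (u := 1) (by simp)
    exact this
  obtain ⟨⟨S, V⟩, ⟨hS, hV⟩, hSV⟩ := ContinuousLinearMap.hasBasis_nhds_zero.mem_iff.1 hu
  obtain ⟨r, hr, hrV⟩ := Metric.mem_nhds_iff.1 hV
  obtain ⟨b, hb, hb0, hSb⟩ := exists_ball_of_isVonNBounded hS
  -- If `|f| < r` on `S` implies `|u f| < 1`, then `|u f|` is at most the supremum of `|f|` over `S`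
  -- scaled by `1 / r`; the factor `2` is slack.
  have hs : 0 < 2 / r := by positivity
  obtain ⟨φ, hφ⟩ := exists_eq_pairing (hb.const_mul hs.le)
    (fun n => mul_nonneg hs.le (hb0 n)) u.toLinearMap (by
      intro f c hf
      have hc : 0 ≤ c := by
        have h0 : (0 : Bdot cls M η).toFun ∈ Ball η fun n => 2 / r * b n := by
          have h1 : (0 : Bdot cls M η).toFun = 0 := rfl
          rw [h1]
          refine ⟨contDiff_const, fun n x => ?_⟩
          have h2 : iteratedFDeriv ℝ n (0 : Rd d → ℂ) x = 0 :=
            congrFun iteratedFDeriv_fun_zero x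
          rw [h2, norm_zero]
          exact mul_nonneg (mul_nonneg hs.le (hb0 n)) (hadm.pos x).le
        simpa using hf 0 h0
      -- Normalising by `c + ε` rather than `c` covers the case `c = 0` and makes the inequalities
      -- strict.
      refine le_of_forall_pos_le_add fun ε hε => ?_
      have hc' : 0 < c + ε := by linarith
      have hmem : ((c + ε : ℝ) : ℂ)⁻¹ • f ∈ {f : DualL1 cls M η | ‖u f‖ < 1} := by
        refine hSV fun ψ hψ => hrV ?_
        have h1 : (((2 / r : ℝ) : ℂ) • ψ).toFun ∈ Ball η fun n => 2 / r * b n := by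
          have h2 := hSb ψ hψ
          refine ⟨contDiff_const.smul h2.1, fun n x => ?_⟩
          rw [DSpace.toFun_smul, iteratedFDeriv_smul_fun h2.1, norm_smul, Complex.norm_real,
            Real.norm_eq_abs, abs_of_pos hs, mul_assoc]
          exact mul_le_mul_of_nonneg_left (h2.2 n x) hs.le
        have h3 := hf _ h1
        rw [map_smul, norm_smul, Complex.norm_real, Real.norm_eq_abs, abs_of_pos hs] at h3
        rw [mem_ball_zero_iff]
        have e : (((c + ε : ℝ) : ℂ)⁻¹ • f) ψ = ((c + ε : ℝ) : ℂ)⁻¹ * f ψ := rfl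
        rw [e, norm_mul, norm_inv, Complex.norm_real, Real.norm_eq_abs, abs_of_pos hc',
          inv_mul_lt_iff₀ hc']
        rw [div_mul_eq_mul_div, div_le_iff₀ hr] at h3
        nlinarith
      have h4 : ‖u (((c + ε : ℝ) : ℂ)⁻¹ • f)‖ < 1 := hmem
      rw [map_smul, norm_smul, norm_inv, Complex.norm_real, Real.norm_eq_abs, abs_of_pos hc',
        inv_mul_lt_iff₀ hc', mul_one] at h4
      exact h4.le)
  exact ⟨φ, ContinuousLinearMap.ext hφ⟩

/-- Every functional is the pairing with some function, and its values at the `δ_x` determine that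
function. This yields uniqueness without a separate density argument for the `δ_x`. -/
theorem IsBidualRep.eq_bidualFunctional {u : StrongDual ℂ (DualL1 cls M η)} {φ : DLinfC cls M η}
    (h : IsBidualRep u φ) : u = bidualFunctional φ := by
  obtain ⟨φ', rfl⟩ := exists_bidualFunctional_eq u
  have e : φ' = φ := DLinfC.ext_toFun (funext fun x => by
    obtain ⟨δ, hδ, h1⟩ := h x
    rw [← h1, bidualFunctional_apply, pairing_delta hδ])
  rw [e]

theorem existsUnique_isBidualRep (φ : DLinfC cls M η) :
    ∃! u : StrongDual ℂ (DualL1 cls M η), IsBidualRep u φ :=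
  ⟨bidualFunctional φ, isBidualRep_bidualFunctional φ, fun _ h => h.eq_bidualFunctional⟩

theorem toBidual_eq (φ : DLinfC cls M η) : toBidual φ = bidualFunctional φ := by
  have h : ∃ u, IsBidualRep u φ := ⟨_, isBidualRep_bidualFunctional φ⟩
  rw [toBidual, dif_pos h]
  exact h.choose_spec.eq_bidualFunctional

end Bidual

end Ultra
end

noncomputable section
namespace Ultra

variable {d : ℕ} {cls : UltraClass} {M : ℕ → ℝ} {η : Rd d → ℝ} [hadm : Admissible M η]

/-! ### The strong dual of `D^*_{L^∞_η,c}` -/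

section StrongDual

theorem DLinfC.hasBasis_nhds_zero : (𝓝 (0 : DLinfC cls M η)).HasBasis
    (fun Kε : Set (DualL1 cls M η) × ℝ => Kε.1 ∈ compactConvexCircled cls M η ∧ 0 < Kε.2)
    fun Kε => {φ | ∀ f ∈ Kε.1, ‖pairing f φ‖ < Kε.2} := by
  have h0 : UniformConvergenceCLM.ofFun (RingHom.id ℂ) ℂ (compactConvexCircled cls M η)
      (toBidual (0 : DLinfC cls M η)) = 0 := by
    refine UniformConvergenceCLM.ext _ _ fun f => ?_
    have h1 : pairing f (0 : DLinfC cls M η) = 0 := by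
      have := pairing_smul_right f 0 (0 : DLinfC cls M η)
      rwa [zero_smul, zero_mul] at this
    rw [toBidual_eq]
    exact h1
  have h1 := (UniformConvergenceCLM.hasBasis_nhds_zero_of_basis (RingHom.id ℂ) ℂ
    (compactConvexCircled cls M η) ⟨_, span_mem_compactConvexCircled 0⟩
    directedOn_compactConvexCircled (Metric.nhds_basis_ball (x := (0 : ℂ))))
  rw [nhds_induced, h0]
  refine (h1.comap _).to_hasBasis (fun Kε h => ⟨Kε, h, fun φ hφ f hf => ?_⟩)
    fun Kε h => ⟨Kε, h, fun φ hφ f hf => ?_⟩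
  · have e : UniformConvergenceCLM.ofFun (RingHom.id ℂ) ℂ (compactConvexCircled cls M η)
        (toBidual φ) f = pairing f φ := by rw [toBidual_eq]; rfl
    rw [e]
    exact mem_ball_zero_iff.2 (hφ f hf)
  · have e : UniformConvergenceCLM.ofFun (RingHom.id ℂ) ℂ (compactConvexCircled cls M η)
        (toBidual φ) f = pairing f φ := by rw [toBidual_eq]; rfl
    have h2 := hφ f hf
    rw [e] at h2
    exact mem_ball_zero_iff.1 h2

/-- Bounded subsets of `D^*_{L^∞_η,c}` are bounded in the class `*`. -/
theorem DLinfC.exists_ball_of_isVonNBounded {B : Set (DLinfC cls M η)}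
    (hB : Bornology.IsVonNBounded ℂ B) :
    ∃ b, Dom cls M b ∧ ∀ φ ∈ B, φ.toFun ∈ Ball η b := by
  by_contra hcon
  have h1 : ¬ ∃ b, Dom cls M b ∧ DLinfC.toFun '' B ⊆ Ball η b := fun ⟨b, hb, h⟩ =>
    hcon ⟨b, hb, fun φ hφ => h ⟨φ, hφ, rfl⟩⟩
  obtain ⟨a, α, x, φ, hφ, hlt, p, hp, hle⟩ := exists_derivFunctional_unbounded (cls := cls)
    (M := M) (η := η) (by
      rintro _ ⟨φ, -, rfl⟩
      obtain ⟨_, -, h⟩ := φ.exists_ball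
      exact h.1) h1
  -- The damped functionals lie in one compact convex circled set `K`, whose polar must absorb `B`.
  -- If it does so with factor `2 ^ n`, the `n`-th damped functional is below `2 ^ n` on `B`, but it
  -- exceeds `2 ^ n` at the `n`-th chosen function.
  obtain ⟨K, hK, hKf⟩ := exists_compactConvexCircled
    (fun n => derivFunctional (cls := cls) (M := M) (η := η) (a n) (α n) (x n)) hp hle
  have hU := DLinfC.hasBasis_nhds_zero.mem_of_mem (i := (K, 1)) ⟨hK, one_pos⟩
  obtain ⟨r, hr⟩ := absorbs_iff_norm.1 (hB hU)
  obtain ⟨n, hn⟩ := pow_unbounded_of_one_lt (max r 1) (show (1 : ℝ) < 2 by norm_num)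
  obtain ⟨φ', hφB, hφ'⟩ := hφ n
  obtain ⟨f, hf, hfψ⟩ := hKf n
  have hnorm : ‖((2 : ℂ)) ^ n‖ = 2 ^ n := by rw [norm_pow]; norm_num
  obtain ⟨χ, hχ, hχφ⟩ := hr (2 ^ n) (by rw [hnorm]; exact (le_max_left _ _).trans hn.le) hφB
  have h2 : ‖pairing f χ‖ < 1 := hχ f hf
  have h3 : pairing f φ' = (2 : ℂ) ^ n * pairing f χ := by
    rw [← hχφ]
    exact pairing_smul_right f _ χ
  have h4 : pairing f φ' = (1 / 2 : ℂ) ^ n * a n * mderiv (α n) φ'.toFun (x n) :=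
    pairing_of_mderiv (fun ψ => by rw [hfψ, derivFunctional_apply, mul_assoc]) φ'
  have h5 := hlt n
  rw [← hφ'] at h5
  have h6 : ‖(1 / 2 : ℂ)‖ = 1 / 2 := by norm_num
  have h7 : ‖pairing f φ'‖ < 2 ^ n := by
    rw [h3, norm_mul, hnorm]
    exact mul_lt_of_lt_one_right (by positivity) h2
  rw [h4, mul_assoc, norm_mul, norm_pow, h6] at h7
  have h8 : (1 / 2 : ℝ) ^ n * 4 ^ n = 2 ^ n := by rw [← mul_pow]; norm_num
  have h9 : (1 / 2 : ℝ) ^ n * 4 ^ n <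
      (1 / 2 : ℝ) ^ n * ‖a n * mderiv (α n) φ'.toFun (x n)‖ := by gcongr
  linarith

/-- A compact set of functionals is bounded in the strong dual, hence uniformly bounded on bounded
subsets of `Ḃ^*_η`; so its polar absorbs their images. -/
theorem isVonNBounded_image_incl {S : Set (Bdot cls M η)} (hS : Bornology.IsVonNBounded ℂ S) :
    Bornology.IsVonNBounded ℂ (incl '' S) := by
  rw [DLinfC.hasBasis_nhds_zero.isVonNBounded_iff]
  rintro ⟨K, ε⟩ ⟨hK, hε⟩
  have h1 : Bornology.IsVonNBounded ℂ (Set.image2 (fun (f : DualL1 cls M η) ψ => f ψ) K S) :=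
    ContinuousLinearMap.isVonNBounded_image2_apply (hK.1.isVonNBounded ℂ) hS
  obtain ⟨R, hR, h2⟩ := (NormedSpace.isVonNBounded_iff ℂ).1 h1 |>.exists_pos_norm_lt
  refine absorbs_iff_norm.2 ⟨R / ε, fun c hc => ?_⟩
  have hc0 : 0 < ‖c‖ := (by positivity : 0 < R / ε).trans_le hc
  have hc1 : c ≠ 0 := norm_pos_iff.1 hc0
  rintro _ ⟨ψ, hψ, rfl⟩
  refine ⟨c⁻¹ • incl ψ, fun f hf => ?_, smul_inv_smul₀ hc1 _⟩
  have h3 := h2 _ ⟨f, hf, ψ, hψ, rfl⟩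
  rw [pairing_smul_right, pairing_incl, norm_mul, norm_inv, inv_mul_lt_iff₀ hc0]
  rw [div_le_iff₀ hε] at hc
  exact h3.trans_le hc

/-- The continuous functional on `D^*_{L^∞_η,c}` given by an element of `D'^*_{L^1_η}`. -/
def pairingFunctional (f : DualL1 cls M η) : StrongDual ℂ (DLinfC cls M η) where
  toFun φ := pairing f φ
  map_add' φ ψ := pairing_add_right f φ ψ
  map_smul' c φ := pairing_smul_right f c φ
  cont := by
    -- Each `f` lies in the compact convex circled set of its multiples by the closed unit disc, so
    -- evaluation at `f` is continuous.
    have h : ContinuousEvalConst (UniformConvergenceCLM (RingHom.id ℂ) ℂ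
        (compactConvexCircled cls M η)) (DualL1 cls M η) ℂ :=
      UniformConvergenceCLM.continuousEvalConst _ _ _ (Set.eq_univ_of_forall fun f =>
        ⟨_, span_mem_compactConvexCircled f, 1, by simp, one_smul _ _⟩)
    have h1 := (h.continuous_eval_const f).comp (continuous_induced_dom :
      Continuous fun φ : DLinfC cls M η => UniformConvergenceCLM.ofFun (RingHom.id ℂ) ℂ
        (compactConvexCircled cls M η) (toBidual φ))
    refine h1.congr fun φ => ?_
    rw [Function.comp_apply, toBidual_eq]
    rfl

/-- The map `f ↦ ⟨f, ·⟩` from `D'^*_{L^1_η}` to the dual of `D^*_{L^∞_η,c}`. -/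
def pairingLinear : DualL1 cls M η →ₗ[ℂ] StrongDual ℂ (DLinfC cls M η) where
  toFun := pairingFunctional
  map_add' f g := ContinuousLinearMap.ext (pairing_add_left f g)
  map_smul' c f := ContinuousLinearMap.ext (pairing_smul_left c f)

theorem pairingLinear_apply (f : DualL1 cls M η) (φ : DLinfC cls M η) :
    pairingLinear f φ = pairing f φ := rfl

theorem pairingLinear_incl (f : DualL1 cls M η) (ψ : Bdot cls M η) :
    pairingLinear f (incl ψ) = f ψ := by
  rw [pairingLinear_apply, pairing_incl]

theorem pairingLinear_injective :
    Function.Injective (pairingLinear : DualL1 cls M η →ₗ[ℂ] _) := fun f g h =>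
  ContinuousLinearMap.ext fun ψ => by
    rw [← pairingLinear_incl f, h, pairingLinear_incl]

/-- Continuous functionals on `D^*_{L^∞_η,c}` are given by elements of `D'^*_{L^1_η}`, according to
the Mackey–Arens theorem. -/
theorem pairingLinear_surjective :
    Function.Surjective (pairingLinear : DualL1 cls M η →ₗ[ℂ] _) := by
  intro T
  have hT : {φ : DLinfC cls M η | ‖T φ‖ < 1} ∈ 𝓝 0 :=
    (T.continuous.norm.tendsto 0).eventually_lt_const (u := 1) (by simp)
  obtain ⟨⟨K₀, ε⟩, ⟨hK₀, hε⟩, hKT₀⟩ := DLinfC.hasBasis_nhds_zero.mem_iff.1 hT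
  -- Enlarging `K₀` so that it contains `0` makes it nonempty, which forces `0 ≤ c` below.
  obtain ⟨K, hK, hK₀K, h0K⟩ := directedOn_compactConvexCircled K₀ hK₀ _
    (span_mem_compactConvexCircled (0 : DualL1 cls M η))
  have h0 : (0 : DualL1 cls M η) ∈ K := h0K ⟨0, by simp, zero_smul ℂ (0 : DualL1 cls M η)⟩
  have hKT : ∀ φ : DLinfC cls M η, (∀ f ∈ K, ‖pairing f φ‖ < ε) → ‖T φ‖ < 1 := fun φ h =>
    hKT₀ (show φ ∈ {φ | ∀ f ∈ K₀, ‖pairing f φ‖ < ε} from fun f hf => h f (hK₀K hf))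
  have : CompactSpace K := isCompact_iff_compactSpace.1 hK.1
  have hs : 0 < 2 / ε := by positivity
  -- `T` is dominated by the supremum over `K` scaled by `1 / ε`, with a slack factor `2`. The
  -- pairings with a fixed `φ` are continuous on `K`, so `T` is the pairing with an element of the
  -- scaled set.
  let J : K → DLinfC cls M η →ₗ[ℂ] ℂ := fun k =>
    (pairingLinear (((2 / ε : ℝ) : ℂ) • k.1)).toLinearMap
  have hJ : ∀ k φ, J k φ = ((2 / ε : ℝ) : ℂ) * pairing k.1 φ := fun k φ =>
    pairing_smul_left _ k.1 φ
  obtain ⟨k, hk⟩ := exists_eq_of_forall_norm_le J (fun φ => by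
      simp only [hJ]
      exact continuous_const.mul ((bidualFunctional φ).continuous.comp continuous_subtype_val))
    (fun k k' s t hs ht hst => by
      refine ⟨⟨s • k.1 + t • k'.1, hK.2.1 k.2 k'.2 hs ht hst⟩, fun φ => ?_⟩
      have e : pairing (s • k.1 + t • k'.1) φ = s * pairing k.1 φ + t * pairing k'.1 φ := by
        rw [pairing_add_left]
        exact congrArg₂ _ (pairing_smul_left (s : ℂ) k.1 φ) (pairing_smul_left (t : ℂ) k'.1 φ)
      rw [hJ, hJ, hJ, e]
      ring)
    (fun k c hc => by
      refine ⟨⟨c • k.1, hK.2.2 c hc ⟨k.1, k.2, rfl⟩⟩, fun φ => ?_⟩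
      rw [hJ, hJ, pairing_smul_left]
      ring)
    T.toLinearMap (fun φ c h => by
      have hc : 0 ≤ c := (norm_nonneg _).trans (h ⟨0, h0⟩)
      refine le_of_forall_pos_le_add fun δ hδ => ?_
      have hc' : 0 < c + δ := by linarith
      have h4 : ‖T (((c + δ : ℝ) : ℂ)⁻¹ • φ)‖ < 1 := by
        refine hKT _ fun f hf => ?_
        have h3 := h ⟨f, hf⟩
        rw [hJ, norm_mul, Complex.norm_real, Real.norm_eq_abs, abs_of_pos hs, div_mul_eq_mul_div,
          div_le_iff₀ hε] at h3
        rw [pairing_smul_right, norm_mul, norm_inv, Complex.norm_real, Real.norm_eq_abs,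
          abs_of_pos hc', inv_mul_lt_iff₀ hc']
        nlinarith
      rw [map_smul, norm_smul, norm_inv, Complex.norm_real, Real.norm_eq_abs, abs_of_pos hc',
        inv_mul_lt_iff₀ hc', mul_one] at h4
      exact h4.le)
  exact ⟨_, ContinuousLinearMap.ext hk⟩

/-- Bounded sets of `D^*_{L^∞_η,c}` lie in balls, and on a ball the pairing is uniformly small for
`f` near zero. -/
theorem pairingLinear_continuous :
    Continuous (pairingLinear : DualL1 cls M η →ₗ[ℂ] StrongDual ℂ (DLinfC cls M η)) := by
  refine continuous_of_continuousAt_zero _ ?_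
  rw [ContinuousAt, map_zero, (ContinuousLinearMap.hasBasis_nhds_zero_of_basis
    Metric.nhds_basis_closedBall).tendsto_right_iff]
  rintro ⟨B, ε⟩ ⟨hB, hε⟩
  obtain ⟨b, hb, h⟩ := DLinfC.exists_ball_of_isVonNBounded hB
  filter_upwards [eventually_norm_pairing_le hb hε] with f hf φ hφ
  exact mem_closedBall_zero_iff.2 (hf φ (h φ hφ))

/-- The algebraic isomorphism of the dual of `D^*_{L^∞_η,c}` with `D'^*_{L^1_η}`. -/
def dualLinearEquiv : StrongDual ℂ (DLinfC cls M η) ≃ₗ[ℂ] DualL1 cls M η :=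
  (LinearEquiv.ofBijective pairingLinear
    ⟨pairingLinear_injective, pairingLinear_surjective⟩).symm

theorem dualLinearEquiv_apply (T : StrongDual ℂ (DLinfC cls M η)) (ψ : Bdot cls M η) :
    dualLinearEquiv T ψ = T (incl ψ) := by
  rw [← pairingLinear_incl]
  exact congrArg (fun T : StrongDual ℂ (DLinfC cls M η) => T (incl ψ))
    ((LinearEquiv.ofBijective pairingLinear
      ⟨pairingLinear_injective, pairingLinear_surjective⟩).apply_symm_apply T)

theorem dualLinearEquiv_continuous :
    Continuous (dualLinearEquiv : StrongDual ℂ (DLinfC cls M η) ≃ₗ[ℂ] DualL1 cls M η) := by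
  refine continuous_of_continuousAt_zero dualLinearEquiv ?_
  rw [ContinuousAt, map_zero, (ContinuousLinearMap.hasBasis_nhds_zero).tendsto_right_iff]
  rintro ⟨S, V⟩ ⟨hS, hV⟩
  filter_upwards [ContinuousLinearMap.eventually_nhds_zero_mapsTo (isVonNBounded_image_incl hS) hV]
    with T hT ψ hψ
  rw [dualLinearEquiv_apply]
  exact hT ⟨ψ, hψ, rfl⟩

/-- The isomorphism of the strong dual of `D^*_{L^∞_η,c}` with `D'^*_{L^1_η}`. -/
def dualEquiv : StrongDual ℂ (DLinfC cls M η) ≃L[ℂ] DualL1 cls M η where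
  toLinearEquiv := dualLinearEquiv
  continuous_toFun := dualLinearEquiv_continuous
  continuous_invFun := pairingLinear_continuous

end StrongDual

end Ultra
end

theorem mainTheorem9 (d : ℕ) (cls : Ultra.UltraClass) (M A : ℕ → ℝ)
    (hM : Ultra.IsMSequence M) (hA : Ultra.IsASequence A)
    (η : Ultra.Rd d → ℝ) (hη : Ultra.IsUltraWeight cls A η) :
    (∀ φ : Ultra.DLinfC cls M η,
      ∃! u : StrongDual ℂ (Ultra.DualL1 cls M η), Ultra.IsBidualRep u φ) ∧
    ∃ e : StrongDual ℂ (Ultra.DLinfC cls M η) ≃L[ℂ] Ultra.DualL1 cls M η,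
      ∀ (T : StrongDual ℂ (Ultra.DLinfC cls M η)) (ψ : Ultra.Bdot cls M η),
        e T ψ = T (Ultra.incl ψ) := by
  have : Ultra.Admissible M η := ⟨hM, hη.continuous, hη.pos⟩
  exact ⟨Ultra.existsUnique_isBidualRep, Ultra.dualEquiv, Ultra.dualLinearEquiv_apply⟩
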